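/- Let $d\ge 2$ be an integer and let $\gamma,\beta,m$ be real numbers with $\gamma<d$, $\gamma-2<\beta<\frac{d-2}{d}\gamma$ and $m\in(0,1)$. Set $\sigma:=2+\beta-\gamma>0$ and $m_c:=\frac{d-2-\beta}{d-\gamma}\in(0,1)$. Consider the weighted fast diffusion equation $$u_\tau+|y|^\gamma\,\nabla\cdot\big(|y|^{-\beta}\,u\,\nabla u^{m-1}\big)=0,\qquad \tau>0,\ y\in\mathbb R^d. \tag{FD}$$ *Barenblatt solutions.* For $C>0$ and $T>0$ ($T\in\mathbb R$ is allowed if $m=m_c$) let $$U_{C,T}(\tau,y):=\frac{R(\tau)^{\gamma-d}}{\big(C+(|y|/R(\tau))^{\sigma}\big)^{1/(1-m)}},$$ where $$R(\tau)=\big[\sigma(d-\gamma)(m-m_c)(T+\tau)\big]^{\frac1{(d-\gamma)(m-m_c)}}\ (\tau\ge0)\quad\text{if } m>m_c,$$ $$R(\tau)=e^{T+\sigma\tau}\ (\tau\ge0)\quad\text{if } m=m_c,$$ $$R(\tau)=\big[\sigma(d-\gamma)(m_c-m)(T-\tau)\big]^{-\frac1{(d-\gamma)(m_c-m)}}\ (0\le\tau<T)\quad\text{if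 } m<m_c.$$ *Solutions.* Let $\mathrm L^{1,\gamma}:=\mathrm L^1(\mathbb R^d,|y|^{-\gamma}dy)$, and let $\mathrm L^{1,\gamma}_{\rm loc}$ be the corresponding space of functions that are integrable on bounded sets. A very weak solution with nonnegative bounded initial datum $u_0$ is a nonnegative function $u\in C([0,\infty);\mathrm L^{1,\gamma}_{\rm loc})\cap \mathrm L^\infty((0,\infty)\times\mathbb R^d)$ with $u(\tau)\to u_0$ in $\mathrm L^{1,\gamma}_{\rm loc}$ as $\tau\to0^+$ and $$-\int_0^\infty\!\!\int_{\mathbb R^d}u\,\varphi_\tau\,|y|^{-\gamma}\,dy\,d\tau=\frac{1-m}{m}\int_0^\infty\!\!\int_{\mathbb R^d}u^m\,\nabla\cdot\big(|y|^{-\beta}\nabla\varphi\big)\,dy\,d\tau\qquad\forall\,\varphi\in C_c^\infty((0,\infty)\times\mathbb R^d).$$ By a solution of (FD) with initial datum $u_0$ we mean a very weak solution $u$ obtained by truncation: for some smooth $\phi:\mathbb R^d\to[0,1]$ with $\phi(y)=1$ if $|y|\le1$ and $\phi(y)=0$ if $|y|>2$, one has $u_n(\tau)\to u(\tau)$ in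 $\mathrm L^{1,\gamma}_{\rm loc}$ for every $\tau\ge0$, where $u_n$, $n\ge1$, is the strong solution with initial datum $\phi(\cdot/n)\,u_0$. Here a strong solution is a nonnegative, bounded $v\in C([0,\infty);\mathrm L^{1,\gamma})$ with $v_\tau\in \mathrm L^1_{\rm loc}((0,\infty);\mathrm L^{1,\gamma})$ and $\nabla v^m\in \mathrm L^2_{\rm loc}((0,\infty);\mathrm L^2(\mathbb R^d,|y|^{-\beta}dy))$, which attains its initial datum at $\tau=0$ and satisfies $|y|^{-\gamma}v_\tau=\frac{1-m}{m}\nabla\cdot(|y|^{-\beta}\nabla v^m)$ in the sense of distributions on $\mathbb R^d$ for almost every $\tau>0$. *Initial datum.* Assume that (H1) there are constants $C_1>C_2>0$ and $T$ as above such that $U_{C_1,T}(0,y)\le u_0(y)\le U_{C_2,T}(0,y)$ for almost every $y\in\mathbb R^d$; (H2) there are $C\in[C_2,C_1]$ and $f\in \mathrm L^{1,\gamma}$ such that $u_0=U_{C,T}(0,\cdot)+f$ almost everywhere. **Proposition (conservation of relative mass).** Let $u$ be a solution of (FD) with initial datum $u_0$ satisfying (H1)–(H2). Then, for every $\tau\ge0$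 (with $\tau<T$ if $m<m_c$), the function $u(\tau)-U_{C,T}(\tau)$ belongs to $\mathrm L^{1,\gamma}$ and $$\int_{\mathbb R^d}\big[u(\tau,y)-U_{C,T}(\tau,y)\big]\frac{dy}{|y|^\gamma}=\int_{\mathbb R^d}\big[u_0(y)-U_{C,T}(0,y)\big]\frac{dy}{|y|^\gamma}.$$ The function $U_{C,T}(\tau)$ itself is not required to belong to $\mathrm L^{1,\gamma}$. -/

import Mathlib

open MeasureTheory Filter Topology Set
open scoped ContDiff

noncomputable section

namespace WFD

/-- The Euclidean space of dimension `d`. -/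
abbrev E (d : ℕ) := EuclideanSpace ℝ (Fin d)

/-- The critical exponent `(d - 2 - β) / (d - γ)`. -/
def mc (d : ℕ) (β γ : ℝ) : ℝ := ((d : ℝ) - 2 - β) / ((d : ℝ) - γ)

/-- The scaling factor `R` of the self-similar solutions, that is, the solution of
`R' = (2 + β - γ) R ^ (1 - a)`, where `a = (d - γ) (m - mc)`, with `R 0 ^ a = (2 + β - γ) |a| T` if
`m ≠ mc` and `R 0 = exp T` if `m = mc`.
If `m < mc` it is defined for `τ < T` only (values for `τ ≥ T` are meaningless). -/
def scaleR (d : ℕ) (m β γ T τ : ℝ) : ℝ :=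
  if mc d β γ < m then
    ((2 + β - γ) * (((d : ℝ) - γ) * (m - mc d β γ)) * (T + τ)) ^
      (1 / (((d : ℝ) - γ) * (m - mc d β γ)))
  else if m = mc d β γ then
    Real.exp (T + (2 + β - γ) * τ)
  else
    ((2 + β - γ) * (((d : ℝ) - γ) * (mc d β γ - m)) * (T - τ)) ^
      (-(1 / (((d : ℝ) - γ) * (mc d β γ - m))))

/-- The self-similar solution of Barenblatt type with parameters `C` and `T`. -/
def barenblatt (d : ℕ) (m β γ C T τ : ℝ) (y : E d) : ℝ :=
  scaleR d m β γ T τ ^ (γ - (d : ℝ)) /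
    (C + (‖y‖ / scaleR d m β γ T τ) ^ (2 + β - γ)) ^ (1 / (1 - m))

/-- `f` belongs to the space `L¹(|y|^(-γ) dy)`. -/
def MemL1w {d : ℕ} (γ : ℝ) (f : E d → ℝ) : Prop :=
  Integrable (fun y : E d => f y * ‖y‖ ^ (-γ))

/-- `f` belongs to the space of functions that are in `L¹(|y|^(-γ) dy)` on bounded sets. -/
def MemL1wLoc {d : ℕ} (γ : ℝ) (f : E d → ℝ) : Prop :=
  ∀ r : ℝ, IntegrableOn (fun y : E d => f y * ‖y‖ ^ (-γ)) (Metric.ball 0 r)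

/-- Convergence of `F i` to `f` along `l`, in `L¹(|y|^(-γ) dy)` on bounded sets. -/
def TendstoL1wLoc {d : ℕ} {ι : Type*} (γ : ℝ) (F : ι → E d → ℝ) (l : Filter ι)
    (f : E d → ℝ) : Prop :=
  ∀ r : ℝ, Tendsto (fun i => ∫ y in Metric.ball (0 : E d) r, |F i y - f y| * ‖y‖ ^ (-γ)) l (𝓝 0)

/-- The divergence of a vector field. -/
def divergence {d : ℕ} (V : E d → E d) (y : E d) : ℝ :=
  ∑ i : Fin d, (fderiv ℝ V y (EuclideanSpace.single i 1)) i

/-- The weighted Laplacian `∇ · (|y|^(-β) ∇ φ)`. -/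
def weightedLaplacian {d : ℕ} (β : ℝ) (φ : E d → ℝ) (y : E d) : ℝ :=
  divergence (fun z : E d => ‖z‖ ^ (-β) • gradient φ z) y

/-- Bounded very weak solutions `u` of
`u_τ + |y|^γ ∇ · (|y|^(-β) u ∇ u^(m-1)) = 0` on `(0, ∞) × ℝ^d` with initial datum `u₀`. -/
structure IsVeryWeakSolution {d : ℕ} (m β γ : ℝ) (u₀ : E d → ℝ) (u : ℝ → E d → ℝ) : Prop where
  nonneg : ∀ τ, 0 ≤ τ → ∀ᵐ y, 0 ≤ u τ y
  bounded : MemLp (fun p : ℝ × E d => u p.1 p.2) ⊤ ((volume.restrict (Ioi 0)).prod volume)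
  memL1wLoc : ∀ τ, 0 ≤ τ → MemL1wLoc γ (u τ)
  continuous : ∀ τ, 0 ≤ τ → TendstoL1wLoc γ u (𝓝[Ici 0] τ) (u τ)
  weak : ∀ φ : ℝ × E d → ℝ, ContDiff ℝ ∞ φ → HasCompactSupport φ →
    tsupport φ ⊆ Ioi (0 : ℝ) ×ˢ univ →
    -(∫ τ in Ioi (0 : ℝ), ∫ y, u τ y * deriv (fun s => φ (s, y)) τ * ‖y‖ ^ (-γ)) =
      (1 - m) / m *
        ∫ τ in Ioi (0 : ℝ), ∫ y, u τ y ^ m * weightedLaplacian β (fun z => φ (τ, z)) y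
  initial : TendstoL1wLoc γ u (𝓝[>] 0) u₀

/-- `G` is the weak gradient of `w` in `ℝ^d ∖ {0}` (the origin is left out because elements of
`L²(|y|^(-β) dy)` need not be locally integrable at the origin). -/
def IsWeakGradient {d : ℕ} (w : E d → ℝ) (G : E d → E d) : Prop :=
  ∀ ψ : E d → ℝ, ContDiff ℝ ∞ ψ → HasCompactSupport ψ → (0 : E d) ∉ tsupport ψ →
    IntegrableOn G (tsupport ψ) ∧ ∫ y, w y • gradient ψ y = -∫ y, ψ y • G y

/-- Strong solutions, with finite energy, of the Cauchy problem with nonnegative initial datum `v₀`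
in `L¹(|y|^(-γ) dy)` and `L^∞`: the solution is continuous on `[0, ∞)` with values in
`L¹(|y|^(-γ) dy)`, its time derivative `g` is in `L¹_loc((0, ∞); L¹(|y|^(-γ) dy))`, the spatial
gradient `G` of `v^m` is in `L²_loc((0, ∞); L²(|y|^(-β) dy))`, and
`|y|^(-γ) g = (1 - m) / m * ∇ · (|y|^(-β) G)` at almost every time. -/
structure IsStrongSolution {d : ℕ} (m β γ : ℝ) (v₀ : E d → ℝ) (v : ℝ → E d → ℝ) : Prop where
  nonneg : ∀ τ, 0 ≤ τ → ∀ᵐ y, 0 ≤ v τ y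
  bounded : MemLp (fun p : ℝ × E d => v p.1 p.2) ⊤ ((volume.restrict (Ioi 0)).prod volume)
  memL1w : ∀ τ, 0 ≤ τ → MemL1w γ (v τ)
  continuous : ∀ τ, 0 ≤ τ →
    Tendsto (fun s => ∫ y, |v s y - v τ y| * ‖y‖ ^ (-γ)) (𝓝[Ici 0] τ) (𝓝 0)
  initial : v 0 =ᵐ[volume] v₀
  equation : ∃ (g : ℝ → E d → ℝ) (G : ℝ → E d → E d),
    (∀ a b : ℝ, 0 < a → a ≤ b →
      Integrable (fun p : ℝ × E d => g p.1 p.2 * ‖p.2‖ ^ (-γ))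
        ((volume.restrict (Ioc a b)).prod volume) ∧
      ∀ᵐ y, v b y - v a y = ∫ s in a..b, g s y) ∧
    AEStronglyMeasurable (fun p : ℝ × E d => G p.1 p.2) ((volume.restrict (Ioi 0)).prod volume) ∧
    (∀ a b : ℝ, 0 < a → a ≤ b →
      Integrable (fun p : ℝ × E d => ‖G p.1 p.2‖ ^ 2 * ‖p.2‖ ^ (-β))
        ((volume.restrict (Ioc a b)).prod volume)) ∧
    (∀ᵐ τ ∂(volume.restrict (Ioi (0 : ℝ))), IsWeakGradient (fun y => v τ y ^ m) (G τ)) ∧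
    (∀ᵐ τ ∂(volume.restrict (Ioi (0 : ℝ))),
      ∀ φ : E d → ℝ, ContDiff ℝ ∞ φ → HasCompactSupport φ →
        ∫ y, g τ y * φ y * ‖y‖ ^ (-γ) =
          -((1 - m) / m * ∫ y, ‖y‖ ^ (-β) * inner ℝ (G τ y) (gradient φ y)))

/-- Smooth truncation functions: `0 ≤ φ ≤ 1`, `φ = 1` on the closed unit ball, `φ = 0` outside the
closed ball of radius `2`. -/
structure IsTruncation {d : ℕ} (φ : E d → ℝ) : Prop where
  smooth : ContDiff ℝ ∞ φ
  nonneg : ∀ y, 0 ≤ φ y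
  le_one : ∀ y, φ y ≤ 1
  eq_one : ∀ y, ‖y‖ ≤ 1 → φ y = 1
  eq_zero : ∀ y, 2 < ‖y‖ → φ y = 0

/-- Solutions with initial datum `u₀`: very weak solutions that are limits, locally in
`L¹(|y|^(-γ) dy)`, of the strong solutions with truncated initial data `φ(·/n) u₀`, `n ≥ 1`. -/
structure IsSolution {d : ℕ} (m β γ : ℝ) (u₀ : E d → ℝ) (u : ℝ → E d → ℝ) : Prop where
  isVeryWeakSolution : IsVeryWeakSolution m β γ u₀ u
  approximation : ∃ (φ : E d → ℝ) (v : ℕ → ℝ → E d → ℝ), IsTruncation φ ∧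
    (∀ n : ℕ, 1 ≤ n → IsStrongSolution m β γ (fun y => φ ((n : ℝ)⁻¹ • y) * u₀ y) (v n)) ∧
    ∀ τ, 0 ≤ τ → TendstoL1wLoc γ (fun n => v n τ) atTop (u τ)

/-- Assumption (H1) for given constants `T`, `C₁`, `C₂`. -/
def H1 {d : ℕ} (m β γ T C₁ C₂ : ℝ) (u₀ : E d → ℝ) : Prop :=
  (m ≠ mc d β γ → 0 < T) ∧ 0 < C₂ ∧ C₂ < C₁ ∧
    ∀ᵐ y, barenblatt d m β γ C₁ T 0 y ≤ u₀ y ∧ u₀ y ≤ barenblatt d m β γ C₂ T 0 y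

/-- Assumption (H2) for given constants `T`, `C₁`, `C₂` and `C`. -/
def H2 {d : ℕ} (m β γ T C₁ C₂ C : ℝ) (u₀ : E d → ℝ) : Prop :=
  C ∈ Icc C₂ C₁ ∧ ∃ f : E d → ℝ, MemL1w γ f ∧ ∀ᵐ y, u₀ y = barenblatt d m β γ C T 0 y + f y

end WFD

end

namespace WFD

theorem integral_euler_eq_zero {d : ℕ} {q : E d → ℝ} (hq : ContDiff ℝ 1 q)
    (hc : HasCompactSupport q) : ∫ y, ((d : ℝ) * q y + fderiv ℝ q y y) = 0 := by
  have hfc : HasCompactSupport (fderiv ℝ q) := hc.fderiv ℝ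
  have hcont : Continuous (fderiv ℝ q) := hq.continuous_fderiv one_ne_zero
  have hi : ∀ i : Fin d, ∫ y : E d, y i * fderiv ℝ q y (EuclideanSpace.single i 1) =
      -∫ y, q y := by
    intro i
    have hfd : ∀ y : E d, fderiv ℝ (fun y : E d => y i) y = EuclideanSpace.proj (𝕜 := ℝ) i :=
      fun y => (EuclideanSpace.proj (𝕜 := ℝ) i).fderiv
    have key := integral_mul_fderiv_eq_neg_fderiv_mul_of_integrable
      (μ := (volume : Measure (E d))) (f := fun y : E d => EuclideanSpace.proj (𝕜 := ℝ) i y)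
      (g := q) (v := EuclideanSpace.single i 1) ?_ ?_ ?_ ?_ ?_
    · simpa [hfd] using key
    · have : Integrable q := hq.continuous.integrable_of_hasCompactSupport hc
      simpa [hfd] using this
    · apply Continuous.integrable_of_hasCompactSupport
      · fun_prop
      · refine (hfc.comp_left (g := fun L : E d →L[ℝ] ℝ => L (EuclideanSpace.single i 1))
          (by simp)).mul_left
    · apply Continuous.integrable_of_hasCompactSupport
      · exact (by fun_prop : Continuous fun y : E d => EuclideanSpace.proj (𝕜 := ℝ) i y).mul
          hq.continuous
      · exact hc.mul_left
    · intro x _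
      exact (EuclideanSpace.proj (𝕜 := ℝ) i).differentiableAt
    · intro x _
      exact hq.differentiable one_ne_zero x
  have hsum : ∀ y : E d, fderiv ℝ q y y =
      ∑ i, y i * fderiv ℝ q y (EuclideanSpace.single i 1) := by
    intro y
    have h := congrArg (fderiv ℝ q y) ((EuclideanSpace.basisFun (Fin d) ℝ).sum_repr y)
    rw [← h]
    simp [map_sum]
  have hint : ∀ i : Fin d,
      Integrable fun y : E d => y i * fderiv ℝ q y (EuclideanSpace.single i 1) := by
    intro i
    apply Continuous.integrable_of_hasCompactSupport
    · fun_prop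
    · refine (hfc.comp_left (g := fun L : E d →L[ℝ] ℝ => L (EuclideanSpace.single i 1))
          (by simp)).mul_left
  simp_rw [hsum]
  rw [integral_add, integral_finsetSum]
  · simp [hi, integral_const_mul]
  · exact fun i _ => hint i
  · exact (hq.continuous.integrable_of_hasCompactSupport hc).const_mul _
  · exact integrable_finsetSum _ fun i _ => hint i

theorem tendsto_eLpNorm_translate_sub {d : ℕ} {F : Type*} [NormedAddCommGroup F]
    {A : E d → F} (hA : MemLp A 2) :
    Tendsto (fun h : E d => eLpNorm (fun x => A (x - h) - A x) 2 volume) (𝓝 0) (𝓝 0) := by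
  have hmp : ∀ h : E d, MeasurePreserving (fun x : E d => x - h) volume volume :=
    fun h => measurePreserving_sub_right volume h
  let g : E d → C(E d, E d) := fun h => ⟨fun x => x - h, by fun_prop⟩
  have hg : Tendsto g (𝓝 0) (𝓝 (g 0)) := by
    have : Continuous g := by
      apply ContinuousMap.continuous_of_continuous_uncurry
      simp only [g, Function.uncurry_def, ContinuousMap.coe_mk]
      fun_prop
    exact this.tendsto 0
  have key := Filter.Tendsto.compMeasurePreservingLp (E := F) (p := 2)
    (tendsto_const_nhds (x := hA.toLp A)) hg (fun h => hmp h) (hmp 0) (by norm_num)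
  rw [tendsto_iff_edist_tendsto_0] at key
  refine key.congr fun h => ?_
  rw [Lp.edist_def]
  apply eLpNorm_congr_ae
  have h1 := Lp.coeFn_compMeasurePreserving (hA.toLp A) (hmp h)
  have h2 := Lp.coeFn_compMeasurePreserving (hA.toLp A) (hmp 0)
  have h3 := (hmp h).quasiMeasurePreserving.ae_eq_comp hA.coeFn_toLp
  have h4 := (hmp 0).quasiMeasurePreserving.ae_eq_comp hA.coeFn_toLp
  filter_upwards [h1, h2, h3, h4] with x e1 e2 e3 e4
  simp only [Function.comp_apply] at e1 e2 e3 e4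
  simp only [Pi.sub_apply]
  change (Lp.compMeasurePreserving _ (hmp h) (hA.toLp A)) x -
    (Lp.compMeasurePreserving _ (hmp 0) (hA.toLp A)) x = _
  rw [e1, e2, e3, e4, sub_zero]

/-- Weighted `L¹` convergence of mollifications of square integrable functions. -/
theorem tendsto_lintegral_mul_convolution_sub {d : ℕ}
    {A : E d → E d} (hA : MemLp A 2) (hAint : Integrable A) {Q : E d → ℝ} (hQ : MemLp Q 2)
    {φ : ℕ → ContDiffBump (0 : E d)} (hφ : Tendsto (fun i => (φ i).rOut) atTop (𝓝 0)) :
    Tendsto (fun i => ∫⁻ x, ‖Q x‖ₑ * ‖(∫ h, (φ i).normed volume h • A (x - h)) - A x‖ₑ) atTop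
      (𝓝 0) := by
  have htr := tendsto_eLpNorm_translate_sub hA
  have hmeas : ∀ i, AEMeasurable (fun z : E d × E d =>
      ‖Q z.1‖ₑ * (‖(φ i).normed volume z.2‖ₑ * ‖A (z.1 - z.2) - A z.1‖ₑ)) (volume.prod volume) := by
    intro i
    have hQ' : AEMeasurable (fun z : E d × E d => ‖Q z.1‖ₑ) (volume.prod volume) :=
      (hQ.1.comp_fst).enorm
    have hA1 : AEStronglyMeasurable (fun z : E d × E d => A z.1) (volume.prod volume) :=
      hA.1.comp_fst
    have hA2 : AEStronglyMeasurable (fun z : E d × E d => A (z.1 - z.2)) (volume.prod volume) :=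
      hA.1.comp_quasiMeasurePreserving (quasiMeasurePreserving_sub volume volume)
    have hn : AEMeasurable (fun z : E d × E d => ‖(φ i).normed volume z.2‖ₑ)
        (volume.prod volume) := by
      have : Continuous fun z : E d × E d => (φ i).normed volume z.2 :=
        (φ i).continuous_normed.comp continuous_snd
      exact this.aestronglyMeasurable.enorm
    exact hQ'.mul (hn.mul (hA2.sub hA1).enorm)
  have hbound : ∀ i, ∫⁻ x, ‖Q x‖ₑ * ‖(∫ h, (φ i).normed volume h • A (x - h)) - A x‖ₑ ≤
      ∫⁻ h, ‖(φ i).normed volume h‖ₑ *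
        (eLpNorm Q 2 volume * eLpNorm (fun x => A (x - h) - A x) 2 volume) := by
    intro i
    calc ∫⁻ x, ‖Q x‖ₑ * ‖(∫ h, (φ i).normed volume h • A (x - h)) - A x‖ₑ
        ≤ ∫⁻ x, ∫⁻ h, ‖Q x‖ₑ * (‖(φ i).normed volume h‖ₑ * ‖A (x - h) - A x‖ₑ) := by
          apply lintegral_mono
          intro x
          dsimp only
          rw [lintegral_const_mul' _ _ (by simp)]
          gcongr
          have hAx : Integrable fun h => (φ i).normed volume h • A (x - h) := by
            have hb : Integrable fun h => A (x - h) := hAint.comp_sub_left x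
            obtain ⟨M, hM⟩ :=
              ((φ i).continuous_normed (μ := volume)).bounded_above_of_compact_support
              (φ i).hasCompactSupport_normed
            exact hb.bdd_smul M ((φ i).continuous_normed.aestronglyMeasurable)
              (Eventually.of_forall hM)
          have e : (∫ h, (φ i).normed volume h • A (x - h)) - A x =
              ∫ h, (φ i).normed volume h • (A (x - h) - A x) := by
            simp_rw [smul_sub]
            rw [integral_sub hAx ((φ i).integrable_normed.smul_const _), integral_smul_const,
              (φ i).integral_normed, one_smul]
          rw [e]
          refine (enorm_integral_le_lintegral_enorm _).trans (le_of_eq ?_)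
          simp_rw [enorm_smul]
      _ = ∫⁻ h, ∫⁻ x, ‖Q x‖ₑ * (‖(φ i).normed volume h‖ₑ * ‖A (x - h) - A x‖ₑ) :=
          lintegral_lintegral_swap (hmeas i)
      _ ≤ _ := by
          apply lintegral_mono
          intro h
          dsimp only
          have : ∀ x, ‖Q x‖ₑ * (‖(φ i).normed volume h‖ₑ * ‖A (x - h) - A x‖ₑ) =
            ‖(φ i).normed volume h‖ₑ * (‖Q x‖ₑ * ‖A (x - h) - A x‖ₑ) := fun x => by ring
          simp_rw [this]
          rw [lintegral_const_mul' _ _ (by simp)]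
          gcongr
          have hA2 : AEStronglyMeasurable (fun x => A (x - h) - A x) volume :=
            (hA.1.comp_measurePreserving (measurePreserving_sub_right volume h)).sub hA.1
          have := ENNReal.lintegral_mul_le_Lp_mul_Lq volume
            (Real.HolderConjugate.two_two) hQ.1.enorm hA2.enorm
          simpa [eLpNorm_eq_lintegral_rpow_enorm_toReal] using this
  rw [ENNReal.tendsto_nhds_zero]
  intro ε hε
  rcases eq_or_ne ε ⊤ with rfl | hεt
  · exact Eventually.of_forall fun _ => le_top
  have hQtop : eLpNorm Q 2 volume ≠ ⊤ := hQ.2.ne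
  have h1 : Tendsto (fun h : E d => eLpNorm Q 2 volume *
      eLpNorm (fun x => A (x - h) - A x) 2 volume) (𝓝 0) (𝓝 0) := by
    simpa using ENNReal.Tendsto.const_mul htr (Or.inr hQtop)
  have h2 : ∀ᶠ h in 𝓝 (0 : E d), eLpNorm Q 2 volume *
      eLpNorm (fun x => A (x - h) - A x) 2 volume ≤ ε := (ENNReal.tendsto_nhds_zero.1 h1) ε hε
  obtain ⟨δ, hδ, hball⟩ := Metric.eventually_nhds_iff_ball.1 h2
  filter_upwards [hφ.eventually (gt_mem_nhds hδ)] with i hi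
  refine (hbound i).trans ?_
  calc _ ≤ ∫⁻ h, ‖(φ i).normed volume h‖ₑ * ε := by
        apply lintegral_mono
        intro h
        dsimp only
        by_cases hh : h ∈ Metric.ball (0 : E d) δ
        · gcongr
          exact hball h hh
        · have : (φ i).normed volume h = 0 := by
            have : h ∉ Function.support ((φ i).normed volume) := by
              rw [(φ i).support_normed_eq]
              intro hm
              exact hh (Metric.ball_subset_ball hi.le hm)
            simpa using this
          simp [this]
    _ = ε := by
        rw [lintegral_mul_const' _ _ hεt]
        have : ∫⁻ h, ‖(φ i).normed volume h‖ₑ = 1 := by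
          have h3 := ofReal_integral_norm_eq_lintegral_enorm
            ((φ i).integrable_normed (μ := (volume : Measure (E d))))
          rw [← h3]
          have : ∀ x, ‖(φ i).normed volume x‖ = (φ i).normed volume x := fun x =>
            Real.norm_of_nonneg ((φ i).nonneg_normed x)
          simp_rw [this, (φ i).integral_normed]
          simp
        rw [this, one_mul]

end WFD

open scoped Convolution

namespace WFD

theorem gradient_mul {d : ℕ} {f g : E d → ℝ} {y : E d} (hf : DifferentiableAt ℝ f y)
    (hg : DifferentiableAt ℝ g y) :
    gradient (fun z => f z * g z) y = f y • gradient g y + g y • gradient f y := by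
  simp only [gradient]
  rw [fderiv_fun_mul hf hg]
  simp

theorem inner_gradient {d : ℕ} (f : E d → ℝ) (y v : E d) :
    inner ℝ (gradient f y) v = fderiv ℝ f y v := by
  simp [gradient, InnerProductSpace.toDual_symm_apply]

theorem continuous_gradient {d : ℕ} {f : E d → ℝ} (hf : ContDiff ℝ 1 f) :
    Continuous (gradient f) :=
  (InnerProductSpace.toDual ℝ (E d)).symm.continuous.comp (hf.continuous_fderiv one_ne_zero)

theorem tsupport_gradient_subset {d : ℕ} (f : E d → ℝ) : tsupport (gradient f) ⊆ tsupport f := by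
  refine (closure_mono ?_).trans (tsupport_fderiv_subset ℝ (f := f))
  intro y hy
  simp only [Function.mem_support, gradient] at hy ⊢
  intro h
  exact hy (by simp [h])

theorem hasCompactSupport_gradient {d : ℕ} {f : E d → ℝ} (hf : HasCompactSupport f) :
    HasCompactSupport (gradient f) :=
  hf.of_isClosed_subset (isClosed_tsupport _) (tsupport_gradient_subset f)

theorem hasCompactSupport_fun_smul_right {X F : Type*} [TopologicalSpace X] [NormedAddCommGroup F]
    [NormedSpace ℝ F] {a : X → ℝ} (ha : HasCompactSupport a) (k : X → F) :
    HasCompactSupport fun y => a y • k y := by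
  refine ha.mono fun y hy => ?_
  simp only [Function.mem_support] at hy ⊢
  intro h
  exact hy (by rw [h, zero_smul])

theorem hasCompactSupport_fun_smul_left {X F : Type*} [TopologicalSpace X] [NormedAddCommGroup F]
    [NormedSpace ℝ F] (a : X → ℝ) {k : X → F} (hk : HasCompactSupport k) :
    HasCompactSupport fun y => a y • k y := by
  refine hk.mono fun y hy => ?_
  simp only [Function.mem_support] at hy ⊢
  intro h
  exact hy (by rw [h, smul_zero])

theorem integrable_bdd_smul {d : ℕ} {F : Type*} [NormedAddCommGroup F] [NormedSpace ℝ F]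
    {W : E d → ℝ} {M : ℝ}
    (hW : AEStronglyMeasurable W) (hWb : ∀ᵐ y, |W y| ≤ M) {k : E d → F} (hk : Continuous k)
    (hkc : HasCompactSupport k) : Integrable fun y => W y • k y :=
  (hk.integrable_of_hasCompactSupport hkc).bdd_smul M hW hWb

theorem integral_cutoff_smul_gradient {d : ℕ} {W : E d → ℝ} {H : E d → E d} {M : ℝ}
    (hW : AEStronglyMeasurable W) (hWb : ∀ᵐ y, |W y| ≤ M) (hWH : IsWeakGradient W H)
    {χ : E d → ℝ} (hχ : ContDiff ℝ ∞ χ) (hχc : HasCompactSupport χ) (hχ0 : (0 : E d) ∉ tsupport χ)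
    {ζ : E d → ℝ} (hζ : ContDiff ℝ ∞ ζ) :
    ∫ y, (χ y * W y) • gradient ζ y =
      -∫ y, ζ y • (χ y • H y + W y • gradient χ y) := by
  have hζ1 : ContDiff ℝ 1 ζ := hζ.of_le (by simp)
  have hχ1 : ContDiff ℝ 1 χ := hχ.of_le (by simp)
  have hs : tsupport (fun y => χ y * ζ y) ⊆ tsupport χ := tsupport_mul_subset_left
  have hc : HasCompactSupport fun y => χ y * ζ y := hχc.mul_right
  obtain ⟨hint, heq⟩ := hWH (fun y => χ y * ζ y) (hχ.mul hζ) hc (fun h => hχ0 (hs h))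
  have hg : ∀ y, gradient (fun z => χ z * ζ z) y = χ y • gradient ζ y + ζ y • gradient χ y :=
    fun y => gradient_mul (hχ.differentiable (by simp) y) (hζ.differentiable (by simp) y)
  have i1 : Integrable fun y => W y • (χ y • gradient ζ y) := by
    refine integrable_bdd_smul hW hWb (hχ.continuous.smul (continuous_gradient hζ1)) ?_
    exact hasCompactSupport_fun_smul_right hχc _
  have i2 : Integrable fun y => W y • (ζ y • gradient χ y) := by
    refine integrable_bdd_smul hW hWb (hζ.continuous.smul (continuous_gradient hχ1)) ?_
    exact hasCompactSupport_fun_smul_left _ (hasCompactSupport_gradient hχc)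
  have i3 : Integrable fun y => (χ y * ζ y) • H y := by
    obtain ⟨N, hN⟩ := (hχ.mul hζ).continuous.bounded_above_of_compact_support hc
    rw [← integrableOn_iff_integrable_of_support_subset (s := tsupport fun y => χ y * ζ y)]
    · exact hint.bdd_smul N (hχ.mul hζ).continuous.aestronglyMeasurable (Eventually.of_forall hN)
    · intro y hy
      apply subset_tsupport
      simp only [Function.mem_support] at hy ⊢
      intro h
      exact hy (by rw [h, zero_smul])
  simp_rw [hg, smul_add] at heq
  rw [integral_add i1 i2] at heq
  have e1 : ∫ y, (χ y * W y) • gradient ζ y = ∫ y, W y • (χ y • gradient ζ y) := by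
    congr 1; ext1 y; rw [smul_smul, mul_comm]
  have e2 : ∫ y, ζ y • (χ y • H y + W y • gradient χ y) =
      ∫ y, ((χ y * ζ y) • H y + W y • (ζ y • gradient χ y)) := by
    congr 1; ext1 y; rw [smul_add, smul_smul, smul_smul, smul_smul, mul_comm (ζ y), mul_comm (ζ y)]
  rw [e1, e2, integral_add i3 i2, eq_sub_of_add_eq heq]
  abel

/-- If `∫ w ∇ζ = -∫ ζ A` for all test functions, mollification commutes with taking gradients. -/
theorem gradient_convolution_eq {d : ℕ} {w : E d → ℝ} {A : E d → E d} (hw : Integrable w)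
    (hA : ∀ ζ : E d → ℝ, ContDiff ℝ ∞ ζ → ∫ y, w y • gradient ζ y = -∫ y, ζ y • A y)
    {ρ : E d → ℝ} (hρ : ContDiff ℝ ∞ ρ) (hρc : HasCompactSupport ρ) (x : E d) :
    gradient (fun z => ∫ t, ρ t * w (z - t)) x = ∫ t, ρ t • A (x - t) := by
  have hρ1 : ContDiff ℝ 1 ρ := hρ.of_le (by simp)
  have hd := hρc.hasFDerivAt_convolution_left (ContinuousLinearMap.lsmul ℝ ℝ) hρ1
    hw.locallyIntegrable (μ := volume) x
  have hfun : (ρ ⋆[ContinuousLinearMap.lsmul ℝ ℝ, volume] w) = fun z => ∫ t, ρ t * w (z - t) := by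
    ext z; simp [convolution]
  rw [hfun] at hd
  have hwx : Integrable fun t => w (x - t) := hw.comp_sub_left x
  obtain ⟨N, hN⟩ := (continuous_gradient hρ1).bounded_above_of_compact_support
    (hasCompactSupport_gradient hρc)
  have i1 : Integrable fun t => w (x - t) • gradient ρ t :=
    hwx.smul_bdd N (continuous_gradient hρ1).aestronglyMeasurable (Eventually.of_forall hN)
  have e1 : gradient (fun z => ∫ t, ρ t * w (z - t)) x = ∫ t, w (x - t) • gradient ρ t := by
    refine ext_inner_right ℝ fun v => ?_
    rw [inner_gradient, hd.fderiv, real_inner_comm, ← integral_inner i1 v]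
    rw [convolution_def, ContinuousLinearMap.integral_apply]
    · congr 1; ext1 t
      rw [real_inner_comm, real_inner_smul_left, inner_gradient]
      simp [ContinuousLinearMap.precompL_apply, mul_comm]
    · exact (hρc.fderiv ℝ).convolutionExists_left _ (hρ1.continuous_fderiv one_ne_zero)
        hw.locallyIntegrable x
  have hζ : ContDiff ℝ ∞ fun y => ρ (x - y) := hρ.comp (contDiff_const.sub contDiff_id)
  have hgz : ∀ y, gradient (fun y => ρ (x - y)) y = -gradient ρ (x - y) := by
    intro y
    simp only [gradient]
    have : HasFDerivAt (fun y => ρ (x - y)) (-(fderiv ℝ ρ (x - y))) y := by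
      have h := ((hρ1.differentiable one_ne_zero) (x - y)).hasFDerivAt.comp y
        ((hasFDerivAt_id y).const_sub x)
      simpa [Function.comp_def] using h
    rw [this.fderiv, map_neg]
  have key := hA _ hζ
  simp_rw [hgz, smul_neg] at key
  rw [integral_neg, neg_inj] at key
  have s1 := integral_sub_left_eq_self (fun t => w (x - t) • gradient ρ t)
    (volume : Measure (E d)) x
  have s2 := integral_sub_left_eq_self (fun t => ρ t • A (x - t)) (volume : Measure (E d)) x
  rw [e1, ← s1, ← s2]
  simpa using key

theorem memLp_two_cutoff {d : ℕ} {W : E d → ℝ} {H : E d → E d} {M : ℝ}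
    (hW : AEStronglyMeasurable W) (hWb : ∀ᵐ y, |W y| ≤ M) (hWH : IsWeakGradient W H)
    {χ : E d → ℝ} (hχ : ContDiff ℝ ∞ χ) (hχc : HasCompactSupport χ) (hχ0 : (0 : E d) ∉ tsupport χ)
    (hH2 : IntegrableOn (fun y => ‖H y‖ ^ 2) (tsupport χ)) :
    HasCompactSupport (fun y => χ y • H y + W y • gradient χ y) ∧
      MemLp (fun y => χ y • H y + W y • gradient χ y) 2 := by
  have hχ1 : ContDiff ℝ 1 χ := hχ.of_le (by simp)
  obtain ⟨N, hN⟩ := hχ.continuous.bounded_above_of_compact_support hχc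
  have hHm : AEStronglyMeasurable H (volume.restrict (tsupport χ)) := (hWH χ hχ hχc hχ0).1.1
  have hH2' : MemLp H 2 (volume.restrict (tsupport χ)) := by
    rw [memLp_two_iff_integrable_sq_norm hHm]
    exact hH2
  have hχH : MemLp (fun y => χ y • H y) 2 := by
    have h : MemLp (fun y => χ y • H y) 2 (volume.restrict (tsupport χ)) := by
      refine (hH2'.const_smul N).of_le (hχ.continuous.aestronglyMeasurable.smul hHm) ?_
      refine Eventually.of_forall fun y => ?_
      rw [norm_smul, Pi.smul_apply, norm_smul]
      gcongr
      exact (hN y).trans (le_abs_self N)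
    rw [← memLp_indicator_iff_restrict (isClosed_tsupport χ).measurableSet] at h
    rwa [Set.indicator_eq_self.2] at h
    intro y hy
    apply subset_tsupport
    simp only [Function.mem_support] at hy ⊢
    intro h
    exact hy (by rw [h, zero_smul])
  have hcs : HasCompactSupport fun y => χ y • H y + W y • gradient χ y := by
    refine HasCompactSupport.add ?_ ?_
    · exact hasCompactSupport_fun_smul_right hχc _
    · exact hasCompactSupport_fun_smul_left _ (hasCompactSupport_gradient hχc)
  refine ⟨hcs, hχH.add ?_⟩
  have : MemLp (gradient χ) 2 := (continuous_gradient hχ1).memLp_of_hasCompactSupport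
    (hasCompactSupport_gradient hχc)
  refine (this.const_smul M).of_le (hW.smul (continuous_gradient hχ1).aestronglyMeasurable) ?_
  filter_upwards [hWb] with y hy
  rw [norm_smul, Pi.smul_apply, norm_smul]
  gcongr
  exact hy.trans (le_abs_self M)

theorem integrable_of_memLp_two {d : ℕ} {A : E d → E d} (hcs : HasCompactSupport A)
    (hA2 : MemLp A 2) : Integrable A := by
  have h1 : MemLp A 1 (volume.restrict (tsupport A)) :=
    have : IsFiniteMeasure (volume.restrict (tsupport A)) :=
      ⟨by simpa using hcs.isCompact.measure_lt_top⟩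
    (hA2.restrict _).mono_exponent (by norm_num)
  rw [← integrableOn_iff_integrable_of_support_subset (subset_tsupport A)]
  exact memLp_one_iff_integrable.1 h1

/-- Smooth approximation, near a set away from the origin, of a bounded function and of its weak
gradient. -/
theorem exists_smooth_approx {d : ℕ} {W : E d → ℝ} {H : E d → E d} {M : ℝ}
    (hW : AEStronglyMeasurable W) (hWb : ∀ᵐ y, |W y| ≤ M) (hWH : IsWeakGradient W H)
    {χ : E d → ℝ} (hχ : ContDiff ℝ ∞ χ) (hχc : HasCompactSupport χ) (hχ0 : (0 : E d) ∉ tsupport χ)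
    (hH2 : IntegrableOn (fun y => ‖H y‖ ^ 2) (tsupport χ))
    {K : Set (E d)} (hK : MeasurableSet K) (hK1 : ∀ y ∈ K, χ y = 1)
    (hK2 : ∀ y ∈ K, gradient χ y = 0) :
    ∃ w : ℕ → E d → ℝ, (∀ n, ContDiff ℝ ∞ (w n)) ∧ (∃ N, ∀ n y, |w n y| ≤ N) ∧
      (∀ᵐ y ∂(volume.restrict K), Tendsto (fun n => w n y) atTop (𝓝 (W y))) ∧
      Tendsto (fun n => ∫⁻ y in K, (1 + ‖H y‖ₑ) * ‖gradient (w n) y - H y‖ₑ) atTop (𝓝 0) := by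
  have hχ1 : ContDiff ℝ 1 χ := hχ.of_le (by simp)
  set w₀ : E d → ℝ := fun y => χ y * W y with hw₀
  set A : E d → E d := fun y => χ y • H y + W y • gradient χ y with hAdef
  have hw₀int : Integrable w₀ := by
    have := integrable_bdd_smul hW hWb hχ.continuous hχc
    refine this.congr (Eventually.of_forall fun y => ?_)
    simp [hw₀, mul_comm]
  have hAw : ∀ ζ : E d → ℝ, ContDiff ℝ ∞ ζ → ∫ y, w₀ y • gradient ζ y = -∫ y, ζ y • A y :=
    fun ζ hζ => integral_cutoff_smul_gradient hW hWb hWH hχ hχc hχ0 hζ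
  obtain ⟨hcs, hA2⟩ : HasCompactSupport A ∧ MemLp A 2 :=
    memLp_two_cutoff hW hWb hWH hχ hχc hχ0 hH2
  have hAint : Integrable A := integrable_of_memLp_two hcs hA2
  let φ : ℕ → ContDiffBump (0 : E d) := fun n =>
    { rIn := 1 / ((n : ℝ) + 1)
      rOut := 2 / ((n : ℝ) + 1)
      rIn_pos := by positivity
      rIn_lt_rOut := by gcongr; norm_num }
  have hφ : Tendsto (fun i => (φ i).rOut) atTop (𝓝 0) := by
    have := (tendsto_one_div_add_atTop_nhds_zero_nat (𝕜 := ℝ)).const_mul 2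
    simpa [φ, div_eq_mul_inv] using this
  have hφ' : ∀ᶠ i in atTop, (φ i).rOut ≤ 2 * (φ i).rIn := Eventually.of_forall fun i => by
    simp only [φ]; apply le_of_eq; ring
  have hae := ContDiffBump.ae_convolution_tendsto_right_of_locallyIntegrable (μ := volume) hφ hφ'
    hw₀int.locallyIntegrable
  refine ⟨fun n z => ∫ t, (φ n).normed volume t * w₀ (z - t), fun n => ?_, ?_, ?_, ?_⟩
  · have := ((φ n).hasCompactSupport_normed (μ := volume)).contDiff_convolution_left
      (ContinuousLinearMap.lsmul ℝ ℝ) (φ n).contDiff_normed hw₀int.locallyIntegrable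
      (n := (⊤ : ℕ∞)) (μ := volume)
    convert! this using 2
  · obtain ⟨N, hN⟩ := hχ.continuous.bounded_above_of_compact_support hχc
    have hN0 : 0 ≤ N := (norm_nonneg _).trans (hN 0)
    have hb : ∀ᵐ y, ‖w₀ y‖ ≤ N * M := by
      filter_upwards [hWb] with y hy
      rw [hw₀, norm_mul]
      exact mul_le_mul (hN y) hy (norm_nonneg _) hN0
    refine ⟨N * M, fun n y => ?_⟩
    have hi : Integrable fun t => (φ n).normed volume t * (N * M) :=
      (φ n).integrable_normed.mul_const _
    rw [← Real.norm_eq_abs]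
    refine (norm_integral_le_of_norm_le hi ?_).trans (le_of_eq ?_)
    · have hq := (quasiMeasurePreserving_sub_left_of_right_invariant volume y).ae hb
      filter_upwards [hq] with t ht
      rw [norm_mul, Real.norm_of_nonneg ((φ n).nonneg_normed t)]
      exact mul_le_mul_of_nonneg_left ht ((φ n).nonneg_normed t)
    · rw [integral_mul_const, (φ n).integral_normed, one_mul]
  · rw [ae_restrict_iff' hK]
    filter_upwards [hae] with y hy hyK
    have : w₀ y = W y := by simp [hw₀, hK1 y hyK]
    rw [← this]
    refine hy.congr fun n => ?_
    simp [convolution]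
  · have hQ : MemLp (K.indicator fun y => 1 + ‖A y‖) 2 := by
      have hKf : K ⊆ tsupport χ := fun y hy => subset_tsupport _ (by
        simp [Function.mem_support, hK1 y hy])
      rw [memLp_indicator_iff_restrict hK]
      have : IsFiniteMeasure (volume.restrict K) :=
        ⟨by simpa using (measure_mono hKf).trans_lt hχc.isCompact.measure_lt_top⟩
      have h1 : MemLp (fun _ : E d => (1 : ℝ)) 2 (volume.restrict K) := memLp_const 1
      have h2 : MemLp (fun y : E d => ‖A y‖) 2 (volume.restrict K) := (hA2.restrict K).norm
      exact h1.add h2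
    have := tendsto_lintegral_mul_convolution_sub hA2 hAint hQ hφ
    refine this.congr fun n => ?_
    rw [← lintegral_indicator hK]
    congr 1
    ext1 y
    dsimp only
    have hgr := gradient_convolution_eq hw₀int hAw ((φ n).contDiff_normed (μ := volume))
      (φ n).hasCompactSupport_normed y
    by_cases hy : y ∈ K
    · have e : A y = H y := by simp [hAdef, hK1 y hy, hK2 y hy]
      simp only [hy, indicator_of_mem, e, hgr]
      congr 1
      rw [← ofReal_norm, Real.norm_of_nonneg (by positivity), ENNReal.ofReal_add (by norm_num)
        (norm_nonneg _), ofReal_norm, ENNReal.ofReal_one]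
    · simp [hy]


/-- The weighted Laplacian `∇ · (|y|^(-β) ∇ ·)` of the radial function `F (|y|²)`, as a function of
`s = |y|²`. -/
noncomputable def radL (d : ℕ) (β : ℝ) (F : ℝ → ℝ) (s : ℝ) : ℝ :=
  s ^ (-β / 2) * (4 * s * deriv (deriv F) s + 2 * ((d : ℝ) - β) * deriv F s)

/-- Profiles of smooth radial test functions supported away from the origin. -/
structure IsProfile (F : ℝ → ℝ) (a b : ℝ) : Prop where
  smooth : ContDiff ℝ ∞ F
  pos : 0 < a
  lt : a < b
  zero : ∀ s, s ∉ Icc a b → F s = 0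

/-- A closed annulus. -/
def annulus (d : ℕ) (a b : ℝ) : Set (E d) := {y | ‖y‖ ^ 2 ∈ Icc a b}

theorem isClosed_annulus (d : ℕ) (a b : ℝ) : IsClosed (annulus d a b) :=
  isClosed_Icc.preimage (by fun_prop : Continuous fun y : E d => ‖y‖ ^ 2)

theorem isCompact_annulus (d : ℕ) (a b : ℝ) : IsCompact (annulus d a b) := by
  refine (isCompact_closedBall (0 : E d) (1 + |b|)).of_isClosed_subset (isClosed_annulus d a b) ?_
  intro y hy
  rw [mem_closedBall_zero_iff]
  have h2 : ‖y‖ ^ 2 ≤ b := hy.2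
  nlinarith [norm_nonneg y, abs_nonneg b, le_abs_self b]

theorem zero_notMem_annulus {d : ℕ} {a b : ℝ} (ha : 0 < a) : (0 : E d) ∉ annulus d a b := by
  intro h
  have := h.1
  simp at this
  linarith

namespace IsProfile

variable {F : ℝ → ℝ} {a b : ℝ}

theorem deriv_zero (h : IsProfile F a b) : ∀ s, s ∉ Icc a b → deriv F s = 0 := by
  intro s hs
  have : F =ᶠ[𝓝 s] fun _ => 0 := by
    filter_upwards [isClosed_Icc.isOpen_compl.mem_nhds hs] with x hx using h.zero x hx
  rw [this.deriv_eq, deriv_const]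

theorem deriv (h : IsProfile F a b) : IsProfile (deriv F) a b :=
  ⟨(contDiff_infty_iff_deriv.1 h.smooth).2, h.pos, h.lt, h.deriv_zero⟩

theorem contDiff_comp (h : IsProfile F a b) (d : ℕ) : ContDiff ℝ ∞ fun y : E d => F (‖y‖ ^ 2) :=
  h.smooth.comp (contDiff_norm_sq ℝ)

theorem tsupport_comp_subset (h : IsProfile F a b) (d : ℕ) :
    tsupport (fun y : E d => F (‖y‖ ^ 2)) ⊆ annulus d a b := by
  refine closure_minimal ?_ (isClosed_annulus d a b)
  intro y hy
  by_contra hc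
  exact hy (h.zero _ hc)

theorem hasCompactSupport_comp (h : IsProfile F a b) (d : ℕ) :
    HasCompactSupport fun y : E d => F (‖y‖ ^ 2) :=
  (isCompact_annulus d a b).of_isClosed_subset (isClosed_tsupport _) (h.tsupport_comp_subset d)

theorem zero_notMem_tsupport (h : IsProfile F a b) (d : ℕ) :
    (0 : E d) ∉ tsupport fun y : E d => F (‖y‖ ^ 2) :=
  fun h0 => zero_notMem_annulus h.pos (h.tsupport_comp_subset d h0)

theorem rpow_mul (h : IsProfile F a b) (q : ℝ) : IsProfile (fun s => s ^ q * F s) a b := by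
  refine ⟨?_, h.pos, h.lt, fun s hs => by simp [h.zero s hs]⟩
  rw [contDiff_iff_contDiffAt]
  intro s
  rcases lt_or_ge s a with hs | hs
  · have : (fun s => s ^ q * F s) =ᶠ[𝓝 s] fun _ => 0 := by
      filter_upwards [Iio_mem_nhds hs] with x hx
      rw [h.zero x (fun hh => absurd hh.1 (not_le.2 hx)), mul_zero]
    exact contDiffAt_const.congr_of_eventuallyEq this
  · exact (Real.contDiffAt_rpow_const_of_ne (h.pos.trans_le hs).ne').mul h.smooth.contDiffAt

theorem continuous_radL (h : IsProfile F a b) (d : ℕ) (β : ℝ) : Continuous (radL d β F) := by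
  have h1 : Continuous fun s => s ^ (-β / 2) * _root_.deriv F s :=
    (h.deriv.rpow_mul (-β / 2)).smooth.continuous
  have h2 : Continuous fun s => s ^ (-β / 2) * _root_.deriv (_root_.deriv F) s :=
    (h.deriv.deriv.rpow_mul (-β / 2)).smooth.continuous
  have : radL d β F = fun s => 4 * s * (s ^ (-β / 2) * _root_.deriv (_root_.deriv F) s) +
      2 * ((d : ℝ) - β) * (s ^ (-β / 2) * _root_.deriv F s) := by
    ext s; rw [radL]; ring
  rw [this]
  fun_prop

theorem radL_zero (h : IsProfile F a b) (d : ℕ) (β : ℝ) {s : ℝ} (hs : s ∉ Icc a b) :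
    radL d β F s = 0 := by
  rw [radL, h.deriv.zero s hs, h.deriv.deriv.zero s hs]; ring

end IsProfile

theorem hasFDerivAt_comp_norm_sq {d : ℕ} {F : ℝ → ℝ} {F' : ℝ} {y : E d}
    (hF : HasDerivAt F F' (‖y‖ ^ 2)) :
    HasFDerivAt (fun y : E d => F (‖y‖ ^ 2)) ((2 * F') • innerSL ℝ y) y := by
  have h := hF.comp_hasFDerivAt y (hasStrictFDerivAt_norm_sq y).hasFDerivAt
  refine h.congr_fderiv ?_
  ext v
  simp
  ring

theorem gradient_comp_norm_sq {d : ℕ} {F : ℝ → ℝ} {F' : ℝ} {y : E d}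
    (hF : HasDerivAt F F' (‖y‖ ^ 2)) :
    gradient (fun y : E d => F (‖y‖ ^ 2)) y = (2 * F') • y := by
  refine ext_inner_right ℝ fun v => ?_
  rw [inner_gradient, (hasFDerivAt_comp_norm_sq hF).fderiv, real_inner_smul_left]
  simp

theorem exists_cutoff {a b : ℝ} (ha : 0 < a) (hab : a < b) (d : ℕ) :
    ∃ χ : E d → ℝ, ContDiff ℝ ∞ χ ∧ HasCompactSupport χ ∧ (0 : E d) ∉ tsupport χ ∧
      tsupport χ ⊆ annulus d (a / 2) (3 * b) ∧ (∀ y ∈ annulus d a b, χ y = 1) ∧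
      ∀ y ∈ annulus d a b, gradient χ y = 0 := by
  have hb : 0 < b := ha.trans hab
  let G : ℝ → ℝ := fun s =>
    Real.smoothTransition (4 * s / a - 2) * (1 - Real.smoothTransition (s / b - 2))
  have hG : IsProfile G (a / 2) (3 * b) := by
    refine ⟨?_, by positivity, by linarith, fun s hs => ?_⟩
    · have h1 : ContDiff ℝ ∞ fun s : ℝ => Real.smoothTransition (4 * s / a - 2) :=
        Real.smoothTransition.contDiff.comp (by fun_prop)
      have h2 : ContDiff ℝ ∞ fun s : ℝ => Real.smoothTransition (s / b - 2) :=
        Real.smoothTransition.contDiff.comp (by fun_prop)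
      exact h1.mul (contDiff_const.sub h2)
    · rw [mem_Icc, not_and_or, not_le, not_le] at hs
      rcases hs with hs | hs
      · have : Real.smoothTransition (4 * s / a - 2) = 0 := by
          apply Real.smoothTransition.zero_of_nonpos
          have : 4 * s / a < 2 := by rw [div_lt_iff₀ ha]; linarith
          linarith
        simp [G, this]
      · have : Real.smoothTransition (s / b - 2) = 1 := by
          apply Real.smoothTransition.one_of_one_le
          have : 3 < s / b := by rw [lt_div_iff₀ hb]; linarith
          linarith
        simp [G, this]
  have hone : ∀ s, 3 / 4 * a ≤ s → s ≤ 2 * b → G s = 1 := by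
    intro s h1 h2
    have e1 : Real.smoothTransition (4 * s / a - 2) = 1 := by
      apply Real.smoothTransition.one_of_one_le
      have : 3 ≤ 4 * s / a := by rw [le_div_iff₀ ha]; linarith
      linarith
    have e2 : Real.smoothTransition (s / b - 2) = 0 := by
      apply Real.smoothTransition.zero_of_nonpos
      have : s / b ≤ 2 := by rw [div_le_iff₀ hb]; linarith
      linarith
    simp [G, e1, e2]
  refine ⟨fun y => G (‖y‖ ^ 2), hG.contDiff_comp d, hG.hasCompactSupport_comp d,
    hG.zero_notMem_tsupport d, hG.tsupport_comp_subset d, fun y hy => hone _ ?_ ?_, fun y hy => ?_⟩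
  · linarith [hy.1]
  · linarith [hy.2]
  · have : HasDerivAt G 0 (‖y‖ ^ 2) := by
      have he : G =ᶠ[𝓝 (‖y‖ ^ 2)] fun _ => 1 := by
        have h1 : 3 / 4 * a < ‖y‖ ^ 2 := by linarith [hy.1]
        have h2 : ‖y‖ ^ 2 < 2 * b := by linarith [hy.2]
        filter_upwards [Ioo_mem_nhds h1 h2] with s hs using hone s hs.1.le hs.2.le
      exact (hasDerivAt_const _ _).congr_of_eventuallyEq he
    rw [gradient_comp_norm_sq this]
    simp

theorem norm_rpow_eq_sq_rpow {d : ℕ} (q : ℝ) (y : E d) : ‖y‖ ^ q = (‖y‖ ^ 2) ^ (q / 2) := by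
  rw [← Real.rpow_natCast, ← Real.rpow_mul (norm_nonneg _)]
  congr 1; push_cast; ring

theorem weighted_inner_gradient_radial {d : ℕ} (β : ℝ) {F : ℝ → ℝ} (hF : Differentiable ℝ F)
    (v y : E d) :
    ‖y‖ ^ (-β) * inner ℝ v (gradient (fun z : E d => F (‖z‖ ^ 2)) y) =
      2 * ((‖y‖ ^ 2) ^ (-β / 2) * deriv F (‖y‖ ^ 2)) * inner ℝ v y := by
  rw [gradient_comp_norm_sq (hF _).hasDerivAt, real_inner_smul_right, norm_rpow_eq_sq_rpow]
  ring

theorem IsProfile.integrable_bdd_mul {F : ℝ → ℝ} {a b : ℝ} (hF : IsProfile F a b) {d : ℕ}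
    {Q : E d → ℝ} (hQ : Continuous Q) : Integrable fun y : E d => Q y * F (‖y‖ ^ 2) :=
  (hQ.mul (hF.contDiff_comp d).continuous).integrable_of_hasCompactSupport
    (hF.hasCompactSupport_comp d).mul_left

theorem IsProfile.integrable_mul_radL {F : ℝ → ℝ} {a b : ℝ} (hF : IsProfile F a b) {d : ℕ} (β : ℝ)
    {Q : E d → ℝ} (hQ : Continuous Q) : Integrable fun y : E d => Q y * radL d β F (‖y‖ ^ 2) := by
  refine (hQ.mul ((hF.continuous_radL d β).comp (by fun_prop))).integrable_of_hasCompactSupport ?_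
  refine HasCompactSupport.of_support_subset_isCompact (isCompact_annulus d a b) fun y hy => ?_
  by_contra hc
  exact hy (by simp [hF.radL_zero d β (s := ‖y‖ ^ 2) hc])

theorem integrable_weighted_inner_gradient_radial {d : ℕ} (β : ℝ) {F : ℝ → ℝ} {a b : ℝ}
    (hF : IsProfile F a b) {X : E d → E d} (hX : Continuous X) :
    Integrable fun y => ‖y‖ ^ (-β) * inner ℝ (X y) (gradient (fun z : E d => F (‖z‖ ^ 2)) y) := by
  simp_rw [weighted_inner_gradient_radial β (hF.smooth.differentiable (by simp))]
  have := (hF.deriv.rpow_mul (-β / 2)).integrable_bdd_mul (d := d)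
    (Q := fun y => 2 * inner ℝ (X y) y) (by fun_prop)
  refine this.congr (Eventually.of_forall fun y => ?_)
  simp only
  ring

/-- Integration by parts against the weighted Laplacian of a radial test function. -/
theorem integral_weighted_inner_gradient_radial {d : ℕ} (β : ℝ) {F : ℝ → ℝ} {a b : ℝ}
    (hF : IsProfile F a b) {Q : E d → ℝ} (hQ : ContDiff ℝ 1 Q) :
    ∫ y, ‖y‖ ^ (-β) * inner ℝ (gradient Q y) (gradient (fun z : E d => F (‖z‖ ^ 2)) y) =
      -∫ y, Q y * radL d β F (‖y‖ ^ 2) := by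
  have hk := hF.deriv.rpow_mul (-β / 2)
  set k : ℝ → ℝ := fun s => s ^ (-β / 2) * deriv F s with hkdef
  have hk1 : ContDiff ℝ 1 fun y : E d => k (‖y‖ ^ 2) := (hk.contDiff_comp d).of_le (by simp)
  have hq : ContDiff ℝ 1 fun y : E d => Q y * k (‖y‖ ^ 2) := hQ.mul hk1
  have key := integral_euler_eq_zero hq (hk.hasCompactSupport_comp d).mul_left
  have hkd : ∀ s, 0 < s → HasDerivAt k
      ((-β / 2) * s ^ (-β / 2 - 1) * deriv F s + s ^ (-β / 2) * deriv (deriv F) s) s := by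
    intro s hs
    exact (Real.hasDerivAt_rpow_const (Or.inl hs.ne')).mul
      (hF.deriv.smooth.differentiable (by simp) s).hasDerivAt
  have h0 : (0 : ℝ) ∉ Icc a b := fun h => absurd h.1 (not_le.2 hF.pos)
  have hfd : ∀ y : E d, (d : ℝ) * (Q y * k (‖y‖ ^ 2)) +
      fderiv ℝ (fun y : E d => Q y * k (‖y‖ ^ 2)) y y =
      (1 / 2) * (‖y‖ ^ (-β) * inner ℝ (gradient Q y) (gradient (fun z : E d => F (‖z‖ ^ 2)) y)) +
      (1 / 2) * (Q y * radL d β F (‖y‖ ^ 2)) := by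
    intro y
    rw [weighted_inner_gradient_radial β (hF.smooth.differentiable (by simp)), inner_gradient]
    rcases eq_or_ne y 0 with rfl | hy
    · simp [hF.radL_zero d β h0, hk.zero 0 h0]
    have hs : 0 < ‖y‖ ^ 2 := by positivity
    have h1 := hasFDerivAt_comp_norm_sq (y := y) (hkd _ hs)
    have h2 := (hQ.differentiable one_ne_zero y).hasFDerivAt.fun_mul h1
    rw [h2.fderiv, radL]
    simp only [add_apply, smul_apply, innerSL_apply_apply,
      real_inner_self_eq_norm_sq, smul_eq_mul, hkdef]
    have e : (‖y‖ ^ 2) ^ (-β / 2 - 1) * ‖y‖ ^ 2 = (‖y‖ ^ 2) ^ (-β / 2) := by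
      rw [← Real.rpow_add_one hs.ne']; congr 1; ring
    linear_combination (Q y * (-β) * deriv F (‖y‖ ^ 2)) * e
  simp_rw [hfd] at key
  rw [integral_add, integral_const_mul, integral_const_mul] at key
  · linarith
  · exact (integrable_weighted_inner_gradient_radial β hF (continuous_gradient hQ)).const_mul _
  · exact (hF.integrable_mul_radL β hQ.continuous).const_mul _


/-- `f = c ∇ · (|y|^(-β) ∇ W)` away from the origin, `H` being the gradient of `W`. -/
structure IsEllipticPair {d : ℕ} (β c : ℝ) (W : E d → ℝ) (H : E d → E d) (f : E d → ℝ) : Prop where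
  meas : AEStronglyMeasurable W
  bdd : ∃ M, ∀ᵐ y, |W y| ≤ M
  grad : IsWeakGradient W H
  sq_integrableOn : ∀ a b, 0 < a → IntegrableOn (fun y => ‖H y‖ ^ 2) (annulus d a b)
  integrableOn : ∀ a b, 0 < a → IntegrableOn f (annulus d a b)
  eq : ∀ φ : E d → ℝ, ContDiff ℝ ∞ φ → HasCompactSupport φ → (0 : E d) ∉ tsupport φ →
    ∫ y, f y * φ y = -(c * ∫ y, ‖y‖ ^ (-β) * inner ℝ (H y) (gradient φ y))

theorem gradient_comp {d : ℕ} {p : ℝ → ℝ} {p' : ℝ} {w : E d → ℝ} {y : E d}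
    (hp : HasDerivAt p p' (w y)) (hw : DifferentiableAt ℝ w y) :
    gradient (fun z => p (w z)) y = p' • gradient w y := by
  refine ext_inner_right ℝ fun v => ?_
  have h : HasFDerivAt (fun z => p (w z)) (p' • fderiv ℝ w y) y :=
    hp.comp_hasFDerivAt y hw.hasFDerivAt
  rw [inner_gradient, h.fderiv, real_inner_smul_left, inner_gradient]
  simp

namespace IsEllipticPair

variable {d : ℕ} {β c : ℝ} {W : E d → ℝ} {H : E d → E d} {f : E d → ℝ}

theorem integrableOn_grad (h : IsEllipticPair β c W H f) {a b : ℝ} (ha : 0 < a) (hab : a < b) :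
    IntegrableOn H (annulus d a b) := by
  obtain ⟨χ, hχ, hχc, hχ0, -, hχ1, -⟩ := exists_cutoff ha hab d
  refine (h.grad χ hχ hχc hχ0).1.mono_set fun y hy => subset_tsupport _ ?_
  simp [Function.mem_support, hχ1 y hy]

theorem test_le (h : IsEllipticPair β c W H f) (hc : 0 ≤ c) {F : ℝ → ℝ} {a b : ℝ}
    (hF : IsProfile F a b) {p P : ℝ → ℝ} (hp : ContDiff ℝ ∞ p) (hP : ∀ x, HasDerivAt P (p x) x)
    (hp1 : ∀ x, |p x| ≤ 1) (hp0 : ∀ x, 0 ≤ deriv p x) {N : ℝ} (hpN : ∀ x, deriv p x ≤ N)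
    {B : ℝ}
    (hB1 : ∀ y : E d, ‖(2 * ((‖y‖ ^ 2) ^ (-β / 2) * deriv F (‖y‖ ^ 2))) • y‖ ≤ B)
    (hB2 : ∀ y : E d, N * ((‖y‖ ^ 2) ^ (-β / 2) * F (‖y‖ ^ 2)) ≤ B)
    (hF0 : ∀ s, 0 ≤ F s) {w : E d → ℝ} (hw : ContDiff ℝ ∞ w)
    (hfin : ∫⁻ y in annulus d a b, (1 + ‖H y‖ₑ) * ‖gradient w y - H y‖ₑ ≠ ⊤) :
    ∫ y, f y * (p (w y) * F (‖y‖ ^ 2)) ≤ c * ((∫ y, P (w y) * radL d β F (‖y‖ ^ 2)) +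
      B * (∫⁻ y in annulus d a b, (1 + ‖H y‖ₑ) * ‖gradient w y - H y‖ₑ).toReal) := by
  have hHi := h.integrableOn_grad hF.pos hF.lt
  have hw1 : ContDiff ℝ 1 w := hw.of_le (by simp)
  have hpd : Differentiable ℝ p := hp.differentiable (by simp)
  have hwd : Differentiable ℝ w := hw.differentiable (by simp)
  have hFd : Differentiable ℝ F := hF.smooth.differentiable (by simp)
  have hPc : ContDiff ℝ 1 P := by
    rw [contDiff_one_iff_deriv]
    refine ⟨fun x => (hP x).differentiableAt, ?_⟩
    have : deriv P = p := funext fun x => (hP x).deriv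
    rw [this]; exact hp.continuous
  have hgφ : ∀ y, gradient (fun z => p (w z) * F (‖z‖ ^ 2)) y =
      p (w y) • gradient (fun z : E d => F (‖z‖ ^ 2)) y +
        (F (‖y‖ ^ 2) * deriv p (w y)) • gradient w y := by
    intro y
    rw [gradient_mul (f := fun z => p (w z)) ((hpd _).comp y (hwd y))
      ((hF.contDiff_comp d).differentiable (by simp) y),
      gradient_comp (hpd _).hasDerivAt (hwd y), smul_smul]
  have hts : tsupport (fun y : E d => p (w y) * F (‖y‖ ^ 2)) ⊆ annulus d a b :=
    (tsupport_mul_subset_right).trans (hF.tsupport_comp_subset d)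
  have heq := h.eq (fun y => p (w y) * F (‖y‖ ^ 2)) ((hp.comp hw).mul (hF.contDiff_comp d))
    (hF.hasCompactSupport_comp d).mul_left (fun h0 => zero_notMem_annulus hF.pos (hts h0))
  set V : E d → E d := fun y =>
    (p (w y) * (2 * ((‖y‖ ^ 2) ^ (-β / 2) * deriv F (‖y‖ ^ 2)))) • y +
      (deriv p (w y) * ((‖y‖ ^ 2) ^ (-β / 2) * F (‖y‖ ^ 2))) • gradient w y with hV
  have hVc : Continuous V := by
    have h1 := ((hF.deriv.rpow_mul (-β / 2)).contDiff_comp d).continuous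
    have h2 := ((hF.rpow_mul (-β / 2)).contDiff_comp d).continuous
    have h3 := continuous_gradient hw1
    have h4 := hp.continuous
    have h5 := hw.continuous
    have h6 : Continuous (deriv p) := hp.continuous_deriv (by simp)
    fun_prop
  have hinner : ∀ y, ‖y‖ ^ (-β) * inner ℝ (H y) (gradient (fun z => p (w z) * F (‖z‖ ^ 2)) y) =
      inner ℝ (H y) (V y) := by
    intro y
    have e := weighted_inner_gradient_radial β hFd (H y) y
    rw [hgφ, inner_add_right, real_inner_smul_right, real_inner_smul_right, hV, inner_add_right,
      real_inner_smul_right, real_inner_smul_right, mul_add, mul_left_comm, e,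
      norm_rpow_eq_sq_rpow]
    ring
  have hV0 : ∀ y, y ∉ annulus d a b → V y = 0 := by
    intro y hy
    have h1 : F (‖y‖ ^ 2) = 0 := hF.zero _ hy
    have h2 : deriv F (‖y‖ ^ 2) = 0 := hF.deriv.zero _ hy
    simp [hV, h1, h2]
  have hVcs : HasCompactSupport V := HasCompactSupport.intro (isCompact_annulus d a b) hV0
  obtain ⟨N', hN'⟩ := hVc.bounded_above_of_compact_support hVcs
  have hLint : Integrable fun y => inner ℝ (H y) (V y) := by
    rw [← integrableOn_iff_integrable_of_support_subset (s := annulus d a b)]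
    · refine (hHi.norm.const_mul N').mono' (hHi.1.inner hVc.aestronglyMeasurable)
        (Eventually.of_forall fun y => ?_)
      rw [mul_comm]
      exact (norm_inner_le_norm _ _).trans
        (mul_le_mul_of_nonneg_left (hN' y) (norm_nonneg _))
    · intro y hy
      by_contra hcon
      exact hy (by simp [hV0 y hcon])
  have hPw : ∀ y, gradient (fun z => P (w z)) y = p (w y) • gradient w y :=
    fun y => gradient_comp (hP _) (hwd y)
  have hibp := integral_weighted_inner_gradient_radial β hF (hPc.comp hw1)
  have hRint := integrable_weighted_inner_gradient_radial β hF
    (continuous_gradient (hPc.comp hw1))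
  have hmeas : AEStronglyMeasurable (fun y => (1 + ‖H y‖) * ‖gradient w y - H y‖)
      (volume.restrict (annulus d a b)) :=
    (hHi.1.norm.const_add 1).mul ((continuous_gradient hw1).aestronglyMeasurable.sub hHi.1).norm
  have hen : ∀ y, ‖(1 + ‖H y‖) * ‖gradient w y - H y‖‖ₑ =
      (1 + ‖H y‖ₑ) * ‖gradient w y - H y‖ₑ := by
    intro y
    rw [enorm_mul, enorm_norm, ← ofReal_norm (1 + ‖H y‖), Real.norm_of_nonneg (by positivity),
      ENNReal.ofReal_add zero_le_one (norm_nonneg _), ofReal_norm, ENNReal.ofReal_one]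
  have hEint : IntegrableOn (fun y => (1 + ‖H y‖) * ‖gradient w y - H y‖) (annulus d a b) := by
    refine ⟨hmeas, ?_⟩
    rw [hasFiniteIntegral_iff_enorm]
    simp_rw [hen]
    exact hfin.lt_top
  have hEval : ∫ y in annulus d a b, (1 + ‖H y‖) * ‖gradient w y - H y‖ =
      (∫⁻ y in annulus d a b, (1 + ‖H y‖ₑ) * ‖gradient w y - H y‖ₑ).toReal := by
    have hnn : ∀ y, 0 ≤ (1 + ‖H y‖) * ‖gradient w y - H y‖ := fun y => by positivity
    rw [integral_eq_lintegral_of_nonneg_ae (Eventually.of_forall hnn) hmeas]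
    congr 1
    refine lintegral_congr fun y => ?_
    rw [← hen y, ← ofReal_norm, Real.norm_of_nonneg (hnn y)]
  have hpt : ∀ y, -inner ℝ (H y) (V y) ≤
      -(‖y‖ ^ (-β) * inner ℝ (gradient (fun z => P (w z)) y)
        (gradient (fun z : E d => F (‖z‖ ^ 2)) y)) +
      B * (annulus d a b).indicator (fun y => (1 + ‖H y‖) * ‖gradient w y - H y‖) y := by
    intro y
    rw [weighted_inner_gradient_radial β hFd, hPw, real_inner_smul_left]
    by_cases hy : y ∈ annulus d a b
    · rw [indicator_of_mem hy, hV]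
      simp only [inner_add_right, real_inner_smul_right]
      set k := 2 * ((‖y‖ ^ 2) ^ (-β / 2) * deriv F (‖y‖ ^ 2)) with hk
      set r := (‖y‖ ^ 2) ^ (-β / 2) * F (‖y‖ ^ 2) with hr
      have hr0 : 0 ≤ r := mul_nonneg (by positivity) (hF0 _)
      set g := gradient w y with hg
      have h1 : inner ℝ (H y) y = inner ℝ g y - inner ℝ (g - H y) y := by
        rw [inner_sub_left]; ring
      have h2 : inner ℝ (H y) g = ‖H y‖ ^ 2 + inner ℝ (H y) (g - H y) := by
        rw [inner_sub_right, real_inner_self_eq_norm_sq]; ring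
      have h3 : p (w y) * k * inner ℝ (g - H y) y ≤ B * ‖g - H y‖ := by
        have : p (w y) * k * inner ℝ (g - H y) y = p (w y) * inner ℝ (g - H y) (k • y) := by
          rw [real_inner_smul_right]; ring
        rw [this]
        calc p (w y) * inner ℝ (g - H y) (k • y) ≤ |p (w y) * inner ℝ (g - H y) (k • y)| :=
              le_abs_self _
          _ ≤ 1 * (‖g - H y‖ * B) := by
              rw [abs_mul]
              refine mul_le_mul (hp1 _) ?_ (abs_nonneg _) zero_le_one
              exact (abs_real_inner_le_norm _ _).trans
                (mul_le_mul_of_nonneg_left (hB1 y) (norm_nonneg _))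
          _ = _ := by ring
      have h4 : -(deriv p (w y) * r * inner ℝ (H y) (g - H y)) ≤ B * (‖H y‖ * ‖g - H y‖) := by
        have h5 : -inner ℝ (H y) (g - H y) ≤ ‖H y‖ * ‖g - H y‖ :=
          (neg_le_abs _).trans (abs_real_inner_le_norm _ _)
        have h6 : deriv p (w y) * r ≤ B :=
          (mul_le_mul_of_nonneg_right (hpN _) hr0).trans (hB2 y)
        calc -(deriv p (w y) * r * inner ℝ (H y) (g - H y))
            = (deriv p (w y) * r) * (-inner ℝ (H y) (g - H y)) := by ring
          _ ≤ (deriv p (w y) * r) * (‖H y‖ * ‖g - H y‖) :=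
              mul_le_mul_of_nonneg_left h5 (mul_nonneg (hp0 _) hr0)
          _ ≤ _ := mul_le_mul_of_nonneg_right h6 (by positivity)
      have h7 : 0 ≤ deriv p (w y) * r * ‖H y‖ ^ 2 :=
        mul_nonneg (mul_nonneg (hp0 _) hr0) (by positivity)
      rw [h1, h2]
      nlinarith [h3, h4, h7]
    · have h2 : deriv F (‖y‖ ^ 2) = 0 := hF.deriv.zero _ hy
      simp [hV0 y hy, hy, h2]
  have hfinal : -∫ y, inner ℝ (H y) (V y) ≤ (∫ y, P (w y) * radL d β F (‖y‖ ^ 2)) +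
      B * (∫⁻ y in annulus d a b, (1 + ‖H y‖ₑ) * ‖gradient w y - H y‖ₑ).toReal := by
    have hE' : Integrable
        ((annulus d a b).indicator fun y => (1 + ‖H y‖) * ‖gradient w y - H y‖) :=
      hEint.integrable_indicator (isClosed_annulus d a b).measurableSet
    have := integral_mono hLint.neg (hRint.neg.add (hE'.const_mul B)) hpt
    rw [integral_add' hRint.neg (hE'.const_mul B), integral_const_mul,
      integral_indicator (isClosed_annulus d a b).measurableSet, hEval] at this
    simp only [Pi.neg_apply, Function.comp_def] at this hibp
    rw [integral_neg, integral_neg, hibp, neg_neg] at this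
    exact this
  rw [heq]
  simp_rw [hinner]
  rw [← mul_neg]
  exact mul_le_mul_of_nonneg_left hfinal hc

theorem kato_smooth (h : IsEllipticPair β c W H f) (hc : 0 ≤ c) {F : ℝ → ℝ} {a b : ℝ}
    (hF : IsProfile F a b) (hF0 : ∀ s, 0 ≤ F s) {p P : ℝ → ℝ} (hp : ContDiff ℝ ∞ p)
    (hP : ∀ x, HasDerivAt P (p x) x) (hp1 : ∀ x, |p x| ≤ 1) (hp0 : ∀ x, 0 ≤ deriv p x) {N : ℝ}
    (hpN : ∀ x, deriv p x ≤ N) :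
    ∫ y, f y * (p (W y) * F (‖y‖ ^ 2)) ≤ c * ∫ y, P (W y) * radL d β F (‖y‖ ^ 2) := by
  obtain ⟨M, hM⟩ := h.bdd
  have hKm : MeasurableSet (annulus d a b) := (isClosed_annulus d a b).measurableSet
  obtain ⟨χ, hχ, hχc, hχ0, hχs, hχ1, hχ2⟩ := exists_cutoff hF.pos hF.lt d
  obtain ⟨w, hw, ⟨N₁, hwN⟩, hwae, hwe⟩ := exists_smooth_approx h.meas hM h.grad hχ hχc hχ0
    ((h.sq_integrableOn _ _ (half_pos hF.pos)).mono_set hχs) hKm hχ1 hχ2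
  have hPcont : Continuous P := continuous_iff_continuousAt.2 fun x => (hP x).continuousAt
  obtain ⟨B1, hB1⟩ : ∃ B, ∀ y : E d,
      ‖(2 * ((‖y‖ ^ 2) ^ (-β / 2) * deriv F (‖y‖ ^ 2))) • y‖ ≤ B := by
    have h1 := ((hF.deriv.rpow_mul (-β / 2)).contDiff_comp d).continuous
    refine Continuous.bounded_above_of_compact_support (by fun_prop) ?_
    refine HasCompactSupport.intro (isCompact_annulus d a b) fun y hy => ?_
    have h2 : deriv F (‖y‖ ^ 2) = 0 := hF.deriv.zero _ hy
    simp [h2]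
  obtain ⟨B2, hB2⟩ := (((hF.rpow_mul (-β / 2)).contDiff_comp d).continuous).const_smul N
    |>.bounded_above_of_compact_support
      (((hF.rpow_mul (-β / 2)).hasCompactSupport_comp d).smul_left (f := fun _ => N))
  have hae' : ∀ᵐ y : E d, y ∈ annulus d a b → Tendsto (fun n => w n y) atTop (𝓝 (W y)) :=
    (ae_restrict_iff' hKm).1 hwae
  have hlim1 : Tendsto (fun n => ∫ y, f y * (p (w n y) * F (‖y‖ ^ 2))) atTop
      (𝓝 (∫ y, f y * (p (W y) * F (‖y‖ ^ 2)))) := by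
    obtain ⟨B3, hB3⟩ := (hF.contDiff_comp d).continuous.bounded_above_of_compact_support
      (hF.hasCompactSupport_comp d)
    have hfi := h.integrableOn a b hF.pos
    have hset : ∀ q : E d → ℝ, ∫ y, f y * (q y * F (‖y‖ ^ 2)) =
        ∫ y in annulus d a b, f y * (q y * F (‖y‖ ^ 2)) := by
      intro q
      rw [setIntegral_eq_integral_of_forall_compl_eq_zero]
      intro y hy
      rw [hF.zero _ hy]; ring
    rw [hset (fun y => p (W y))]
    simp_rw [fun n => hset (fun y => p (w n y))]
    refine tendsto_integral_of_dominated_convergence (fun y => ‖f y‖ * B3) ?_ (hfi.norm.mul_const _)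
      ?_ ?_
    · intro n
      exact hfi.1.mul ((hp.continuous.comp (hw n).continuous).mul
        (hF.contDiff_comp d).continuous).aestronglyMeasurable
    · refine fun n => Eventually.of_forall fun y => ?_
      rw [norm_mul, norm_mul]
      gcongr
      calc ‖p (w n y)‖ * ‖F (‖y‖ ^ 2)‖ ≤ 1 * B3 :=
            mul_le_mul (hp1 _) (hB3 y) (norm_nonneg _) zero_le_one
        _ = B3 := one_mul _
    · filter_upwards [hwae] with y hy
      exact (((hp.continuous.tendsto _).comp hy).mul_const _).const_mul _
  have hlim2 : Tendsto (fun n => ∫ y, P (w n y) * radL d β F (‖y‖ ^ 2)) atTop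
      (𝓝 (∫ y, P (W y) * radL d β F (‖y‖ ^ 2))) := by
    obtain ⟨B4, hB4⟩ := (isCompact_Icc (a := -N₁) (b := N₁)).exists_bound_of_continuousOn
      hPcont.continuousOn
    refine tendsto_integral_of_dominated_convergence (fun y => ‖B4 * radL d β F (‖y‖ ^ 2)‖) ?_ ?_
      ?_ ?_
    · intro n
      exact ((hPcont.comp (hw n).continuous).mul
        ((hF.continuous_radL d β).comp (by fun_prop))).aestronglyMeasurable
    · exact (hF.integrable_mul_radL β (Q := fun _ => B4) continuous_const).norm
    · refine fun n => Eventually.of_forall fun y => ?_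
      rw [norm_mul, norm_mul]
      gcongr
      exact (hB4 _ (abs_le.1 (hwN n y))).trans (le_abs_self _)
    · filter_upwards [hae'] with y hy
      by_cases hyK : y ∈ annulus d a b
      · exact ((hPcont.tendsto _).comp (hy hyK)).mul_const _
      · have h0 : radL d β F (‖y‖ ^ 2) = 0 := hF.radL_zero d β hyK
        simp [h0]
  have hlim3 : Tendsto (fun n => (∫⁻ y in annulus d a b,
      (1 + ‖H y‖ₑ) * ‖gradient (w n) y - H y‖ₑ).toReal) atTop (𝓝 0) := by
    simpa [Function.comp_def] using (ENNReal.tendsto_toReal ENNReal.zero_ne_top).comp hwe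
  have hR := (hlim2.add (hlim3.const_mul (max B1 (max B2 0)))).const_mul c
  rw [mul_zero, add_zero] at hR
  refine le_of_tendsto_of_tendsto hlim1 hR ?_
  filter_upwards [hwe.eventually (gt_mem_nhds ENNReal.zero_lt_top)] with n hn
  refine h.test_le hc hF hp hP hp1 hp0 hpN ?_ ?_ hF0 (hw n) hn.ne
  · exact fun y => (hB1 y).trans (le_max_left _ _)
  · intro y
    have h1 := (le_abs_self _).trans (hB2 y)
    exact h1.trans ((le_max_left _ _).trans (le_max_right _ _))

end IsEllipticPair


theorem smoothTransition_integral_bounds (x : ℝ) :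
    |(∫ t in (0 : ℝ)..x, Real.smoothTransition t) - max x 0| ≤ 1 := by
  have hi : ∀ a b, IntervalIntegrable Real.smoothTransition volume a b :=
    fun a b => Real.smoothTransition.continuous.intervalIntegrable a b
  rcases le_total x 0 with hx | hx
  · have : ∫ t in (0 : ℝ)..x, Real.smoothTransition t = ∫ t in (0 : ℝ)..x, (0 : ℝ) := by
      refine intervalIntegral.integral_congr fun t ht => ?_
      rw [uIcc_of_ge hx] at ht
      exact Real.smoothTransition.zero_of_nonpos ht.2
    rw [this, max_eq_right hx]; simp
  have hle : ∫ t in (0 : ℝ)..x, Real.smoothTransition t ≤ x := by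
    have := intervalIntegral.integral_mono hx (hi 0 x) (intervalIntegrable_const (c := (1 : ℝ)))
      fun t => Real.smoothTransition.le_one t
    simpa using this
  have hge : x - 1 ≤ ∫ t in (0 : ℝ)..x, Real.smoothTransition t := by
    rcases le_total x 1 with h1 | h1
    · exact (sub_nonpos.2 h1).trans
        (intervalIntegral.integral_nonneg hx fun t _ => Real.smoothTransition.nonneg t)
    · rw [← intervalIntegral.integral_add_adjacent_intervals (hi 0 1) (hi 1 x)]
      have e1 : ∫ t in (1 : ℝ)..x, Real.smoothTransition t = x - 1 := by
        have : ∫ t in (1 : ℝ)..x, Real.smoothTransition t = ∫ t in (1 : ℝ)..x, (1 : ℝ) := by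
          refine intervalIntegral.integral_congr fun t ht => ?_
          rw [uIcc_of_le h1] at ht
          exact Real.smoothTransition.one_of_one_le ht.1
        rw [this]; simp
      have e2 : 0 ≤ ∫ t in (0 : ℝ)..1, Real.smoothTransition t :=
        intervalIntegral.integral_nonneg zero_le_one fun t _ => Real.smoothTransition.nonneg t
      linarith
  rw [max_eq_left hx, abs_le]
  constructor <;> linarith

theorem deriv_smoothTransition_nonneg (x : ℝ) : 0 ≤ deriv Real.smoothTransition x :=
  Real.smoothTransition.monotone.deriv_nonneg

theorem deriv_smoothTransition_eq_zero {x : ℝ} (hx : x ∉ Icc (0 : ℝ) 1) :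
    deriv Real.smoothTransition x = 0 := by
  rw [mem_Icc, not_and_or, not_le, not_le] at hx
  rcases hx with hx | hx
  · have : Real.smoothTransition =ᶠ[𝓝 x] fun _ => 0 := by
      filter_upwards [Iio_mem_nhds hx] with t ht
        using Real.smoothTransition.zero_of_nonpos (le_of_lt ht)
    rw [this.deriv_eq, deriv_const]
  · have : Real.smoothTransition =ᶠ[𝓝 x] fun _ => 1 := by
      filter_upwards [Ioi_mem_nhds hx] with t ht
        using Real.smoothTransition.one_of_one_le (le_of_lt ht)
    rw [this.deriv_eq, deriv_const]

theorem exists_deriv_smoothTransition_le : ∃ N, ∀ x, deriv Real.smoothTransition x ≤ N := by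
  have hc : Continuous (deriv Real.smoothTransition) :=
    (Real.smoothTransition.contDiff (n := ⊤)).continuous_deriv (by simp)
  obtain ⟨N, hN⟩ := hc.bounded_above_of_compact_support
    (HasCompactSupport.intro isCompact_Icc fun x hx => deriv_smoothTransition_eq_zero hx)
  exact ⟨N, fun x => (le_abs_self _).trans (hN x)⟩

namespace IsEllipticPair

variable {d : ℕ} {β c : ℝ} {W : E d → ℝ} {H : E d → E d} {f : E d → ℝ}

theorem integral_mul_eq (h : IsEllipticPair β c W H f) (hc : 0 ≤ c) {F : ℝ → ℝ} {a b : ℝ}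
    (hF : IsProfile F a b) (hF0 : ∀ s, 0 ≤ F s) :
    ∫ y, f y * F (‖y‖ ^ 2) = c * ∫ y, W y * radL d β F (‖y‖ ^ 2) := by
  apply le_antisymm
  · have := h.kato_smooth hc hF hF0 (p := fun _ => 1) (P := fun x => x) contDiff_const hasDerivAt_id
      (by simp) (by simp) (N := 0) (by simp)
    simpa using this
  · have := h.kato_smooth hc hF hF0 (p := fun _ => -1) (P := fun x => -x) contDiff_const
      (fun x => hasDerivAt_neg x) (by simp) (by simp) (N := 0) (by simp)
    simp only [neg_mul, one_mul, mul_neg, integral_neg] at this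
    linarith

/-- Kato's inequality. -/
theorem kato (h : IsEllipticPair β c W H f) (hc : 0 ≤ c) {F : ℝ → ℝ} {a b : ℝ}
    (hF : IsProfile F a b) (hF0 : ∀ s, 0 ≤ F s) :
    ∫ y, f y * ((if 0 < W y then 1 else 0) * F (‖y‖ ^ 2)) ≤
      c * ∫ y, max (W y) 0 * radL d β F (‖y‖ ^ 2) := by
  obtain ⟨M, hM⟩ := h.bdd
  obtain ⟨N, hN⟩ := exists_deriv_smoothTransition_le
  have hSd : Differentiable ℝ Real.smoothTransition :=
    (Real.smoothTransition.contDiff (n := ⊤)).differentiable (by simp)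
  let p : ℕ → ℝ → ℝ := fun n x => Real.smoothTransition (((n : ℝ) + 1) * x)
  let Q : ℝ → ℝ := fun x => ∫ t in (0 : ℝ)..x, Real.smoothTransition t
  let P : ℕ → ℝ → ℝ := fun n x => ((n : ℝ) + 1)⁻¹ * Q (((n : ℝ) + 1) * x)
  have hlin : ∀ (n : ℕ) (x : ℝ), HasDerivAt (fun x => ((n : ℝ) + 1) * x) ((n : ℝ) + 1) x :=
    fun n x => by simpa using (hasDerivAt_id x).const_mul ((n : ℝ) + 1)
  have hQd : ∀ x, HasDerivAt Q (Real.smoothTransition x) x := fun x =>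
    intervalIntegral.integral_hasDerivAt_right
      (Real.smoothTransition.continuous.intervalIntegrable _ _)
      (Real.smoothTransition.continuous.stronglyMeasurableAtFilter _ _)
      Real.smoothTransition.continuous.continuousAt
  have hPd : ∀ n x, HasDerivAt (P n) (p n x) x := by
    intro n x
    have h1 := ((hQd (((n : ℝ) + 1) * x)).comp x (hlin n x)).const_mul ((n : ℝ) + 1)⁻¹
    convert! h1 using 1
    have : ((n : ℝ) + 1) ≠ 0 := by positivity
    simp only [p]
    field_simp
  have hpd : ∀ n x, deriv (p n) x = deriv Real.smoothTransition (((n : ℝ) + 1) * x) *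
      ((n : ℝ) + 1) := fun n x => ((hSd _).hasDerivAt.comp x (hlin n x)).deriv
  have hPb : ∀ n x, |P n x - max x 0| ≤ ((n : ℝ) + 1)⁻¹ := by
    intro n x
    have hn : 0 < ((n : ℝ) + 1) := by positivity
    have h1 := smoothTransition_integral_bounds (((n : ℝ) + 1) * x)
    have h2 : max (((n : ℝ) + 1) * x) 0 = ((n : ℝ) + 1) * max x 0 := by
      rw [mul_max_of_nonneg _ _ hn.le, mul_zero]
    have h3 : P n x - max x 0 = ((n : ℝ) + 1)⁻¹ * (Q (((n : ℝ) + 1) * x) -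
        max (((n : ℝ) + 1) * x) 0) := by
      rw [h2, mul_sub, ← mul_assoc, inv_mul_cancel₀ hn.ne', one_mul]
    rw [h3, abs_mul, abs_of_pos (inv_pos.2 hn)]
    exact mul_le_of_le_one_right (inv_pos.2 hn).le h1
  have key : ∀ n, ∫ y, f y * (p n (W y) * F (‖y‖ ^ 2)) ≤
      c * ∫ y, P n (W y) * radL d β F (‖y‖ ^ 2) := by
    intro n
    refine h.kato_smooth hc hF hF0 (N := N * ((n : ℝ) + 1)) ?_ (hPd n) ?_ ?_ ?_
    · exact Real.smoothTransition.contDiff.comp (contDiff_const.mul contDiff_id)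
    · intro x
      rw [abs_of_nonneg (Real.smoothTransition.nonneg _)]
      exact Real.smoothTransition.le_one _
    · intro x
      rw [hpd]
      exact mul_nonneg (deriv_smoothTransition_nonneg _) (by positivity)
    · intro x
      rw [hpd]
      exact mul_le_mul_of_nonneg_right (hN _) (by positivity)
  have hinv : Tendsto (fun n : ℕ => ((n : ℝ) + 1)⁻¹) atTop (𝓝 0) := by
    simpa using tendsto_one_div_add_atTop_nhds_zero_nat (𝕜 := ℝ)
  have hptend : ∀ x, Tendsto (fun n => p n x) atTop (𝓝 (if 0 < x then 1 else 0)) := by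
    intro x
    split_ifs with hx
    · refine tendsto_const_nhds.congr' ?_
      obtain ⟨n₀, hn₀⟩ := exists_nat_gt (1 / x)
      filter_upwards [eventually_ge_atTop n₀] with n hn
      symm
      apply Real.smoothTransition.one_of_one_le
      have h1 : 1 / x ≤ (n : ℝ) + 1 := by
        have : (n₀ : ℝ) ≤ n := by exact_mod_cast hn
        linarith
      rwa [div_le_iff₀ hx] at h1
    · refine tendsto_const_nhds.congr fun n => ?_
      symm
      apply Real.smoothTransition.zero_of_nonpos
      exact mul_nonpos_of_nonneg_of_nonpos (by positivity) (not_lt.1 hx)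
  have hPtend : ∀ x, Tendsto (fun n => P n x) atTop (𝓝 (max x 0)) := by
    intro x
    rw [tendsto_iff_norm_sub_tendsto_zero]
    exact squeeze_zero (fun _ => norm_nonneg _) (fun n => hPb n x) hinv
  have hfi := h.integrableOn a b hF.pos
  have hset : ∀ q : E d → ℝ, ∫ y, f y * (q y * F (‖y‖ ^ 2)) =
      ∫ y in annulus d a b, f y * (q y * F (‖y‖ ^ 2)) := by
    intro q
    rw [setIntegral_eq_integral_of_forall_compl_eq_zero]
    intro y hy
    rw [hF.zero _ hy]; ring
  have hlim1 : Tendsto (fun n => ∫ y, f y * (p n (W y) * F (‖y‖ ^ 2))) atTop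
      (𝓝 (∫ y, f y * ((if 0 < W y then 1 else 0) * F (‖y‖ ^ 2)))) := by
    obtain ⟨B3, hB3⟩ := (hF.contDiff_comp d).continuous.bounded_above_of_compact_support
      (hF.hasCompactSupport_comp d)
    rw [hset (fun y => if 0 < W y then 1 else 0)]
    simp_rw [fun n => hset (fun y => p n (W y))]
    refine tendsto_integral_of_dominated_convergence (fun y => ‖f y‖ * B3) ?_ (hfi.norm.mul_const _)
      ?_ ?_
    · intro n
      have hpc : Continuous (p n) :=
        Real.smoothTransition.continuous.comp (continuous_const.mul continuous_id)
      exact hfi.1.mul ((hpc.comp_aestronglyMeasurable h.meas.restrict).mul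
        (hF.contDiff_comp d).continuous.aestronglyMeasurable)
    · refine fun n => Eventually.of_forall fun y => ?_
      rw [norm_mul, norm_mul]
      gcongr
      refine (mul_le_mul ?_ (hB3 y) (norm_nonneg _) zero_le_one).trans (one_mul B3).le
      rw [Real.norm_of_nonneg (Real.smoothTransition.nonneg _)]
      exact Real.smoothTransition.le_one _
    · exact Eventually.of_forall fun y => ((hptend _).mul_const _).const_mul _
  have hlim2 : Tendsto (fun n => ∫ y, P n (W y) * radL d β F (‖y‖ ^ 2)) atTop
      (𝓝 (∫ y, max (W y) 0 * radL d β F (‖y‖ ^ 2))) := by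
    refine tendsto_integral_of_dominated_convergence
      (fun y => ‖(M + 1) * radL d β F (‖y‖ ^ 2)‖) ?_ ?_ ?_ ?_
    · intro n
      have hPc : Continuous (P n) := continuous_iff_continuousAt.2 fun x => (hPd n x).continuousAt
      exact (hPc.comp_aestronglyMeasurable h.meas).mul
        ((hF.continuous_radL d β).comp (by fun_prop)).aestronglyMeasurable
    · exact (hF.integrable_mul_radL β (Q := fun _ => M + 1) continuous_const).norm
    · intro n
      filter_upwards [hM] with y hy
      rw [norm_mul (P n (W y)), norm_mul (M + 1)]
      refine mul_le_mul_of_nonneg_right ?_ (norm_nonneg _)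
      have h1 := hPb n (W y)
      have h2 : ((n : ℝ) + 1)⁻¹ ≤ 1 := inv_le_one_of_one_le₀ (by
        have : (0 : ℝ) ≤ n := Nat.cast_nonneg n
        linarith)
      have h3 : |max (W y) 0| ≤ |W y| := by
        rcases le_total (W y) 0 with h0 | h0
        · simp [max_eq_right h0]
        · simp [max_eq_left h0]
      calc ‖P n (W y)‖ = |P n (W y) - max (W y) 0 + max (W y) 0| := by
            rw [sub_add_cancel, Real.norm_eq_abs]
        _ ≤ |P n (W y) - max (W y) 0| + |max (W y) 0| := abs_add_le _ _
        _ ≤ M + 1 := by linarith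
        _ ≤ ‖M + 1‖ := le_abs_self _
    · exact Eventually.of_forall fun y => (hPtend _).mul_const _
  exact le_of_tendsto_of_tendsto hlim1 (hlim2.const_mul c) (Eventually.of_forall key)

end IsEllipticPair


theorem _root_.AbsolutelyContinuousOnInterval.max_zero {X : ℝ → ℝ} {a b : ℝ}
    (h : AbsolutelyContinuousOnInterval X a b) :
    AbsolutelyContinuousOnInterval (fun s => max (X s) 0) a b := by
  unfold AbsolutelyContinuousOnInterval at h ⊢
  refine squeeze_zero (fun _ => Finset.sum_nonneg fun _ _ => dist_nonneg) (fun e => ?_) h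
  refine Finset.sum_le_sum fun i _ => ?_
  rw [Real.dist_eq, Real.dist_eq]
  exact (abs_max_sub_max_le_abs _ _ _)

theorem max_zero_integral_eq {f : ℝ → ℝ} {a b : ℝ} (hab : a ≤ b) (hf : IntegrableOn f (Ioc a b))
    (x : ℝ) :
    max (x + ∫ r in a..b, f r) 0 - max x 0 =
      ∫ s in Ioc a b, if 0 < x + ∫ r in a..s, f r then f s else 0 := by
  have hfi : IntervalIntegrable f volume a b :=
    (intervalIntegrable_iff_integrableOn_Ioc_of_le hab).2 hf
  set X : ℝ → ℝ := fun s => x + ∫ r in a..s, f r with hX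
  have hac : AbsolutelyContinuousOnInterval X a b := by
    have h1 := hfi.absolutelyContinuousOnInterval_intervalIntegral (c := a) (by simp)
    have h2 : AbsolutelyContinuousOnInterval (fun _ : ℝ => x) a b :=
      (LipschitzOnWith.of_dist_le_mul (K := 0) (by simp)).absolutelyContinuousOnInterval
    exact h2.add h1
  have hac' := hac.max_zero
  have key := hac'.integral_deriv_eq_sub
  have hXa : X a = x := by simp [hX]
  rw [hXa] at key
  rw [← key, intervalIntegral.integral_of_le hab]
  refine setIntegral_congr_ae measurableSet_Ioc ?_
  filter_upwards [hac'.ae_differentiableAt, hfi.ae_hasDerivAt_integral] with s h1 h2 hs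
  have hs' : s ∈ uIcc a b := by rw [uIcc_of_le hab]; exact Ioc_subset_Icc_self hs
  have hd : HasDerivAt X (f s) s := (h2 hs' a (by simp)).const_add x
  split_ifs with hpos
  · have : (fun s => max (X s) 0) =ᶠ[𝓝 s] X := by
      filter_upwards [hd.continuousAt.eventually (lt_mem_nhds hpos)] with r hr
        using max_eq_left hr.le
    rw [this.deriv_eq, hd.deriv]
  · have : IsLocalMin (fun s => max (X s) 0) s := by
      refine Eventually.of_forall fun r => ?_
      simp only
      rw [max_eq_right (not_lt.1 hpos)]
      exact le_max_right _ _
    exact this.deriv_eq_zero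

section Evolution

variable {α : Type*} [MeasurableSpace α] {μ : Measure α} [SFinite μ] {h Y : ℝ → α → ℝ} {a b : ℝ}

theorem integral_sub_eq_of_evolution (hab : a ≤ b)
    (hh : Integrable (fun p : ℝ × α => h p.1 p.2) ((volume.restrict (Ioc a b)).prod μ))
    (hYa : Integrable (Y a) μ) (hYb : Integrable (Y b) μ)
    (hev : ∀ᵐ y ∂μ, Y b y - Y a y = ∫ r in a..b, h r y) :
    (∫ y, Y b y ∂μ) - ∫ y, Y a y ∂μ = ∫ s in Ioc a b, ∫ y, h s y ∂μ := by
  rw [← integral_sub hYb hYa, integral_congr_ae hev]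
  simp_rw [intervalIntegral.integral_of_le hab]
  exact (integral_integral_swap hh).symm

theorem integral_max_sub_eq_of_evolution (hab : a ≤ b)
    (hh : Integrable (fun p : ℝ × α => h p.1 p.2) ((volume.restrict (Ioc a b)).prod μ))
    (hYa : Integrable (Y a) μ) (hYb : Integrable (Y b) μ)
    (hev : ∀ s ∈ Icc a b, ∀ᵐ y ∂μ, Y s y - Y a y = ∫ r in a..s, h r y) :
    IntegrableOn (fun s => ∫ y, (if 0 < Y s y then h s y else 0) ∂μ) (Ioc a b) ∧
    (∫ y, max (Y b y) 0 ∂μ) - ∫ y, max (Y a y) 0 ∂μ =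
      ∫ s in Ioc a b, ∫ y, (if 0 < Y s y then h s y else 0) ∂μ := by
  set h' : ℝ × α → ℝ := hh.1.mk _ with hh'
  have hsm : StronglyMeasurable h' := hh.1.stronglyMeasurable_mk
  have hae : (fun p : ℝ × α => h p.1 p.2) =ᵐ[(volume.restrict (Ioc a b)).prod μ] h' :=
    hh.1.ae_eq_mk
  have hh'i : Integrable h' ((volume.restrict (Ioc a b)).prod μ) := hh.congr hae
  set y₀ : α → ℝ := hYa.1.mk _ with hy₀
  have hy₀m : StronglyMeasurable y₀ := hYa.1.stronglyMeasurable_mk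
  let Z : ℝ × α → ℝ := fun p => y₀ p.2 + ∫ r in Ioc a b, if r ≤ p.1 then h' (r, p.2) else 0
  have hZm : StronglyMeasurable Z := by
    refine (hy₀m.comp_measurable measurable_snd).add ?_
    refine StronglyMeasurable.integral_prod_right (ν := volume.restrict (Ioc a b))
      (f := fun (p : ℝ × α) (r : ℝ) => if r ≤ p.1 then h' (r, p.2) else 0) ?_
    refine StronglyMeasurable.ite ?_ ?_ stronglyMeasurable_const
    · exact measurableSet_le measurable_snd (measurable_fst.comp measurable_fst)
    · exact hsm.comp_measurable (measurable_snd.prodMk (measurable_snd.comp measurable_fst))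
  have hZs : ∀ s ∈ Icc a b, ∀ y, Z (s, y) = y₀ y + ∫ r in a..s, h' (r, y) := by
    intro s hs y
    simp only [Z]
    rw [intervalIntegral.integral_of_le hs.1]
    congr 1
    have e : (fun r => if r ≤ s then h' (r, y) else 0) =
        (Iic s).indicator fun r => h' (r, y) := by
      ext r; simp [indicator]
    rw [e, setIntegral_indicator measurableSet_Iic]
    congr 2
    ext r
    simp only [mem_inter_iff, mem_Ioc, mem_Iic]
    constructor
    · rintro ⟨⟨h1, h2⟩, h3⟩; exact ⟨h1, h3⟩
    · rintro ⟨h1, h3⟩; exact ⟨⟨h1, h3.trans hs.2⟩, h3⟩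
  have hsec : ∀ᵐ y ∂μ, ∀ᵐ r ∂(volume.restrict (Ioc a b)), h r y = h' (r, y) := by
    have := (Measure.measurePreserving_swap (μ := μ)
      (ν := volume.restrict (Ioc a b))).quasiMeasurePreserving.ae_eq_comp hae
    exact Measure.ae_ae_of_ae_prod this
  have hYZ : ∀ s ∈ Icc a b, ∀ᵐ y ∂μ, Y s y = Z (s, y) := by
    intro s hs
    filter_upwards [hev s hs, hYa.1.ae_eq_mk, hsec] with y h1 h2 h3
    rw [hZs s hs, ← hy₀] at *
    have h4 : ∫ r in a..s, h r y = ∫ r in a..s, h' (r, y) := by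
      rw [intervalIntegral.integral_of_le hs.1, intervalIntegral.integral_of_le hs.1]
      refine setIntegral_congr_ae measurableSet_Ioc ?_
      have h5 := (ae_restrict_iff' measurableSet_Ioc).1 h3
      filter_upwards [h5] with r hr hrs using hr ⟨hrs.1, hrs.2.trans hs.2⟩
    rw [← h4, ← h1, ← h2]; ring
  let k : ℝ × α → ℝ := fun p => if 0 < Z p then h' p else 0
  have hki : Integrable k ((volume.restrict (Ioc a b)).prod μ) := by
    have : k = {p | 0 < Z p}.indicator h' := by ext p; simp [k, indicator]
    rw [this]
    exact hh'i.indicator (measurableSet_lt measurable_const hZm.measurable)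
  have hsec2 : ∀ᵐ s ∂(volume.restrict (Ioc a b)), ∀ᵐ y ∂μ, h s y = h' (s, y) :=
    Measure.ae_ae_of_ae_prod hae
  have hinner : ∀ᵐ s ∂(volume.restrict (Ioc a b)),
      ∫ y, (if 0 < Y s y then h s y else 0) ∂μ = ∫ y, k (s, y) ∂μ := by
    filter_upwards [hsec2, ae_restrict_mem measurableSet_Ioc] with s h1 hs
    refine integral_congr_ae ?_
    filter_upwards [h1, hYZ s (Ioc_subset_Icc_self hs)] with y h2 h3
    rw [h2, h3]
  have hint : IntegrableOn (fun s => ∫ y, (if 0 < Y s y then h s y else 0) ∂μ) (Ioc a b) :=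
    hki.integral_prod_left.congr (hinner.mono fun s hs => hs.symm)
  refine ⟨hint, ?_⟩
  have hmax : ∀ {g : α → ℝ}, Integrable g μ → Integrable (fun y => max (g y) 0) μ :=
    fun hg => hg.pos_part
  rw [integral_congr_ae hinner, ← integral_sub (hmax hYb) (hmax hYa), integral_integral_swap hki]
  refine integral_congr_ae ?_
  have hsec3 : ∀ᵐ y ∂μ, IntegrableOn (fun r => h' (r, y)) (Ioc a b) := hh'i.prod_left_ae
  filter_upwards [hYZ b (right_mem_Icc.2 hab), hYZ a (left_mem_Icc.2 hab), hsec3] with y h1 h2 h3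
  have h4 := max_zero_integral_eq hab h3 (y₀ y)
  rw [h1, h2, hZs b (right_mem_Icc.2 hab), hZs a (left_mem_Icc.2 hab),
    intervalIntegral.integral_same, add_zero, h4]
  refine setIntegral_congr_fun measurableSet_Ioc fun s hs => ?_
  simp only [k]
  rw [hZs s (Ioc_subset_Icc_self hs)]

end Evolution


theorem exists_annulus_superset {d : ℕ} {K : Set (E d)} (hK : IsCompact K) (h0 : (0 : E d) ∉ K) :
    ∃ a b, 0 < a ∧ a < b ∧ K ⊆ annulus d a b := by
  rcases K.eq_empty_or_nonempty with rfl | hne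
  · exact ⟨1, 2, one_pos, one_lt_two, empty_subset _⟩
  have hc : ContinuousOn (fun y : E d => ‖y‖ ^ 2) K := by fun_prop
  obtain ⟨y₁, h1, h1'⟩ := hK.exists_isMinOn hne hc
  obtain ⟨y₂, h2, h2'⟩ := hK.exists_isMaxOn hne hc
  have hy : y₁ ≠ 0 := fun h => h0 (h ▸ h1)
  refine ⟨‖y₁‖ ^ 2, ‖y₂‖ ^ 2 + 1, by positivity, ?_, fun y hy => ⟨h1' hy, ?_⟩⟩
  · have : ‖y₁‖ ^ 2 ≤ ‖y₂‖ ^ 2 := h1' h2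
    linarith
  · have : ‖y‖ ^ 2 ≤ ‖y₂‖ ^ 2 := h2' hy
    linarith

theorem continuous_mul_of_continuousOn_compl_zero {X F : Type*} [TopologicalSpace X] [Zero X]
    [T1Space X] [NormedAddCommGroup F] [NormedSpace ℝ F] {ψ : X → ℝ} (hψ : Continuous ψ)
    (h0 : (0 : X) ∉ tsupport ψ) {k : X → F} (hk : ContinuousOn k {0}ᶜ) :
    Continuous fun y => ψ y • k y := by
  rw [continuous_iff_continuousAt]
  intro y
  rcases eq_or_ne y 0 with rfl | hy
  · have : (fun y => ψ y • k y) =ᶠ[𝓝 0] fun _ => 0 := by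
      filter_upwards [(isClosed_tsupport ψ).isOpen_compl.mem_nhds h0] with z hz
      rw [image_eq_zero_of_notMem_tsupport hz, zero_smul]
    exact continuousAt_const.congr this.symm
  · exact hψ.continuousAt.smul (hk.continuousAt (isOpen_compl_singleton.mem_nhds hy))

namespace IsEllipticPair

variable {d : ℕ} {β c : ℝ} {W W' : E d → ℝ} {H H' : E d → E d} {f f' : E d → ℝ}

theorem integrable_mul (h : IsEllipticPair β c W H f) {φ : E d → ℝ} (hφ : Continuous φ)
    (hc : HasCompactSupport φ) (h0 : (0 : E d) ∉ tsupport φ) : Integrable fun y => f y * φ y := by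
  obtain ⟨a, b, ha, -, hK⟩ := exists_annulus_superset hc.isCompact h0
  obtain ⟨N, hN⟩ := hφ.bounded_above_of_compact_support hc
  rw [← integrableOn_iff_integrable_of_support_subset (s := tsupport φ)]
  · exact ((h.integrableOn a b ha).mono_set hK).mul_bdd hφ.aestronglyMeasurable
      (Eventually.of_forall hN)
  · intro y hy
    exact subset_tsupport _ (right_ne_zero_of_mul hy)

theorem integrable_inner (h : IsEllipticPair β c W H f) {φ : E d → ℝ} (hφ : ContDiff ℝ ∞ φ)
    (hc : HasCompactSupport φ) (h0 : (0 : E d) ∉ tsupport φ) :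
    Integrable fun y => ‖y‖ ^ (-β) * inner ℝ (H y) (gradient φ y) := by
  obtain ⟨a, b, ha, hab, hK⟩ := exists_annulus_superset hc.isCompact h0
  have hφ1 : ContDiff ℝ 1 φ := hφ.of_le (by simp)
  obtain ⟨χ, hχ, hχc, hχ0, hχs, hχ1, hχ2⟩ := exists_cutoff ha hab d
  have hk : Continuous fun y : E d => χ y • ‖y‖ ^ (-β) := by
    refine continuous_mul_of_continuousOn_compl_zero hχ.continuous hχ0 ?_
    exact (continuous_norm.continuousOn).rpow_const fun y hy => Or.inl (norm_ne_zero_iff.2 hy)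
  have hg0 : ∀ y, y ∉ tsupport φ → gradient φ y = 0 := fun y hy =>
    image_eq_zero_of_notMem_tsupport fun hh => hy (tsupport_gradient_subset φ hh)
  have hV : Continuous fun y : E d => (χ y • ‖y‖ ^ (-β)) • gradient φ y :=
    hk.smul (continuous_gradient hφ1)
  have hVc : HasCompactSupport fun y : E d => (χ y • ‖y‖ ^ (-β)) • gradient φ y :=
    hasCompactSupport_fun_smul_left _ (hasCompactSupport_gradient hc)
  obtain ⟨N, hN⟩ := hV.bounded_above_of_compact_support hVc
  have e : (fun y => ‖y‖ ^ (-β) * inner ℝ (H y) (gradient φ y)) =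
      fun y => inner ℝ (H y) ((χ y • ‖y‖ ^ (-β)) • gradient φ y) := by
    ext y
    by_cases hy : y ∈ tsupport φ
    · rw [hχ1 y (hK hy), one_smul, real_inner_smul_right]
    · simp [hg0 y hy]
  rw [e, ← integrableOn_iff_integrable_of_support_subset (s := annulus d a b)]
  · have hHi := h.integrableOn_grad ha hab
    refine (hHi.norm.mul_const N).mono' (hHi.1.inner hV.aestronglyMeasurable)
      (Eventually.of_forall fun y => ?_)
    exact (norm_inner_le_norm _ _).trans (mul_le_mul_of_nonneg_left (hN y) (norm_nonneg _))
  · intro y hy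
    by_contra hcon
    exact hy (by simp [hg0 y fun hh => hcon (hK hh)])

theorem sub (h : IsEllipticPair β c W H f) (h' : IsEllipticPair β c W' H' f') :
    IsEllipticPair β c (fun y => W y - W' y) (fun y => H y - H' y) (fun y => f y - f' y) where
  meas := h.meas.sub h'.meas
  bdd := by
    obtain ⟨M, hM⟩ := h.bdd
    obtain ⟨M', hM'⟩ := h'.bdd
    refine ⟨M + M', ?_⟩
    filter_upwards [hM, hM'] with y h1 h2
    exact (abs_sub _ _).trans (add_le_add h1 h2)
  grad := by
    intro ψ hψ hc h0
    obtain ⟨i1, e1⟩ := h.grad ψ hψ hc h0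
    obtain ⟨i2, e2⟩ := h'.grad ψ hψ hc h0
    obtain ⟨M, hM⟩ := h.bdd
    obtain ⟨M', hM'⟩ := h'.bdd
    refine ⟨i1.sub i2, ?_⟩
    have hψ1 : ContDiff ℝ 1 ψ := hψ.of_le (by simp)
    have hint : ∀ {X : E d → E d}, IntegrableOn X (tsupport ψ) → Integrable fun y => ψ y • X y := by
      intro X hX
      obtain ⟨N, hN⟩ := hψ.continuous.bounded_above_of_compact_support hc
      rw [← integrableOn_iff_integrable_of_support_subset (s := tsupport ψ)]
      · exact hX.bdd_smul N hψ.continuous.aestronglyMeasurable (Eventually.of_forall hN)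
      · intro y hy
        exact subset_tsupport _ (left_ne_zero_of_smul hy)
    simp_rw [sub_smul, smul_sub]
    rw [integral_sub, integral_sub (hint i1) (hint i2), e1, e2]
    · abel
    · exact integrable_bdd_smul h.meas hM (continuous_gradient hψ1) (hasCompactSupport_gradient hc)
    · exact integrable_bdd_smul h'.meas hM' (continuous_gradient hψ1)
        (hasCompactSupport_gradient hc)
  sq_integrableOn := by
    intro a b ha
    have hab : a < max a b + 1 := (le_max_left a b).trans_lt (lt_add_one _)
    have hs : annulus d a b ⊆ annulus d a (max a b + 1) := fun y hy =>
      ⟨hy.1, hy.2.trans ((le_max_right a b).trans (lt_add_one _).le)⟩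
    have m1 := (h.integrableOn_grad ha hab).1
    have m2 := (h'.integrableOn_grad ha hab).1
    refine IntegrableOn.mono_set ?_ hs
    refine ((h.sq_integrableOn a _ ha).add (h'.sq_integrableOn a _ ha)).const_mul 2
      |>.mono' ((m1.sub m2).norm.pow 2) (Eventually.of_forall fun y => ?_)
    rw [Real.norm_of_nonneg (by positivity), Pi.add_apply]
    nlinarith [norm_sub_le (H y) (H' y), norm_nonneg (H y - H' y), sq_nonneg (‖H y‖ - ‖H' y‖),
      norm_nonneg (H y), norm_nonneg (H' y)]
  integrableOn a b ha := (h.integrableOn a b ha).sub (h'.integrableOn a b ha)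
  eq := by
    intro φ hφ hc h0
    simp_rw [sub_mul, inner_sub_left, mul_sub]
    rw [integral_sub (h.integrable_mul hφ.continuous hc h0)
      (h'.integrable_mul hφ.continuous hc h0), integral_sub (h.integrable_inner hφ hc h0)
      (h'.integrable_inner hφ hc h0), h.eq φ hφ hc h0, h'.eq φ hφ hc h0]
    ring

end IsEllipticPair

/-- Strong solutions of the equation away from the origin, on the time interval `[0, t₀]`. -/
structure IsLocalStrongSolution {d : ℕ} (m β γ t₀ : ℝ) (v g : ℝ → E d → ℝ)
    (G : ℝ → E d → E d) : Prop where
  nonneg : ∀ s ∈ Icc 0 t₀, ∀ᵐ y, 0 ≤ v s y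
  meas : AEStronglyMeasurable (fun p : ℝ × E d => v p.1 p.2)
    ((volume.restrict (Ioc 0 t₀)).prod volume)
  bdd : ∃ M, ∀ᵐ s ∂(volume.restrict (Ioc 0 t₀)), ∀ᵐ y, v s y ≤ M
  pair : ∀ᵐ s ∂(volume.restrict (Ioc 0 t₀)),
    IsEllipticPair β ((1 - m) / m) (fun y => v s y ^ m) (G s) (fun y => g s y * ‖y‖ ^ (-γ))
  evolution : ∀ a b, 0 < a → a ≤ b → b ≤ t₀ → ∀ᵐ y, v b y - v a y = ∫ s in a..b, g s y
  integrable_deriv : ∀ a b, 0 < a → a ≤ b → b ≤ t₀ → ∀ (k : ℝ → ℝ) (a' b' : ℝ),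
    IsProfile k a' b' → Integrable (fun p : ℝ × E d => g p.1 p.2 * k (‖p.2‖ ^ 2))
      ((volume.restrict (Ioc a b)).prod volume)
  integrable : ∀ s ∈ Icc 0 t₀, ∀ (k : ℝ → ℝ) (a' b' : ℝ), IsProfile k a' b' →
    Integrable fun y => v s y * k (‖y‖ ^ 2)
  tendsto_zero : ∀ (k : ℝ → ℝ) (a' b' : ℝ), IsProfile k a' b' →
    Tendsto (fun s => ∫ y, |v s y - v 0 y| * |k (‖y‖ ^ 2)|) (𝓝[>] 0) (𝓝 0)

namespace IsLocalStrongSolution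

variable {d : ℕ} {m β γ t₀ : ℝ} {v g v' g' : ℝ → E d → ℝ} {G G' : ℝ → E d → E d}

theorem exists_pow_bound (hm : 0 < m) (h : IsLocalStrongSolution m β γ t₀ v g G) :
    ∃ M, 0 ≤ M ∧ ∀ᵐ s ∂(volume.restrict (Ioc 0 t₀)), ∀ᵐ y, 0 ≤ v s y ^ m ∧ v s y ^ m ≤ M := by
  obtain ⟨M, hM⟩ := h.bdd
  refine ⟨(max M 0) ^ m, by positivity, ?_⟩
  filter_upwards [hM, ae_restrict_mem measurableSet_Ioc] with s h1 hs
  filter_upwards [h1, h.nonneg s (Ioc_subset_Icc_self hs)] with y h2 h3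
  exact ⟨by positivity, Real.rpow_le_rpow h3 (h2.trans (le_max_left _ _)) hm.le⟩

theorem aestronglyMeasurable_pow_sub (hm : 0 < m) (h : IsLocalStrongSolution m β γ t₀ v g G)
    (h' : IsLocalStrongSolution m β γ t₀ v' g' G') :
    AEStronglyMeasurable (fun p : ℝ × E d => v p.1 p.2 ^ m - v' p.1 p.2 ^ m)
      ((volume.restrict (Ioc 0 t₀)).prod volume) := by
  have hc : Continuous fun x : ℝ => x ^ m := Real.continuous_rpow_const hm.le
  exact (hc.comp_aestronglyMeasurable h.meas).sub (hc.comp_aestronglyMeasurable h'.meas)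

theorem exists_flux_bound (hm : 0 < m) (h : IsLocalStrongSolution m β γ t₀ v g G)
    (h' : IsLocalStrongSolution m β γ t₀ v' g' G') {F : ℝ → ℝ} {a' b' : ℝ}
    (hF : IsProfile F a' b') {Θ : ℝ → ℝ} (hΘ : Continuous Θ) (hΘ1 : ∀ x, |Θ x| ≤ |x|) :
    AEStronglyMeasurable (fun s => ∫ y, Θ (v s y ^ m - v' s y ^ m) * radL d β F (‖y‖ ^ 2))
      (volume.restrict (Ioc 0 t₀)) ∧
    ∃ N, 0 ≤ N ∧ ∀ᵐ s ∂(volume.restrict (Ioc 0 t₀)),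
      ‖∫ y, Θ (v s y ^ m - v' s y ^ m) * radL d β F (‖y‖ ^ 2)‖ ≤ N := by
  obtain ⟨M, hM0, hM⟩ := h.exists_pow_bound hm
  obtain ⟨M', hM0', hM'⟩ := h'.exists_pow_bound hm
  constructor
  · have := (hΘ.comp_aestronglyMeasurable (h.aestronglyMeasurable_pow_sub hm h')).mul
      ((hF.continuous_radL d β).comp
        (by fun_prop : Continuous fun p : ℝ × E d => ‖p.2‖ ^ 2)).aestronglyMeasurable
    exact this.integral_prod_right'
  · have hi : Integrable fun y : E d => (M + M') * |radL d β F (‖y‖ ^ 2)| := by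
      have := (hF.integrable_mul_radL (d := d) β (Q := fun _ => 1) continuous_const).abs
      refine (this.const_mul (M + M')).congr (Eventually.of_forall fun y => ?_)
      simp
    refine ⟨∫ y : E d, (M + M') * |radL d β F (‖y‖ ^ 2)|,
      integral_nonneg fun y => mul_nonneg (by positivity) (abs_nonneg _), ?_⟩
    filter_upwards [hM, hM'] with s h1 h2
    refine norm_integral_le_of_norm_le hi ?_
    filter_upwards [h1, h2] with y h3 h4
    rw [norm_mul, Real.norm_eq_abs, Real.norm_eq_abs]
    refine mul_le_mul_of_nonneg_right ((hΘ1 _).trans ?_) (abs_nonneg _)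
    rw [abs_le]
    constructor <;> linarith [h3.1, h3.2, h4.1, h4.2]

theorem evolution_mul (h : IsLocalStrongSolution m β γ t₀ v g G)
    (h' : IsLocalStrongSolution m β γ t₀ v' g' G') {k : ℝ → ℝ} {a' b' : ℝ}
    (hk : IsProfile k a' b') {a b : ℝ} (ha : 0 < a) (hab : a ≤ b) (hb : b ≤ t₀) :
    ∀ᵐ y : E d, (v b y - v' b y) * k (‖y‖ ^ 2) - (v a y - v' a y) * k (‖y‖ ^ 2) =
      ∫ r in a..b, (g r y - g' r y) * k (‖y‖ ^ 2) := by
  filter_upwards [h.evolution a b ha hab hb, h'.evolution a b ha hab hb,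
    (h.integrable_deriv a b ha hab hb k a' b' hk).prod_left_ae,
    (h'.integrable_deriv a b ha hab hb k a' b' hk).prod_left_ae] with y e1 e2 i1 i2
  by_cases h0 : k (‖y‖ ^ 2) = 0
  · simp [h0]
  · have j : ∀ {q : ℝ → ℝ}, Integrable (fun r => q r * k (‖y‖ ^ 2)) (volume.restrict (Ioc a b)) →
        IntervalIntegrable q volume a b := by
      intro q hq
      rw [intervalIntegrable_iff_integrableOn_Ioc_of_le hab]
      have := hq.mul_const (k (‖y‖ ^ 2))⁻¹
      refine this.congr (Eventually.of_forall fun r => ?_)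
      simp only
      rw [mul_assoc, mul_inv_cancel₀ h0, mul_one]
    rw [intervalIntegral.integral_mul_const, intervalIntegral.integral_sub (j i1) (j i2), ← e1,
      ← e2]
    ring

theorem integrable_sub_mul (h : IsLocalStrongSolution m β γ t₀ v g G)
    (h' : IsLocalStrongSolution m β γ t₀ v' g' G') {k : ℝ → ℝ} {a' b' : ℝ}
    (hk : IsProfile k a' b') {s : ℝ} (hs : s ∈ Icc 0 t₀) :
    Integrable fun y => (v s y - v' s y) * k (‖y‖ ^ 2) := by
  simp_rw [sub_mul]
  exact (h.integrable s hs k a' b' hk).sub (h'.integrable s hs k a' b' hk)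

theorem integrable_deriv_sub (h : IsLocalStrongSolution m β γ t₀ v g G)
    (h' : IsLocalStrongSolution m β γ t₀ v' g' G') {k : ℝ → ℝ} {a' b' : ℝ}
    (hk : IsProfile k a' b') {a b : ℝ} (ha : 0 < a) (hab : a ≤ b) (hb : b ≤ t₀) :
    Integrable (fun p : ℝ × E d => (g p.1 p.2 - g' p.1 p.2) * k (‖p.2‖ ^ 2))
      ((volume.restrict (Ioc a b)).prod volume) := by
  simp_rw [sub_mul]
  exact (h.integrable_deriv a b ha hab hb k a' b' hk).sub
    (h'.integrable_deriv a b ha hab hb k a' b' hk)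

theorem contraction_aux (hm : 0 < m) (hm1 : m < 1) (h : IsLocalStrongSolution m β γ t₀ v g G)
    (h' : IsLocalStrongSolution m β γ t₀ v' g' G') {F : ℝ → ℝ} {a' b' : ℝ}
    (hF : IsProfile F a' b') (hF0 : ∀ s, 0 ≤ F s) {a : ℝ} (ha : 0 < a) (hat : a ≤ t₀) :
    (∫ y, max ((v t₀ y - v' t₀ y) * ((‖y‖ ^ 2) ^ (-γ / 2) * F (‖y‖ ^ 2))) 0) -
        ∫ y, max ((v a y - v' a y) * ((‖y‖ ^ 2) ^ (-γ / 2) * F (‖y‖ ^ 2))) 0 ≤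
      ∫ s in Ioc a t₀, (1 - m) / m *
        ∫ y, max (v s y ^ m - v' s y ^ m) 0 * radL d β F (‖y‖ ^ 2) := by
  have hc : 0 ≤ (1 - m) / m := div_nonneg (by linarith) hm.le
  have hk := hF.rpow_mul (-γ / 2)
  have ht0 : t₀ ∈ Icc 0 t₀ := ⟨ha.le.trans hat, le_rfl⟩
  obtain ⟨hint, heq⟩ := integral_max_sub_eq_of_evolution hat
    (h.integrable_deriv_sub h' hk ha hat le_rfl)
    (Y := fun s y => (v s y - v' s y) * ((‖y‖ ^ 2) ^ (-γ / 2) * F (‖y‖ ^ 2)))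
    (h.integrable_sub_mul h' hk ⟨ha.le, hat⟩) (h.integrable_sub_mul h' hk ht0)
    (fun s hs => h.evolution_mul h' hk ha hs.1 hs.2)
  rw [heq]
  obtain ⟨hmeas, N, -, hN⟩ := h.exists_flux_bound hm h' hF (Θ := fun x => max x 0)
    (by fun_prop) (fun x => by
      rcases le_total x 0 with h0 | h0
      · simp [max_eq_right h0]
      · simp [max_eq_left h0])
  have hsub : Ioc a t₀ ⊆ Ioc 0 t₀ := Ioc_subset_Ioc_left ha.le
  have hle := Measure.restrict_mono hsub (le_refl (volume : Measure ℝ))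
  refine integral_mono_ae hint ?_ ?_
  · refine Integrable.const_mul ?_ _
    exact Integrable.of_bound (hmeas.mono_measure hle) N (ae_mono hle hN)
  · filter_upwards [ae_mono hle h.pair, ae_mono hle h'.pair, ae_restrict_mem measurableSet_Ioc]
      with s p1 p2 hs
    refine le_trans (le_of_eq ?_) ((p1.sub p2).kato hc hF hF0)
    refine integral_congr_ae ?_
    filter_upwards [h.nonneg s (Ioc_subset_Icc_self (hsub hs)),
      h'.nonneg s (Ioc_subset_Icc_self (hsub hs))] with y n1 n2
    have hw0 : 0 ≤ (‖y‖ ^ 2) ^ (-γ / 2) * F (‖y‖ ^ 2) := mul_nonneg (by positivity) (hF0 _)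
    rw [norm_rpow_eq_sq_rpow]
    rcases hw0.eq_or_lt with h0 | h0
    · rw [← h0]
      simp only [mul_zero, lt_self_iff_false, if_false]
      linear_combination (g s y - g' s y) *
        (if 0 < v s y ^ m - v' s y ^ m then 1 else 0) * h0
    · have hiff : 0 < (v s y - v' s y) * ((‖y‖ ^ 2) ^ (-γ / 2) * F (‖y‖ ^ 2)) ↔
          0 < v s y ^ m - v' s y ^ m := by
        rw [mul_pos_iff_of_pos_right h0, sub_pos, sub_pos, Real.rpow_lt_rpow_iff n2 n1 hm]
      simp only [hiff]
      split_ifs <;> ring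

theorem tendsto_initial (h : IsLocalStrongSolution m β γ t₀ v g G)
    (h' : IsLocalStrongSolution m β γ t₀ v' g' G') {k : ℝ → ℝ} {a' b' : ℝ}
    (hk : IsProfile k a' b') (ht : 0 < t₀) {Θ : ℝ → ℝ} (hΘ : ∀ x y, |Θ x - Θ y| ≤ |x - y|)
    (hΘ0 : Θ 0 = 0) :
    Tendsto (fun a => ∫ y, Θ ((v a y - v' a y) * k (‖y‖ ^ 2))) (𝓝[>] 0)
      (𝓝 (∫ y, Θ ((v 0 y - v' 0 y) * k (‖y‖ ^ 2)))) := by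
  have hΘc : Continuous Θ := by
    have : LipschitzWith 1 Θ := LipschitzWith.of_dist_le_mul fun x y => by
      simpa [Real.dist_eq] using hΘ x y
    exact this.continuous
  rw [tendsto_iff_norm_sub_tendsto_zero]
  have hsum := (h.tendsto_zero k a' b' hk).add (h'.tendsto_zero k a' b' hk)
  rw [add_zero] at hsum
  have hi : ∀ s ∈ Icc 0 t₀, Integrable fun y => Θ ((v s y - v' s y) * k (‖y‖ ^ 2)) := by
    intro s hs
    have hi := h.integrable_sub_mul h' hk hs
    refine hi.mono (hΘc.comp_aestronglyMeasurable hi.1) (Eventually.of_forall fun y => ?_)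
    have := hΘ ((v s y - v' s y) * k (‖y‖ ^ 2)) 0
    rwa [hΘ0, sub_zero, sub_zero] at this
  have h0 : (0 : ℝ) ∈ Icc 0 t₀ := ⟨le_rfl, ht.le⟩
  refine squeeze_zero' (Eventually.of_forall fun _ => norm_nonneg _) ?_ hsum
  filter_upwards [Ioc_mem_nhdsGT ht] with a ha
  have ha' : a ∈ Icc 0 t₀ := Ioc_subset_Icc_self ha
  have j : ∀ {q : ℝ → E d → ℝ}, (∀ s ∈ Icc 0 t₀, Integrable fun y => q s y * k (‖y‖ ^ 2)) →
      Integrable fun y => |q a y - q 0 y| * |k (‖y‖ ^ 2)| := by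
    intro q hq
    refine ((hq a ha').sub (hq 0 h0)).abs.congr (Eventually.of_forall fun y => ?_)
    simp only [Pi.sub_apply]
    rw [← sub_mul, abs_mul]
  have j1 := j fun s hs => h.integrable s hs k a' b' hk
  have j2 := j fun s hs => h'.integrable s hs k a' b' hk
  rw [← integral_sub (hi a ha') (hi 0 h0), ← integral_add j1 j2]
  refine norm_integral_le_of_norm_le (j1.add j2) (Eventually.of_forall fun y => ?_)
  refine (hΘ _ _).trans ?_
  rw [← sub_mul, abs_mul, ← add_mul]
  refine mul_le_mul_of_nonneg_right ?_ (abs_nonneg _)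
  have : v a y - v' a y - (v 0 y - v' 0 y) = (v a y - v 0 y) - (v' a y - v' 0 y) := by ring
  rw [this]
  exact abs_sub _ _

theorem tendsto_setIntegral_Ioc {N : ℝ → ℝ} {t B : ℝ}
    (hN : AEStronglyMeasurable N (volume.restrict (Ioc 0 t)))
    (hB : ∀ᵐ s ∂(volume.restrict (Ioc 0 t)), ‖N s‖ ≤ B) (ht : 0 < t) :
    Tendsto (fun a => ∫ s in Ioc a t, N s) (𝓝[>] 0) (𝓝 (∫ s in Ioc 0 t, N s)) := by
  have hi : IntegrableOn N (Ioc 0 t) := Integrable.of_bound hN B hB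
  have hB0 : Tendsto (fun a : ℝ => B * a) (𝓝[>] 0) (𝓝 0) := by
    have : Tendsto (fun a : ℝ => B * a) (𝓝 0) (𝓝 (B * 0)) := (continuous_const_mul B).tendsto 0
    rw [mul_zero] at this
    exact this.mono_left nhdsWithin_le_nhds
  rw [tendsto_iff_norm_sub_tendsto_zero]
  refine squeeze_zero' (Eventually.of_forall fun _ => norm_nonneg _) ?_ hB0
  filter_upwards [Ioc_mem_nhdsGT ht] with a ha
  have hun : Ioc 0 t = Ioc 0 a ∪ Ioc a t := (Ioc_union_Ioc_eq_Ioc ha.1.le ha.2).symm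
  have hs1 : Ioc 0 a ⊆ Ioc 0 t := Ioc_subset_Ioc_right ha.2
  have hs2 : Ioc a t ⊆ Ioc 0 t := Ioc_subset_Ioc_left ha.1.le
  rw [hun, setIntegral_union (Ioc_disjoint_Ioc_of_le le_rfl) measurableSet_Ioc (hi.mono_set hs1)
    (hi.mono_set hs2)]
  rw [sub_add_cancel_right, norm_neg]
  have h2 := norm_setIntegral_le_of_norm_le_const_ae' (μ := volume) (s := Ioc 0 a) (C := B) (f := N)
    (by simp) ((ae_restrict_iff' measurableSet_Ioc).1
      (ae_mono (Measure.restrict_mono hs1 le_rfl) hB))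
  simpa [Measure.real, ha.1.le] using h2

/-- `L¹` contraction, up to the flux through the support of the test function. -/
theorem contraction (hm : 0 < m) (hm1 : m < 1) (h : IsLocalStrongSolution m β γ t₀ v g G)
    (h' : IsLocalStrongSolution m β γ t₀ v' g' G') {F : ℝ → ℝ} {a' b' : ℝ}
    (hF : IsProfile F a' b') (hF0 : ∀ s, 0 ≤ F s) (ht : 0 < t₀) :
    (∫ y, max ((v t₀ y - v' t₀ y) * ((‖y‖ ^ 2) ^ (-γ / 2) * F (‖y‖ ^ 2))) 0) ≤
      (∫ y, max ((v 0 y - v' 0 y) * ((‖y‖ ^ 2) ^ (-γ / 2) * F (‖y‖ ^ 2))) 0) +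
      ∫ s in Ioc 0 t₀, (1 - m) / m *
        ∫ y, max (v s y ^ m - v' s y ^ m) 0 * radL d β F (‖y‖ ^ 2) := by
  have hk := hF.rpow_mul (-γ / 2)
  have l1 := h.tendsto_initial h' hk ht (Θ := fun x => max x 0)
    (fun x y => abs_max_sub_max_le_abs _ _ _) (by simp)
  obtain ⟨hmeas, N, -, hN⟩ := h.exists_flux_bound hm h' hF (Θ := fun x => max x 0)
    (by fun_prop) (fun x => by
      rcases le_total x 0 with h0 | h0
      · simp [max_eq_right h0]
      · simp [max_eq_left h0])
  have l2 := tendsto_setIntegral_Ioc (hmeas.const_mul ((1 - m) / m)) (B := ‖(1 - m) / m‖ * N)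
    (hN.mono fun s hs => by
      rw [norm_mul]; exact mul_le_mul_of_nonneg_left hs (norm_nonneg _)) ht
  refine ge_of_tendsto (l1.add l2) ?_
  filter_upwards [Ioc_mem_nhdsGT ht] with a ha
  have := h.contraction_aux hm hm1 h' hF hF0 ha.1 ha.2
  linarith

theorem balance (hm : 0 < m) (hm1 : m < 1) (h : IsLocalStrongSolution m β γ t₀ v g G)
    (h' : IsLocalStrongSolution m β γ t₀ v' g' G') {F : ℝ → ℝ} {a' b' : ℝ}
    (hF : IsProfile F a' b') (hF0 : ∀ s, 0 ≤ F s) (ht : 0 < t₀) :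
    (∫ y, (v t₀ y - v' t₀ y) * ((‖y‖ ^ 2) ^ (-γ / 2) * F (‖y‖ ^ 2))) =
      (∫ y, (v 0 y - v' 0 y) * ((‖y‖ ^ 2) ^ (-γ / 2) * F (‖y‖ ^ 2))) +
      ∫ s in Ioc 0 t₀, (1 - m) / m *
        ∫ y, (v s y ^ m - v' s y ^ m) * radL d β F (‖y‖ ^ 2) := by
  have hc : 0 ≤ (1 - m) / m := div_nonneg (by linarith) hm.le
  have hk := hF.rpow_mul (-γ / 2)
  have l1 := h.tendsto_initial h' hk ht (Θ := fun x => x) (fun x y => le_rfl) rfl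
  obtain ⟨hmeas, N, -, hN⟩ := h.exists_flux_bound hm h' hF (Θ := fun x => x)
    continuous_id (fun x => le_rfl)
  have l2 := tendsto_setIntegral_Ioc (hmeas.const_mul ((1 - m) / m)) (B := ‖(1 - m) / m‖ * N)
    (hN.mono fun s hs => by
      rw [norm_mul]; exact mul_le_mul_of_nonneg_left hs (norm_nonneg _)) ht
  refine tendsto_nhds_unique (tendsto_const_nhds.congr' ?_) (l1.add l2)
  filter_upwards [Ioc_mem_nhdsGT ht] with a ha
  have ht0 : t₀ ∈ Icc 0 t₀ := ⟨ht.le, le_rfl⟩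
  have heq := integral_sub_eq_of_evolution ha.2 (h.integrable_deriv_sub h' hk ha.1 ha.2 le_rfl)
    (Y := fun s y => (v s y - v' s y) * ((‖y‖ ^ 2) ^ (-γ / 2) * F (‖y‖ ^ 2)))
    (h.integrable_sub_mul h' hk ⟨ha.1.le, ha.2⟩) (h.integrable_sub_mul h' hk ht0)
    (h.evolution_mul h' hk ha.1 ha.2 le_rfl)
  rw [sub_eq_iff_eq_add'] at heq
  rw [heq]
  congr 1
  have hsub : Ioc a t₀ ⊆ Ioc 0 t₀ := Ioc_subset_Ioc_left ha.1.le
  have hle := Measure.restrict_mono hsub (le_refl (volume : Measure ℝ))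
  refine integral_congr_ae ?_
  filter_upwards [ae_mono hle h.pair, ae_mono hle h'.pair] with s p1 p2
  rw [← (p1.sub p2).integral_mul_eq hc hF hF0]
  refine integral_congr_ae (Eventually.of_forall fun y => ?_)
  simp only
  rw [norm_rpow_eq_sq_rpow]
  ring

end IsLocalStrongSolution


theorem ae_Ioc_zero_of_forall {P : ℝ → Prop} {t : ℝ}
    (h : ∀ a, 0 < a → a ≤ t → ∀ᵐ s ∂(volume.restrict (Ioc a t)), P s) :
    ∀ᵐ s ∂(volume.restrict (Ioc 0 t)), P s := by
  have hsub : Ioc 0 t ⊆ ⋃ n : ℕ, Ioc (1 / ((n : ℝ) + 1)) t := by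
    intro s hs
    obtain ⟨n, hn⟩ := exists_nat_one_div_lt hs.1
    exact mem_iUnion.2 ⟨n, hn, hs.2⟩
  refine ae_restrict_of_ae_restrict_of_subset hsub ?_
  rw [ae_restrict_iUnion_iff]
  intro n
  rcases le_or_gt (1 / ((n : ℝ) + 1)) t with hn | hn
  · exact h _ (by positivity) hn
  · rw [Ioc_eq_empty (not_lt.2 hn.le)]
    simp

theorem mul_weight_eq {d : ℕ} {k : ℝ → ℝ} {a b : ℝ} (hk : IsProfile k a b) (γ x : ℝ) (y : E d) :
    x * k (‖y‖ ^ 2) = x * ‖y‖ ^ (-γ) * ((‖y‖ ^ 2) ^ (γ / 2) * k (‖y‖ ^ 2)) := by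
  rcases eq_or_ne y 0 with rfl | hy
  · have : k (‖(0 : E d)‖ ^ 2) = 0 := hk.zero _ fun h => by
      have := h.1
      simp at this
      linarith [hk.pos]
    rw [this]; ring
  · have hy' : 0 < ‖y‖ := norm_pos_iff.2 hy
    rw [← norm_rpow_eq_sq_rpow, Real.rpow_neg hy'.le]
    have : ‖y‖ ^ γ ≠ 0 := (Real.rpow_pos_of_pos hy' _).ne'
    field_simp

theorem integrableOn_annulus_of_weighted {d : ℕ} {q : E d → ℝ} {β : ℝ}
    (hq : Integrable fun y => q y * ‖y‖ ^ (-β)) {a b : ℝ} (ha : 0 < a) :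
    IntegrableOn q (annulus d a b) := by
  have hne : ∀ y ∈ annulus d a b, 0 < ‖y‖ := by
    intro y hy
    rw [norm_pos_iff]
    rintro rfl
    exact zero_notMem_annulus ha hy
  have hc : ContinuousOn (fun y : E d => ‖y‖ ^ β) (annulus d a b) :=
    continuous_norm.continuousOn.rpow_const fun y hy => Or.inl (hne y hy).ne'
  obtain ⟨N, hN⟩ := (isCompact_annulus d a b).exists_bound_of_continuousOn hc
  have hm : MeasurableSet (annulus d a b) := (isClosed_annulus d a b).measurableSet
  refine (hq.integrableOn.mul_bdd (c := N) (hc.aestronglyMeasurable hm)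
    ((ae_restrict_iff' hm).2 (Eventually.of_forall hN))).congr ?_
  refine (ae_restrict_iff' hm).2 (Eventually.of_forall fun y hy => ?_)
  have h1 := hne y hy
  simp only
  rw [mul_assoc, ← Real.rpow_add h1]
  simp

theorem IsStrongSolution.exists_isLocalStrongSolution {d : ℕ} {m β γ : ℝ} (hm : 0 < m)
    {v₀ : E d → ℝ} {v : ℝ → E d → ℝ} (h : IsStrongSolution m β γ v₀ v) :
    ∃ (g : ℝ → E d → ℝ) (G : ℝ → E d → E d),
      ∀ t₀, IsLocalStrongSolution m β γ t₀ v g G := by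
  obtain ⟨g, G, hg, -, hG, hgrad, heq⟩ := h.equation
  refine ⟨g, G, fun t₀ => ?_⟩
  have hsub : Ioc 0 t₀ ⊆ Ioi 0 := fun s hs => hs.1
  have hle : volume.restrict (Ioc 0 t₀) ≤ volume.restrict (Ioi (0 : ℝ)) :=
    Measure.restrict_mono hsub le_rfl
  have hbdd : ∃ M, 0 ≤ M ∧ ∀ᵐ s ∂(volume.restrict (Ioc 0 t₀)), ∀ᵐ y, ‖v s y‖ ≤ M := by
    have h1 := h.bounded.2
    rw [eLpNorm_exponent_top] at h1
    refine ⟨(eLpNormEssSup (fun p : ℝ × E d => v p.1 p.2)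
      ((volume.restrict (Ioi 0)).prod volume)).toReal, ENNReal.toReal_nonneg, ae_mono hle ?_⟩
    refine Measure.ae_ae_of_ae_prod (p := fun z => ‖v z.1 z.2‖ ≤ _) ?_
    filter_upwards [ae_le_eLpNormEssSup (f := fun p : ℝ × E d => v p.1 p.2)
      (μ := (volume.restrict (Ioi 0)).prod volume)] with p hp
    have := ENNReal.toReal_mono h1.ne hp
    simpa using this
  have hint : ∀ s, 0 ≤ s → ∀ (k : ℝ → ℝ) (a' b' : ℝ), IsProfile k a' b' →
      Integrable fun y => v s y * k (‖y‖ ^ 2) := by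
    intro s hs k a' b' hk
    have hk' := hk.rpow_mul (γ / 2)
    obtain ⟨N, hN⟩ := (hk'.contDiff_comp d).continuous.bounded_above_of_compact_support
      (hk'.hasCompactSupport_comp d)
    refine ((h.memL1w s hs).mul_bdd (c := N) (hk'.contDiff_comp d).continuous.aestronglyMeasurable
      (Eventually.of_forall hN)).congr (Eventually.of_forall fun y => ?_)
    exact (mul_weight_eq hk γ _ y).symm
  have hmv : ∀ s, 0 ≤ s → AEStronglyMeasurable (v s) := by
    intro s hs
    have h1 := (h.memL1w s hs).1
    have hpm : Measurable fun y : E d => ‖y‖ ^ γ := measurable_norm.pow_const γ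
    have h2 := h1.mul hpm.aestronglyMeasurable
    rcases Nat.eq_zero_or_pos d with rfl | hd
    · exact (Measurable.of_discrete (f := v s)).aestronglyMeasurable
    · have : Nonempty (Fin d) := ⟨⟨0, hd⟩⟩
      refine h2.congr ?_
      have hne : ∀ᵐ y : E d, y ≠ 0 := compl_mem_ae_iff.2 (measure_singleton 0)
      filter_upwards [hne] with y hy
      have h3 : 0 < ‖y‖ := norm_pos_iff.2 hy
      simp only [Pi.mul_apply]
      rw [mul_assoc, ← Real.rpow_add h3]
      simp
  refine ⟨fun s hs => h.nonneg s hs.1, ?_, ?_, ?_, fun a b ha hab _ => (hg a b ha hab).2, ?_,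
    fun s hs => hint s hs.1, ?_⟩
  · exact h.bounded.1.mono_measure (Measure.prod_mono hle le_rfl)
  · obtain ⟨M, -, hM⟩ := hbdd
    refine ⟨M, hM.mono fun s hs => hs.mono fun y hy => (le_abs_self _).trans hy⟩
  · obtain ⟨M, hM0, hM⟩ := hbdd
    have hGs : ∀ᵐ s ∂(volume.restrict (Ioc 0 t₀)),
        Integrable fun y => ‖G s y‖ ^ 2 * ‖y‖ ^ (-β) :=
      ae_Ioc_zero_of_forall fun a ha hat => (hG a t₀ ha hat).prod_right_ae
    have hgs : ∀ᵐ s ∂(volume.restrict (Ioc 0 t₀)), Integrable fun y => g s y * ‖y‖ ^ (-γ) :=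
      ae_Ioc_zero_of_forall fun a ha hat => (hg a t₀ ha hat).1.prod_right_ae
    filter_upwards [hM, hGs, hgs, ae_mono hle hgrad, ae_mono hle heq,
      ae_restrict_mem measurableSet_Ioc] with s h1 h2 h3 h4 h5 hs
    refine ⟨?_, ⟨M ^ m, ?_⟩, h4, fun a b ha => integrableOn_annulus_of_weighted h2 ha,
      fun a b _ => h3.integrableOn, fun φ hφ hc _ => ?_⟩
    · exact (Real.continuous_rpow_const hm.le).comp_aestronglyMeasurable (hmv s hs.1.le)
    · filter_upwards [h1, h.nonneg s hs.1.le] with y e1 e2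
      rw [abs_of_nonneg (by positivity)]
      exact Real.rpow_le_rpow e2 ((le_abs_self _).trans e1) hm.le
    · rw [← h5 φ hφ hc]
      congr 1; ext1 y; ring
  · intro a b ha hab _ k a' b' hk
    have hk' := hk.rpow_mul (γ / 2)
    obtain ⟨N, hN⟩ := (hk'.contDiff_comp d).continuous.bounded_above_of_compact_support
      (hk'.hasCompactSupport_comp d)
    have hcont : Continuous fun p : ℝ × E d => (‖p.2‖ ^ 2) ^ (γ / 2) * k (‖p.2‖ ^ 2) :=
      (hk'.contDiff_comp d).continuous.comp continuous_snd
    refine ((hg a b ha hab).1.mul_bdd (c := N) hcont.aestronglyMeasurable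
      (Eventually.of_forall fun p => hN p.2)).congr (Eventually.of_forall fun p => ?_)
    exact (mul_weight_eq hk γ _ p.2).symm
  · intro k a' b' hk
    have hk' := hk.rpow_mul (γ / 2)
    obtain ⟨N, hN⟩ := (hk'.contDiff_comp d).continuous.bounded_above_of_compact_support
      (hk'.hasCompactSupport_comp d)
    have h0 := h.continuous 0 le_rfl
    have h1 := (h0.mono_left (nhdsWithin_mono 0 Ioi_subset_Ici_self)).mul_const N
    rw [zero_mul] at h1
    refine squeeze_zero' (Eventually.of_forall fun s => integral_nonneg fun y => by positivity)
      ?_ h1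
    filter_upwards [self_mem_nhdsWithin] with s hs
    rw [← integral_mul_const]
    refine integral_mono_of_nonneg (Eventually.of_forall fun y => by positivity) ?_
      (Eventually.of_forall fun y => ?_)
    · refine Integrable.mul_const ?_ N
      refine ((h.memL1w s (le_of_lt hs)).sub (h.memL1w 0 le_rfl)).abs.congr
        (Eventually.of_forall fun y => ?_)
      simp only [Pi.sub_apply]
      rw [← sub_mul, abs_mul, abs_of_nonneg (a := ‖y‖ ^ (-γ)) (by positivity)]
    · simp only
      rw [← abs_mul, mul_weight_eq hk γ, abs_mul, abs_mul,
        abs_of_nonneg (a := ‖y‖ ^ (-γ)) (by positivity)]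
      exact mul_le_mul_of_nonneg_left (hN y) (by positivity)


/-- The range of the parameters. -/
structure Admissible (d : ℕ) (m β γ : ℝ) : Prop where
  m_pos : 0 < m
  m_lt_one : m < 1
  gamma_lt : γ < d
  sigma_pos : 0 < 2 + β - γ
  beta_lt : β < d - 2

/-- `t` is a time at which the self-similar solutions with parameter `T` are defined. -/
structure ValidTime (d : ℕ) (m β γ T t : ℝ) : Prop where
  nonneg : 0 ≤ t
  T_pos : m ≠ mc d β γ → 0 < T
  lt_T : m < mc d β γ → t < T

theorem ValidTime.mono {d : ℕ} {m β γ T t s : ℝ} (h : ValidTime d m β γ T t) (hs : s ∈ Icc 0 t) :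
    ValidTime d m β γ T s :=
  ⟨hs.1, h.T_pos, fun hm => hs.2.trans_lt (h.lt_T hm)⟩

/-- The exponent `(d - γ) (m - mc)`. -/
noncomputable def expA (d : ℕ) (m β γ : ℝ) : ℝ := ((d : ℝ) - γ) * (m - mc d β γ)

theorem sigma_sub_expA {d : ℕ} {m β γ : ℝ} (h : γ < d) :
    2 + β - γ - expA d m β γ = ((d : ℝ) - γ) * (1 - m) := by
  have : (d : ℝ) - γ ≠ 0 := by linarith
  rw [expA, mc]
  field_simp
  ring

theorem scaleR_pos {d : ℕ} {m β γ T t : ℝ} (hp : Admissible d m β γ)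
    (h : ValidTime d m β γ T t) : 0 < scaleR d m β γ T t := by
  have h1 := hp.sigma_pos
  have h2 : 0 < (d : ℝ) - γ := by linarith [hp.gamma_lt]
  rw [scaleR]
  split_ifs with c1 c2
  · have := h.T_pos c1.ne'
    have h3 : 0 < m - mc d β γ := by linarith
    have h4 : 0 < T + t := by linarith [h.nonneg]
    positivity
  · positivity
  · have hlt : m < mc d β γ := lt_of_le_of_ne (not_lt.1 c1) c2
    have := h.lt_T hlt
    have h3 : 0 < mc d β γ - m := by linarith
    have h4 : 0 < T - t := by linarith
    positivity

theorem hasDerivAt_scaleR {d : ℕ} {m β γ T t : ℝ} (hp : Admissible d m β γ)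
    (h : ValidTime d m β γ T t) :
    HasDerivAt (scaleR d m β γ T)
      ((2 + β - γ) * scaleR d m β γ T t ^ (1 - expA d m β γ)) t := by
  have h1 := hp.sigma_pos
  have h2 : 0 < (d : ℝ) - γ := by linarith [hp.gamma_lt]
  have hfun : scaleR d m β γ T = fun t => scaleR d m β γ T t := rfl
  rw [hfun]
  simp only [scaleR]
  split_ifs with c1 c2
  · have := h.T_pos c1.ne'
    have h3 : 0 < m - mc d β γ := by linarith
    have h4 : 0 < T + t := by linarith [h.nonneg]
    have ha : 0 < ((d : ℝ) - γ) * (m - mc d β γ) := by positivity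
    rw [expA]
    set a := ((d : ℝ) - γ) * (m - mc d β γ)
    have hb : 0 < (2 + β - γ) * a * (T + t) := by positivity
    have hlin : HasDerivAt (fun t => (2 + β - γ) * a * (T + t)) ((2 + β - γ) * a) t := by
      simpa using ((hasDerivAt_id t).const_add T).const_mul ((2 + β - γ) * a)
    convert! hlin.rpow_const (p := 1 / a) (Or.inl hb.ne') using 1
    rw [← Real.rpow_mul hb.le, show 1 / a * (1 - a) = 1 / a - 1 by field_simp]
    field_simp
  · have ha : expA d m β γ = 0 := by rw [expA, c2]; ring
    have hlin : HasDerivAt (fun t => T + (2 + β - γ) * t) (2 + β - γ) t := by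
      simpa using ((hasDerivAt_id t).const_mul (2 + β - γ)).const_add T
    convert! hlin.exp using 1
    rw [ha, sub_zero, Real.rpow_one]; ring
  · have hlt : m < mc d β γ := lt_of_le_of_ne (not_lt.1 c1) c2
    have := h.lt_T hlt
    have h3 : 0 < mc d β γ - m := by linarith
    have h4 : 0 < T - t := by linarith
    have hb' : expA d m β γ = -(((d : ℝ) - γ) * (mc d β γ - m)) := by rw [expA]; ring
    have ha : 0 < ((d : ℝ) - γ) * (mc d β γ - m) := by positivity
    rw [hb']
    set a := ((d : ℝ) - γ) * (mc d β γ - m)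
    have hb : 0 < (2 + β - γ) * a * (T - t) := by positivity
    have hlin : HasDerivAt (fun t => (2 + β - γ) * a * (T - t)) (-((2 + β - γ) * a)) t := by
      simpa using ((hasDerivAt_id t).const_sub T).const_mul ((2 + β - γ) * a)
    convert! hlin.rpow_const (p := -(1 / a)) (Or.inl hb.ne') using 1
    rw [← Real.rpow_mul hb.le, show -(1 / a) * (1 - -a) = -(1 / a) - 1 by field_simp; ring]
    field_simp

/-- The pressure variable `U ^ (m - 1)` of the self-similar solution `U`, as a function of
`s = |y|²`. -/
noncomputable def pressure (C σ a R s : ℝ) : ℝ := C * R ^ (σ - a) + s ^ (σ / 2) * R ^ (-a)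

theorem pressure_pos {C σ a R s : ℝ} (hC : 0 < C) (hR : 0 < R) (hs : 0 ≤ s) :
    0 < pressure C σ a R s := by
  have : 0 ≤ s ^ (σ / 2) * R ^ (-a) := by positivity
  have : 0 < C * R ^ (σ - a) := by positivity
  rw [pressure]; linarith

theorem barenblatt_eq {d : ℕ} {m β γ C T t : ℝ} (hp : Admissible d m β γ)
    (h : ValidTime d m β γ T t) (hC : 0 < C) (y : E d) :
    barenblatt d m β γ C T t y =
      pressure C (2 + β - γ) (expA d m β γ) (scaleR d m β γ T t) (‖y‖ ^ 2) ^ (-(1 / (1 - m))) := by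
  have hR := scaleR_pos hp h
  rw [barenblatt, pressure]
  set R := scaleR d m β γ T t
  have h1 : 0 < 1 - m := by linarith [hp.m_lt_one]
  have e1 : (‖y‖ ^ 2) ^ ((2 + β - γ) / 2) = ‖y‖ ^ (2 + β - γ) := (norm_rpow_eq_sq_rpow _ y).symm
  have hσ := hp.sigma_pos
  have e2 : C * R ^ (2 + β - γ - expA d m β γ) + ‖y‖ ^ (2 + β - γ) * R ^ (-expA d m β γ) =
      R ^ (((d : ℝ) - γ) * (1 - m)) * (C + (‖y‖ / R) ^ (2 + β - γ)) := by
    rw [sigma_sub_expA hp.gamma_lt, Real.div_rpow (norm_nonneg _) hR.le]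
    have : R ^ (-expA d m β γ) = R ^ (((d : ℝ) - γ) * (1 - m)) / R ^ (2 + β - γ) := by
      rw [← Real.rpow_sub hR, ← sigma_sub_expA (β := β) hp.gamma_lt]; congr 1; ring
    rw [this]; ring
  rw [e1, e2, Real.mul_rpow (by positivity) (by positivity), ← Real.rpow_mul hR.le,
    Real.rpow_neg (by positivity) (1 / (1 - m)), div_eq_mul_inv]
  congr 2
  field_simp
  ring

theorem hasDerivAt_pressure {C σ a R s : ℝ} (hs : 0 < s) :
    HasDerivAt (pressure C σ a R) (σ / 2 * s ^ (σ / 2 - 1) * R ^ (-a)) s := by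
  have := ((Real.hasDerivAt_rpow_const (p := σ / 2) (Or.inl hs.ne')).mul_const (R ^ (-a))).const_add
    (C * R ^ (σ - a))
  exact this

theorem contDiffAt_pressure_rpow {C σ a R s : ℝ} (hC : 0 < C) (hR : 0 < R) (hs : 0 < s) (q : ℝ) :
    ContDiffAt ℝ 1 (fun s => pressure C σ a R s ^ q) s := by
  have h1 : ContDiffAt ℝ 1 (pressure C σ a R) s := by
    have h2 : ContDiffAt ℝ 1 (fun s : ℝ => s ^ (σ / 2)) s :=
      Real.contDiffAt_rpow_const_of_ne hs.ne'
    exact contDiffAt_const.add (h2.mul contDiffAt_const)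
  exact h1.rpow_const_of_ne (pressure_pos hC hR hs.le).ne'

theorem contDiff_mul_comp_norm_sq {d : ℕ} {φ : E d → ℝ} (hφ : ContDiff ℝ 1 φ)
    (h0 : (0 : E d) ∉ tsupport φ) {κ : ℝ → ℝ} (hκ : ∀ s, 0 < s → ContDiffAt ℝ 1 κ s) :
    ContDiff ℝ 1 fun y => φ y * κ (‖y‖ ^ 2) := by
  rw [contDiff_iff_contDiffAt]
  intro y
  rcases eq_or_ne y 0 with rfl | hy
  · have : (fun y => φ y * κ (‖y‖ ^ 2)) =ᶠ[𝓝 0] fun _ => 0 := by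
      filter_upwards [(isClosed_tsupport φ).isOpen_compl.mem_nhds h0] with z hz
      rw [image_eq_zero_of_notMem_tsupport hz, zero_mul]
    exact contDiffAt_const.congr_of_eventuallyEq this
  · have hs : 0 < ‖y‖ ^ 2 := by positivity
    exact hφ.contDiffAt.mul ((hκ _ hs).comp y (contDiff_norm_sq ℝ).contDiffAt)

theorem integral_radial_field {d : ℕ} {φ : E d → ℝ} (hφ : ContDiff ℝ 1 φ)
    (hc : HasCompactSupport φ) (h0 : (0 : E d) ∉ tsupport φ) {κ κ' : ℝ → ℝ}
    (hκ : ∀ s, 0 < s → ContDiffAt ℝ 1 κ s) (hκ' : ∀ s, 0 < s → HasDerivAt κ (κ' s) s) :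
    ∫ y, κ (‖y‖ ^ 2) * inner ℝ y (gradient φ y) =
      -∫ y, φ y * ((d : ℝ) * κ (‖y‖ ^ 2) + 2 * ‖y‖ ^ 2 * κ' (‖y‖ ^ 2)) := by
  have hq := contDiff_mul_comp_norm_sq hφ h0 hκ
  have hqc : HasCompactSupport fun y => φ y * κ (‖y‖ ^ 2) := hc.mul_right
  have key := integral_euler_eq_zero hq hqc
  have hg0 : ∀ y, y ∉ tsupport φ → gradient φ y = 0 := fun y hy =>
    image_eq_zero_of_notMem_tsupport fun hh => hy (tsupport_gradient_subset φ hh)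
  have hfd : ∀ y : E d, (d : ℝ) * (φ y * κ (‖y‖ ^ 2)) +
      fderiv ℝ (fun y : E d => φ y * κ (‖y‖ ^ 2)) y y = κ (‖y‖ ^ 2) * inner ℝ y (gradient φ y) +
      φ y * ((d : ℝ) * κ (‖y‖ ^ 2) + 2 * ‖y‖ ^ 2 * κ' (‖y‖ ^ 2)) := by
    intro y
    rw [real_inner_comm, inner_gradient]
    rcases eq_or_ne y 0 with rfl | hy
    · have : φ 0 = 0 := image_eq_zero_of_notMem_tsupport h0
      simp [this]
    have hs : 0 < ‖y‖ ^ 2 := by positivity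
    have h1 := hasFDerivAt_comp_norm_sq (y := y) (hκ' _ hs)
    have h2 := (hφ.differentiable one_ne_zero y).hasFDerivAt.fun_mul h1
    rw [h2.fderiv]
    simp only [add_apply, smul_apply, innerSL_apply_apply,
      real_inner_self_eq_norm_sq, smul_eq_mul]
    ring
  have i1 : Integrable fun y => κ (‖y‖ ^ 2) * inner ℝ y (gradient φ y) := by
    have hz : (0 : E d) ∉ tsupport fun y => inner ℝ y (gradient φ y) := by
      refine fun h => h0 ((closure_minimal ?_ (isClosed_tsupport φ)) h)
      intro y hy
      by_contra hcon
      exact hy (by simp [hg0 y hcon])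
    have hco : Continuous fun y => inner ℝ y (gradient φ y) :=
      continuous_id.inner (continuous_gradient hφ)
    have hk : ContinuousOn (fun y : E d => κ (‖y‖ ^ 2)) {0}ᶜ := fun y hy => by
      have hs : 0 < ‖y‖ ^ 2 := by
        have : y ≠ 0 := hy
        positivity
      exact ((hκ' _ hs).continuousAt.comp (f := fun y : E d => ‖y‖ ^ 2)
        (by fun_prop)).continuousWithinAt
    have hcs : HasCompactSupport fun y => inner ℝ y (gradient φ y) := hc.mono' fun y hy => by
      by_contra hcon
      exact hy (by simp [hg0 y hcon])
    have := (continuous_mul_of_continuousOn_compl_zero hco hz hk).integrable_of_hasCompactSupport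
      (μ := volume) (hasCompactSupport_fun_smul_right hcs _)
    refine this.congr (Eventually.of_forall fun y => ?_)
    simp [mul_comm]
  have i0 : Integrable fun y => (d : ℝ) * (φ y * κ (‖y‖ ^ 2)) +
      fderiv ℝ (fun y : E d => φ y * κ (‖y‖ ^ 2)) y y := by
    refine ((hq.continuous.integrable_of_hasCompactSupport hqc).const_mul _).add ?_
    refine Continuous.integrable_of_hasCompactSupport
      ((hq.continuous_fderiv one_ne_zero).clm_apply continuous_id) ?_
    refine (hqc.fderiv ℝ).mono fun y hy => ?_
    simp only [Function.mem_support] at hy ⊢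
    intro h
    exact hy (by rw [h]; rfl)
  have i2 : Integrable fun y => φ y * ((d : ℝ) * κ (‖y‖ ^ 2) + 2 * ‖y‖ ^ 2 * κ' (‖y‖ ^ 2)) := by
    refine (i0.sub i1).congr (Eventually.of_forall fun y => ?_)
    simp only [Pi.sub_apply, hfd]
    ring
  simp_rw [hfd] at key
  rw [integral_add i1 i2] at key
  linarith

theorem isWeakGradient_radial {d : ℕ} {b b' : ℝ → ℝ} (hb : ∀ s, 0 < s → ContDiffAt ℝ 1 b s)
    (hb' : ∀ s, 0 < s → HasDerivAt b (b' s) s) (hbc : ContinuousOn b' (Ioi 0)) :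
    IsWeakGradient (fun y : E d => b (‖y‖ ^ 2)) fun y => (2 * b' (‖y‖ ^ 2)) • y := by
  intro ψ hψ hc h0
  have hψ1 : ContDiff ℝ 1 ψ := hψ.of_le (by simp)
  have hpos : ∀ y : E d, y ∈ ({0}ᶜ : Set (E d)) → 0 < ‖y‖ ^ 2 := fun y hy => by
    have : y ≠ 0 := hy
    positivity
  have hsub : tsupport ψ ⊆ ({0}ᶜ : Set (E d)) := fun y hy hy0 => h0 (by
    rw [mem_singleton_iff] at hy0; rwa [← hy0])
  have hGc : ContinuousOn (fun y : E d => (2 * b' (‖y‖ ^ 2)) • y) {0}ᶜ := by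
    have h1 : ContinuousOn (fun y : E d => b' (‖y‖ ^ 2)) {0}ᶜ :=
      hbc.comp (continuous_norm.pow 2).continuousOn hpos
    exact (continuousOn_const.mul h1).smul continuousOn_id
  have hbcont : ContinuousOn (fun y : E d => b (‖y‖ ^ 2)) {0}ᶜ := fun y hy =>
    ((hb' _ (hpos y hy)).continuousAt.comp (f := fun y : E d => ‖y‖ ^ 2)
      (by fun_prop)).continuousWithinAt
  refine ⟨(hGc.mono hsub).integrableOn_compact hc.isCompact, ?_⟩
  have hz : (0 : E d) ∉ tsupport (gradient ψ) := fun h => h0 (tsupport_gradient_subset ψ h)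
  have i1 : Integrable fun y => b (‖y‖ ^ 2) • gradient ψ y := by
    rw [← integrableOn_iff_integrable_of_support_subset (s := tsupport ψ)]
    · exact ((hbcont.mono hsub).smul (continuous_gradient hψ1).continuousOn).integrableOn_compact
        hc.isCompact
    · intro y hy
      by_contra hcon
      refine hy ?_
      have : gradient ψ y = 0 :=
        image_eq_zero_of_notMem_tsupport fun hh => hcon (tsupport_gradient_subset ψ hh)
      simp [this]
  have i2 : Integrable fun y : E d => ψ y • ((2 * b' (‖y‖ ^ 2)) • y) :=
    (continuous_mul_of_continuousOn_compl_zero hψ.continuous h0 hGc).integrable_of_hasCompactSupport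
      (hasCompactSupport_fun_smul_right hc _)
  refine ext_inner_right ℝ fun v => ?_
  dsimp only
  rw [inner_neg_left, real_inner_comm, real_inner_comm v, ← integral_inner i1 v,
    ← integral_inner i2 v]
  have hq := contDiff_mul_comp_norm_sq hψ1 h0 hb
  have hqc : HasCompactSupport fun y => ψ y * b (‖y‖ ^ 2) := hc.mul_right
  have hfd : ∀ y, fderiv ℝ (fun y : E d => ψ y * b (‖y‖ ^ 2)) y v =
      inner ℝ v (b (‖y‖ ^ 2) • gradient ψ y) + inner ℝ v (ψ y • ((2 * b' (‖y‖ ^ 2)) • y)) := by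
    intro y
    by_cases hy : y = 0
    · subst hy
      have e1 : (fun y : E d => ψ y * b (‖y‖ ^ 2)) =ᶠ[𝓝 0] fun _ => 0 := by
        filter_upwards [(isClosed_tsupport ψ).isOpen_compl.mem_nhds h0] with z hz
        rw [image_eq_zero_of_notMem_tsupport hz, zero_mul]
      rw [e1.fderiv_eq, image_eq_zero_of_notMem_tsupport hz]
      simp
    · have h1 := hasFDerivAt_comp_norm_sq (y := y) (hb' _ (hpos y hy))
      have h2 := (hψ1.differentiable one_ne_zero y).hasFDerivAt.fun_mul h1
      rw [h2.fderiv]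
      simp only [add_apply, smul_apply, innerSL_apply_apply, smul_eq_mul, real_inner_smul_right]
      have e1 : inner ℝ v (gradient ψ y) = fderiv ℝ ψ y v := by
        rw [real_inner_comm, inner_gradient]
      have e2 : inner ℝ y v = inner ℝ v y := real_inner_comm v y
      rw [e1, e2]
      ring
  have hzero : ∫ y, fderiv ℝ (fun y : E d => ψ y * b (‖y‖ ^ 2)) y v = 0 := by
    have := integral_mul_fderiv_eq_neg_fderiv_mul_of_integrable (μ := (volume : Measure (E d)))
      (f := fun _ => (1 : ℝ)) (g := fun y : E d => ψ y * b (‖y‖ ^ 2)) (v := v) (by simp) ?_ ?_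
      (fun _ _ => differentiableAt_const _) (fun x _ => hq.differentiable one_ne_zero x)
    · simpa using this
    · simp_rw [one_mul, hfd]
      exact (i1.const_inner v).add (i2.const_inner v)
    · simpa using hq.continuous.integrable_of_hasCompactSupport hqc
  simp_rw [hfd] at hzero
  rw [integral_add (i1.const_inner v) (i2.const_inner v)] at hzero
  linarith


/-- The time derivative of `pressure`. -/
noncomputable def pressureDeriv (C σ a R s : ℝ) : ℝ :=
  σ * (C * (σ - a) * R ^ (σ - 2 * a) - a * s ^ (σ / 2) * R ^ (-(2 * a)))

theorem continuous_pressure {C σ a R : ℝ} (hσ : 0 < σ) : Continuous (pressure C σ a R) := by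
  unfold pressure
  have : Continuous fun s : ℝ => s ^ (σ / 2) := Real.continuous_rpow_const (by positivity)
  fun_prop

theorem continuous_pressureDeriv {C σ a R : ℝ} (hσ : 0 < σ) :
    Continuous (pressureDeriv C σ a R) := by
  unfold pressureDeriv
  have : Continuous fun s : ℝ => s ^ (σ / 2) := Real.continuous_rpow_const (by positivity)
  fun_prop

theorem continuous_pressure_rpow {d : ℕ} {C σ a R : ℝ} (hC : 0 < C) (hR : 0 < R) (hσ : 0 < σ)
    (q : ℝ) : Continuous fun y : E d => pressure C σ a R (‖y‖ ^ 2) ^ q := by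
  refine ((continuous_pressure hσ).comp (by fun_prop)).rpow_const fun y => Or.inl ?_
  exact (pressure_pos hC hR (by positivity)).ne'

theorem pressure_rpow_le {C σ a R s q : ℝ} (hC : 0 < C) (hR : 0 < R) (hs : 0 ≤ s) (hq : q ≤ 0) :
    pressure C σ a R s ^ q ≤ (C * R ^ (σ - a)) ^ q := by
  refine Real.rpow_le_rpow_of_nonpos (by positivity) ?_ hq
  have : 0 ≤ s ^ (σ / 2) * R ^ (-a) := by positivity
  rw [pressure]; linarith

theorem pressure_flux_identity {d m γ σ a C R s : ℝ} (hm1 : m < 1) (hC : 0 < C) (hR : 0 < R)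
    (hs : 0 < s) (ha : σ - a = (d - γ) * (1 - m)) :
    d * (-(σ * R ^ (-a)) * (s ^ (-γ / 2) * pressure C σ a R s ^ (-(1 / (1 - m))))) +
      2 * s * (-(σ * R ^ (-a)) * (-γ / 2 * s ^ (-γ / 2 - 1) *
        pressure C σ a R s ^ (-(1 / (1 - m))) +
        s ^ (-γ / 2) * (σ / 2 * s ^ (σ / 2 - 1) * R ^ (-a) * (-(1 / (1 - m))) *
          pressure C σ a R s ^ (-(1 / (1 - m)) - 1)))) =
      -(1 / (1 - m)) * pressure C σ a R s ^ (-(1 / (1 - m)) - 1) * pressureDeriv C σ a R s *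
        s ^ (-γ / 2) := by
  have hP := pressure_pos (σ := σ) (a := a) hC hR hs.le
  have h1 : 1 - m ≠ 0 := by linarith
  have e1 : pressure C σ a R s ^ (-(1 / (1 - m))) =
      pressure C σ a R s ^ (-(1 / (1 - m)) - 1) * pressure C σ a R s := by
    rw [← Real.rpow_add_one hP.ne']; congr 1; ring
  have e2 : s ^ (-γ / 2 - 1) * s = s ^ (-γ / 2) := by
    rw [← Real.rpow_add_one hs.ne']; congr 1; ring
  have e3 : s ^ (σ / 2 - 1) * s = s ^ (σ / 2) := by
    rw [← Real.rpow_add_one hs.ne']; congr 1; ring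
  have e4 : R ^ (σ - 2 * a) = R ^ (-a) * R ^ (σ - a) := by
    rw [← Real.rpow_add hR]; congr 1; ring
  have e5 : R ^ (-(2 * a)) = R ^ (-a) * R ^ (-a) := by
    rw [← Real.rpow_add hR]; congr 1; ring
  rw [pressureDeriv, e4, e5, e1]
  set Q := pressure C σ a R s ^ (-(1 / (1 - m)) - 1)
  rw [pressure]
  have ha' : a = σ - (d - γ) * (1 - m) := by linarith
  have key : d * (C * R ^ (σ - a) + s ^ (σ / 2) * R ^ (-a)) - γ * (C * R ^ (σ - a) +
      s ^ (σ / 2) * R ^ (-a)) - σ * (1 / (1 - m)) * s ^ (σ / 2) * R ^ (-a) =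
      1 / (1 - m) * (C * (σ - a) * R ^ (σ - a) - a * s ^ (σ / 2) * R ^ (-a)) := by
    generalize R ^ (σ - a) = x
    generalize R ^ (-a) = z
    generalize s ^ (σ / 2) = w
    rw [ha']
    field_simp
    ring
  have e2' : s * s ^ (-γ / 2 - 1) = s ^ (-γ / 2) := by rw [mul_comm, e2]
  have e3' : s * s ^ (σ / 2 - 1) = s ^ (σ / 2) := by rw [mul_comm, e3]
  linear_combination (-σ * R ^ (-a) * s ^ (-γ / 2) * Q) * key +
    (σ * R ^ (-a) * γ * Q * (C * R ^ (σ - a) + s ^ (σ / 2) * R ^ (-a))) * e2' +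
    (σ * R ^ (-a) * s ^ (-γ / 2) * σ * R ^ (-a) * (1 / (1 - m)) * Q) * e3'

theorem isEllipticPair_pressure {d : ℕ} {m β γ C R : ℝ} (hp : Admissible d m β γ) (hC : 0 < C)
    (hR : 0 < R) :
    IsEllipticPair (d := d) β ((1 - m) / m)
      (fun y => pressure C (2 + β - γ) (expA d m β γ) R (‖y‖ ^ 2) ^ (-(m / (1 - m))))
      (fun y => (2 * ((2 + β - γ) / 2 * (‖y‖ ^ 2) ^ ((2 + β - γ) / 2 - 1) * R ^ (-expA d m β γ) *
        (-(m / (1 - m))) *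
          pressure C (2 + β - γ) (expA d m β γ) R (‖y‖ ^ 2) ^ (-(1 / (1 - m))))) • y)
      (fun y => -(1 / (1 - m)) *
        pressure C (2 + β - γ) (expA d m β γ) R (‖y‖ ^ 2) ^ (-(1 / (1 - m)) - 1) *
          pressureDeriv C (2 + β - γ) (expA d m β γ) R (‖y‖ ^ 2) * ‖y‖ ^ (-γ)) := by
  have hσ := hp.sigma_pos
  have hm0 := hp.m_pos
  have h1m : 0 < 1 - m := by linarith [hp.m_lt_one]
  have ha := sigma_sub_expA (m := m) (β := β) hp.gamma_lt
  set σ := 2 + β - γ with hσdef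
  set a := expA d m β γ with hadef
  have hq : -(m / (1 - m)) - 1 = -(1 / (1 - m)) := by field_simp; ring
  have hbd : ∀ s, 0 < s → HasDerivAt (fun s => pressure C σ a R s ^ (-(m / (1 - m))))
      (σ / 2 * s ^ (σ / 2 - 1) * R ^ (-a) * (-(m / (1 - m))) *
        pressure C σ a R s ^ (-(1 / (1 - m)))) s := by
    intro s hs
    have := (hasDerivAt_pressure (C := C) (σ := σ) (a := a) (R := R) hs).rpow_const
      (p := -(m / (1 - m))) (Or.inl (pressure_pos hC hR hs.le).ne')
    rwa [hq] at this
  have hbc : ContinuousOn (fun s => σ / 2 * s ^ (σ / 2 - 1) * R ^ (-a) * (-(m / (1 - m))) *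
      pressure C σ a R s ^ (-(1 / (1 - m)))) (Ioi 0) := by
    have c1 : ContinuousOn (fun s : ℝ => s ^ (σ / 2 - 1)) (Ioi 0) := fun s hs =>
      (Real.continuousAt_rpow_const s _ (Or.inl (ne_of_gt hs))).continuousWithinAt
    have c2 : ContinuousOn (fun s : ℝ => pressure C σ a R s ^ (-(1 / (1 - m)))) (Ioi 0) :=
      fun s hs => (contDiffAt_pressure_rpow hC hR hs _).continuousAt.continuousWithinAt
    fun_prop
  have hweak := isWeakGradient_radial (d := d)
    (fun s hs => contDiffAt_pressure_rpow (σ := σ) (a := a) hC hR hs (-(m / (1 - m)))) hbd hbc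
  have hne : ∀ {a' b' : ℝ}, 0 < a' → annulus d a' b' ⊆ ({0}ᶜ : Set (E d)) := by
    intro a' b' ha' y hy hy0
    rw [mem_singleton_iff] at hy0
    exact zero_notMem_annulus ha' (hy0 ▸ hy)
  have hnormc : ∀ q : ℝ, ContinuousOn (fun y : E d => ‖y‖ ^ q) {0}ᶜ := fun q =>
    continuous_norm.continuousOn.rpow_const fun y hy => Or.inl (norm_ne_zero_iff.2 hy)
  refine ⟨(continuous_pressure_rpow hC hR hσ _).aestronglyMeasurable,
    ⟨(C * R ^ (σ - a)) ^ (-(m / (1 - m))), Eventually.of_forall fun y => ?_⟩, hweak, ?_, ?_, ?_⟩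
  · have h0 : 0 ≤ pressure C σ a R (‖y‖ ^ 2) ^ (-(m / (1 - m))) :=
      Real.rpow_nonneg (pressure_pos hC hR (by positivity)).le _
    rw [abs_of_nonneg h0]
    refine pressure_rpow_le hC hR (by positivity) ?_
    rw [neg_nonpos]; positivity
  · intro a' b' ha'
    refine ContinuousOn.integrableOn_compact (isCompact_annulus d a' b') ?_
    refine ContinuousOn.pow (ContinuousOn.norm ?_) 2
    have h1 : ContinuousOn (fun y : E d => σ / 2 * (‖y‖ ^ 2) ^ (σ / 2 - 1) * R ^ (-a) *
        (-(m / (1 - m))) * pressure C σ a R (‖y‖ ^ 2) ^ (-(1 / (1 - m)))) (annulus d a' b') :=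
      hbc.comp (continuous_norm.pow 2).continuousOn fun y hy => lt_of_lt_of_le ha' hy.1
    exact (continuousOn_const.mul h1).smul continuousOn_id
  · intro a' b' ha'
    refine ContinuousOn.integrableOn_compact (isCompact_annulus d a' b') ?_
    have h1 := (continuous_pressure_rpow (d := d) (a := a) hC hR hσ
      (-(1 / (1 - m)) - 1)).continuousOn (s := annulus d a' b')
    have h2 : ContinuousOn (fun y : E d => pressureDeriv C σ a R (‖y‖ ^ 2)) (annulus d a' b') :=
      ((continuous_pressureDeriv hσ).comp (continuous_norm.pow 2)).continuousOn
    exact ((continuousOn_const.mul h1).mul h2).mul ((hnormc _).mono (hne ha'))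
  · intro φ hφ hc h0
    have hφ1 : ContDiff ℝ 1 φ := hφ.of_le (by simp)
    have key := integral_radial_field hφ1 hc h0
      (κ := fun s => -(σ * R ^ (-a)) * (s ^ (-γ / 2) * pressure C σ a R s ^ (-(1 / (1 - m)))))
      (κ' := fun s => -(σ * R ^ (-a)) *
        (-γ / 2 * s ^ (-γ / 2 - 1) *
        pressure C σ a R s ^ (-(1 / (1 - m))) +
        s ^ (-γ / 2) * (σ / 2 * s ^ (σ / 2 - 1) * R ^ (-a) * (-(1 / (1 - m))) *
          pressure C σ a R s ^ (-(1 / (1 - m)) - 1))))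
      (fun s hs => contDiffAt_const.mul ((Real.contDiffAt_rpow_const_of_ne hs.ne').mul
        (contDiffAt_pressure_rpow hC hR hs _)))
      (fun s hs => ((Real.hasDerivAt_rpow_const (Or.inl hs.ne')).mul
        ((hasDerivAt_pressure hs).rpow_const
          (Or.inl (pressure_pos hC hR hs.le).ne'))).const_mul _)
    rw [← integral_const_mul]
    have e1 : ∀ y, (1 - m) / m * (‖y‖ ^ (-β) * inner ℝ ((2 * (σ / 2 * (‖y‖ ^ 2) ^ (σ / 2 - 1) *
        R ^ (-a) * (-(m / (1 - m))) * pressure C σ a R (‖y‖ ^ 2) ^ (-(1 / (1 - m))))) • y)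
        (gradient φ y)) = -(σ * R ^ (-a)) * ((‖y‖ ^ 2) ^ (-γ / 2) *
        pressure C σ a R (‖y‖ ^ 2) ^ (-(1 / (1 - m)))) * inner ℝ y (gradient φ y) := by
      intro y
      rcases eq_or_ne y 0 with rfl | hy
      · simp
      have hs : 0 < ‖y‖ ^ 2 := by positivity
      rw [real_inner_smul_left, norm_rpow_eq_sq_rpow]
      have e2 : (‖y‖ ^ 2) ^ (-γ / 2) = (‖y‖ ^ 2) ^ (-β / 2) * (‖y‖ ^ 2) ^ (σ / 2 - 1) := by
        rw [← Real.rpow_add hs]; congr 1; rw [hσdef]; ring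
      have e3 : (1 - m) / m * (m / (1 - m)) = 1 := by field_simp
      rw [e2]
      linear_combination (-(‖y‖ ^ 2) ^ (-β / 2) * σ * (‖y‖ ^ 2) ^ (σ / 2 - 1) * R ^ (-a) *
        pressure C σ a R (‖y‖ ^ 2) ^ (-(1 / (1 - m))) * inner ℝ y (gradient φ y)) * e3
    simp_rw [e1]
    rw [key, neg_neg]
    refine integral_congr_ae (Eventually.of_forall fun y => ?_)
    simp only
    rcases eq_or_ne y 0 with rfl | hy
    · rw [image_eq_zero_of_notMem_tsupport h0]; ring
    have hs : 0 < ‖y‖ ^ 2 := by positivity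
    rw [pressure_flux_identity hp.m_lt_one hC hR hs ha, norm_rpow_eq_sq_rpow]
    ring


theorem continuousOn_scaleR {d : ℕ} {m β γ T t : ℝ} (hp : Admissible d m β γ)
    (h : ValidTime d m β γ T t) : ContinuousOn (scaleR d m β γ T) (Icc 0 t) := fun _ hs =>
  (hasDerivAt_scaleR hp (h.mono hs)).continuousAt.continuousWithinAt

theorem continuousOn_scaleR_rpow {d : ℕ} {m β γ T t : ℝ} (hp : Admissible d m β γ)
    (h : ValidTime d m β γ T t) (q : ℝ) :
    ContinuousOn (fun s => scaleR d m β γ T s ^ q) (Icc 0 t) :=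
  (continuousOn_scaleR hp h).rpow_const fun _ hs => Or.inl (scaleR_pos hp (h.mono hs)).ne'

theorem hasDerivAt_pressure_time {d : ℕ} {m β γ C T t : ℝ} (hp : Admissible d m β γ)
    (h : ValidTime d m β γ T t) (x : ℝ) :
    HasDerivAt (fun t => pressure C (2 + β - γ) (expA d m β γ) (scaleR d m β γ T t) x)
      (pressureDeriv C (2 + β - γ) (expA d m β γ) (scaleR d m β γ T t) x) t := by
  have hR := scaleR_pos hp h
  have h0 := hasDerivAt_scaleR hp h
  have h1 := h0.rpow_const (p := 2 + β - γ - expA d m β γ) (Or.inl hR.ne')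
  have h2 := h0.rpow_const (p := -expA d m β γ) (Or.inl hR.ne')
  convert! (h1.const_mul C).add (h2.const_mul (x ^ ((2 + β - γ) / 2))) using 1
  set R := scaleR d m β γ T t
  set a := expA d m β γ
  set σ := 2 + β - γ
  have e1 : R ^ (σ - 2 * a) = R ^ (1 - a) * R ^ (σ - a - 1) := by
    rw [← Real.rpow_add hR]; congr 1; ring
  have e2 : R ^ (-(2 * a)) = R ^ (1 - a) * R ^ (-a - 1) := by
    rw [← Real.rpow_add hR]; congr 1; ring
  rw [pressureDeriv, e1, e2]
  ring

theorem continuousOn_pressure_prod {d : ℕ} {m β γ C T t : ℝ} (hp : Admissible d m β γ)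
    (h : ValidTime d m β γ T t) :
    ContinuousOn (fun p : ℝ × E d => pressure C (2 + β - γ) (expA d m β γ) (scaleR d m β γ T p.1)
      (‖p.2‖ ^ 2)) (Icc 0 t ×ˢ univ) := by
  have hfst : MapsTo Prod.fst (Icc 0 t ×ˢ (univ : Set (E d))) (Icc 0 t) := fun p hq => hq.1
  have h1 := (continuousOn_scaleR_rpow hp h (2 + β - γ - expA d m β γ)).comp
    continuousOn_fst hfst
  have h2 := (continuousOn_scaleR_rpow hp h (-expA d m β γ)).comp continuousOn_fst hfst
  have h3 : Continuous fun p : ℝ × E d => (‖p.2‖ ^ 2) ^ ((2 + β - γ) / 2) := by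
    have : Continuous fun s : ℝ => s ^ ((2 + β - γ) / 2) :=
      Real.continuous_rpow_const (by linarith [hp.sigma_pos])
    exact this.comp (by fun_prop : Continuous fun p : ℝ × E d => ‖p.2‖ ^ 2)
  exact (continuousOn_const.mul h1).add (h3.continuousOn.mul h2)

theorem continuousOn_pressureDeriv_prod {d : ℕ} {m β γ C T t : ℝ} (hp : Admissible d m β γ)
    (h : ValidTime d m β γ T t) :
    ContinuousOn (fun p : ℝ × E d => pressureDeriv C (2 + β - γ) (expA d m β γ)
      (scaleR d m β γ T p.1) (‖p.2‖ ^ 2)) (Icc 0 t ×ˢ univ) := by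
  have hfst : MapsTo Prod.fst (Icc 0 t ×ˢ (univ : Set (E d))) (Icc 0 t) := fun p hq => hq.1
  have h1 := (continuousOn_scaleR_rpow hp h (2 + β - γ - 2 * expA d m β γ)).comp
    continuousOn_fst hfst
  have h2 := (continuousOn_scaleR_rpow hp h (-(2 * expA d m β γ))).comp continuousOn_fst hfst
  have h3 : Continuous fun p : ℝ × E d => (‖p.2‖ ^ 2) ^ ((2 + β - γ) / 2) := by
    have : Continuous fun s : ℝ => s ^ ((2 + β - γ) / 2) :=
      Real.continuous_rpow_const (by linarith [hp.sigma_pos])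
    exact this.comp (by fun_prop : Continuous fun p : ℝ × E d => ‖p.2‖ ^ 2)
  exact continuousOn_const.mul (((continuousOn_const.mul h1)).sub
    ((continuousOn_const.mul h3.continuousOn).mul h2))

theorem continuousOn_pressure_rpow_prod {d : ℕ} {m β γ C T t : ℝ} (hp : Admissible d m β γ)
    (h : ValidTime d m β γ T t) (hC : 0 < C) (q : ℝ) :
    ContinuousOn (fun p : ℝ × E d => pressure C (2 + β - γ) (expA d m β γ) (scaleR d m β γ T p.1)
      (‖p.2‖ ^ 2) ^ q) (Icc 0 t ×ˢ univ) :=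
  (continuousOn_pressure_prod hp h).rpow_const fun _ hz => Or.inl
    (pressure_pos hC (scaleR_pos hp (h.mono hz.1)) (by positivity)).ne'

theorem barenblatt_nonneg {d : ℕ} {m β γ C T t : ℝ} (hp : Admissible d m β γ)
    (h : ValidTime d m β γ T t) (hC : 0 < C) (y : E d) : 0 ≤ barenblatt d m β γ C T t y := by
  rw [barenblatt_eq hp h hC]
  exact Real.rpow_nonneg (pressure_pos hC (scaleR_pos hp h) (by positivity)).le _

theorem continuousOn_barenblatt {d : ℕ} {m β γ C T t : ℝ} (hp : Admissible d m β γ)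
    (h : ValidTime d m β γ T t) (hC : 0 < C) :
    ContinuousOn (fun p : ℝ × E d => barenblatt d m β γ C T p.1 p.2) (Icc 0 t ×ˢ univ) :=
  (continuousOn_pressure_rpow_prod hp h hC (-(1 / (1 - m)))).congr fun _ hz =>
    barenblatt_eq hp (h.mono hz.1) hC _

theorem continuous_barenblatt {d : ℕ} {m β γ C T t : ℝ} (hp : Admissible d m β γ)
    (h : ValidTime d m β γ T t) (hC : 0 < C) : Continuous (barenblatt d m β γ C T t) := by
  have : barenblatt d m β γ C T t = fun y => pressure C (2 + β - γ) (expA d m β γ)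
    (scaleR d m β γ T t) (‖y‖ ^ 2) ^ (-(1 / (1 - m))) := funext (barenblatt_eq hp h hC)
  rw [this]
  exact continuous_pressure_rpow hC (scaleR_pos hp h) hp.sigma_pos _

theorem exists_pressure_bounds {d : ℕ} {m β γ C T t : ℝ} (hp : Admissible d m β γ)
    (h : ValidTime d m β γ T t) (hC : 0 < C) :
    ∃ δ K, 0 < δ ∧ 0 < K ∧ ∀ s ∈ Icc 0 t, ∀ x : ℝ, 0 ≤ x →
      δ * (1 + x ^ ((2 + β - γ) / 2)) ≤
        pressure C (2 + β - γ) (expA d m β γ) (scaleR d m β γ T s) x ∧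
      pressure C (2 + β - γ) (expA d m β γ) (scaleR d m β γ T s) x ≤
        K * (1 + x ^ ((2 + β - γ) / 2)) := by
  have hne : (Icc 0 t).Nonempty := nonempty_Icc.2 h.nonneg
  have c1 := (continuousOn_scaleR_rpow hp h (2 + β - γ - expA d m β γ)).const_mul C
  have c2 := continuousOn_scaleR_rpow hp h (-expA d m β γ)
  obtain ⟨s1, hs1, l1⟩ := isCompact_Icc.exists_isMinOn hne c1
  obtain ⟨s2, hs2, l2⟩ := isCompact_Icc.exists_isMinOn hne c2
  obtain ⟨s3, hs3, l3⟩ := isCompact_Icc.exists_isMaxOn hne c1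
  obtain ⟨s4, hs4, l4⟩ := isCompact_Icc.exists_isMaxOn hne c2
  have p := fun s hs => scaleR_pos hp (h.mono (s := s) hs)
  have q1 : ∀ s ∈ Icc 0 t, 0 < C * scaleR d m β γ T s ^ (2 + β - γ - expA d m β γ) := fun s hs => by
    have := p s hs; positivity
  have q2 : ∀ s ∈ Icc 0 t, 0 < scaleR d m β γ T s ^ (-expA d m β γ) := fun s hs => by
    have := p s hs; positivity
  refine ⟨_, _, lt_min (q1 _ hs1) (q2 _ hs2), (q1 _ hs3).trans_le (le_max_left _
    (scaleR d m β γ T s4 ^ (-expA d m β γ))), fun s hs x hx => ?_⟩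
  have k1 := isMinOn_iff.1 l1 s hs
  have k2 := isMinOn_iff.1 l2 s hs
  have k3 := isMaxOn_iff.1 l3 s hs
  have k4 := isMaxOn_iff.1 l4 s hs
  have hx' : 0 ≤ x ^ ((2 + β - γ) / 2) := by positivity
  rw [pressure]
  constructor
  · rw [mul_add, mul_one]
    exact add_le_add ((min_le_left _ _).trans k1)
      (by rw [mul_comm]; exact mul_le_mul_of_nonneg_left ((min_le_right _ _).trans k2) hx')
  · rw [mul_add, mul_one, mul_comm (max _ _)]
    exact add_le_add (k3.trans (le_max_left _ _))
      (mul_le_mul_of_nonneg_left (k4.trans (le_max_right _ _)) hx')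

theorem exists_barenblatt_bounds {d : ℕ} {m β γ C T t : ℝ} (hp : Admissible d m β γ)
    (h : ValidTime d m β γ T t) (hC : 0 < C) :
    ∃ K, 0 < K ∧ ∀ s ∈ Icc 0 t, ∀ y : E d,
      barenblatt d m β γ C T s y ≤ K * (1 + ‖y‖ ^ (2 + β - γ)) ^ (-(1 / (1 - m))) ∧
      barenblatt d m β γ C T s y ^ (m - 1) ≤ K * (1 + ‖y‖ ^ (2 + β - γ)) := by
  obtain ⟨δ, K, hδ, hK, hb⟩ := exists_pressure_bounds hp h hC
  have h1m : 0 < 1 - m := by linarith [hp.m_lt_one]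
  refine ⟨max (δ ^ (-(1 / (1 - m)))) K, lt_max_of_lt_right hK, fun s hs y => ?_⟩
  obtain ⟨b1, b2⟩ := hb s hs (‖y‖ ^ 2) (by positivity)
  rw [← norm_rpow_eq_sq_rpow] at b1 b2
  have hP := pressure_pos (σ := 2 + β - γ) (a := expA d m β γ) hC (scaleR_pos hp (h.mono hs))
    (by positivity : 0 ≤ ‖y‖ ^ 2)
  rw [barenblatt_eq hp (h.mono hs) hC]
  have hn : 0 < 1 + ‖y‖ ^ (2 + β - γ) := by positivity
  constructor
  · refine (Real.rpow_le_rpow_of_nonpos (by positivity) b1 ?_).trans ?_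
    · rw [neg_nonpos]; positivity
    · rw [Real.mul_rpow hδ.le hn.le]
      exact mul_le_mul_of_nonneg_right (le_max_left _ _) (by positivity)
  · rw [← Real.rpow_mul hP.le]
    have : -(1 / (1 - m)) * (m - 1) = 1 := by field_simp; ring
    rw [this, Real.rpow_one]
    exact b2.trans (mul_le_mul_of_nonneg_right (le_max_right _ _) hn.le)

theorem exists_barenblatt_le {d : ℕ} {m β γ C T t : ℝ} (hp : Admissible d m β γ)
    (h : ValidTime d m β γ T t) (hC : 0 < C) :
    ∃ M, 0 < M ∧ ∀ s ∈ Icc 0 t, ∀ y : E d, barenblatt d m β γ C T s y ≤ M := by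
  obtain ⟨K, hK, hb⟩ := exists_barenblatt_bounds hp h hC
  refine ⟨K, hK, fun s hs y => (hb s hs y).1.trans ?_⟩
  have h1m : 0 < 1 - m := by linarith [hp.m_lt_one]
  have : (1 + ‖y‖ ^ (2 + β - γ)) ^ (-(1 / (1 - m))) ≤ 1 := by
    refine Real.rpow_le_one_of_one_le_of_nonpos ?_ ?_
    · have : 0 ≤ ‖y‖ ^ (2 + β - γ) := by positivity
      linarith
    · rw [neg_nonpos]; positivity
  nlinarith

theorem exists_isLocalStrongSolution_barenblatt {d : ℕ} {m β γ C T t₀ : ℝ}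
    (hp : Admissible d m β γ) (h : ValidTime d m β γ T t₀) (ht : 0 < t₀) (hC : 0 < C) :
    ∃ (g : ℝ → E d → ℝ) (G : ℝ → E d → E d),
      IsLocalStrongSolution m β γ t₀ (barenblatt d m β γ C T) g G := by
  have hm0 := hp.m_pos
  have h1m : 0 < 1 - m := by linarith [hp.m_lt_one]
  let g : ℝ → E d → ℝ := fun s y => -(1 / (1 - m)) *
    pressure C (2 + β - γ) (expA d m β γ) (scaleR d m β γ T s) (‖y‖ ^ 2) ^ (-(1 / (1 - m)) - 1) *
      pressureDeriv C (2 + β - γ) (expA d m β γ) (scaleR d m β γ T s) (‖y‖ ^ 2)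
  have hg : ContinuousOn (fun p : ℝ × E d => g p.1 p.2) (Icc 0 t₀ ×ˢ univ) :=
    (continuousOn_const.mul (continuousOn_pressure_rpow_prod hp h hC _)).mul
      (continuousOn_pressureDeriv_prod hp h)
  obtain ⟨M, hM0, hM⟩ := exists_barenblatt_le (d := d) hp h hC
  have hIoc : ∀ s ∈ Ioc 0 t₀, ValidTime d m β γ T s := fun s hs => h.mono (Ioc_subset_Icc_self hs)
  refine ⟨g, fun s y => (2 * ((2 + β - γ) / 2 * (‖y‖ ^ 2) ^ ((2 + β - γ) / 2 - 1) *
    scaleR d m β γ T s ^ (-expA d m β γ) * (-(m / (1 - m))) *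
    pressure C (2 + β - γ) (expA d m β γ) (scaleR d m β γ T s) (‖y‖ ^ 2) ^ (-(1 / (1 - m))))) • y,
    fun s hs => Eventually.of_forall fun y => barenblatt_nonneg hp (h.mono hs) hC y, ?_,
    ⟨M, ?_⟩, ?_, ?_, ?_, ?_, ?_⟩
  · rw [← Measure.restrict_univ (μ := (volume : Measure (E d))), Measure.prod_restrict]
    exact ((continuousOn_barenblatt hp h hC).mono
      (prod_mono Ioc_subset_Icc_self le_rfl)).aestronglyMeasurable
      (measurableSet_Ioc.prod MeasurableSet.univ)
  · filter_upwards [ae_restrict_mem measurableSet_Ioc] with s hs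
    exact Eventually.of_forall (hM s (Ioc_subset_Icc_self hs))
  · filter_upwards [ae_restrict_mem measurableSet_Ioc] with s hs
    have hv := hIoc s hs
    have e : (fun y : E d => barenblatt d m β γ C T s y ^ m) = fun y => pressure C (2 + β - γ)
        (expA d m β γ) (scaleR d m β γ T s) (‖y‖ ^ 2) ^ (-(m / (1 - m))) := by
      ext y
      rw [barenblatt_eq hp hv hC, ← Real.rpow_mul
        (pressure_pos hC (scaleR_pos hp hv) (by positivity)).le]
      congr 1; ring
    rw [e]
    exact isEllipticPair_pressure hp hC (scaleR_pos hp hv)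
  · intro a b ha hab hb
    refine Eventually.of_forall fun y => ?_
    have hva : ∀ s ∈ Icc a b, s ∈ Icc 0 t₀ := fun s hs => ⟨ha.le.trans hs.1, hs.2.trans hb⟩
    rw [barenblatt_eq hp (h.mono (hva b ⟨hab, le_rfl⟩)) hC,
      barenblatt_eq hp (h.mono (hva a ⟨le_rfl, hab⟩)) hC]
    symm
    refine intervalIntegral.integral_eq_sub_of_hasDerivAt (f := fun s => pressure C (2 + β - γ)
        (expA d m β γ) (scaleR d m β γ T s) (‖y‖ ^ 2) ^ (-(1 / (1 - m)))) ?_ ?_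
    · intro s hs
      rw [uIcc_of_le hab] at hs
      have hv := h.mono (hva s hs)
      have := (hasDerivAt_pressure_time (C := C) hp hv (‖y‖ ^ 2)).rpow_const
        (p := -(1 / (1 - m))) (Or.inl (pressure_pos hC (scaleR_pos hp hv) (by positivity)).ne')
      convert! this using 1
      simp only [g]; ring
    · refine ContinuousOn.intervalIntegrable ?_
      rw [uIcc_of_le hab]
      exact hg.comp (f := fun s => (s, y)) (by fun_prop) fun s hs => ⟨hva s hs, mem_univ _⟩
  · intro a b ha hab hb k a' b' hk
    rw [← Measure.restrict_univ (μ := (volume : Measure (E d))), Measure.prod_restrict]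
    have hco : ContinuousOn (fun p : ℝ × E d => g p.1 p.2 * k (‖p.2‖ ^ 2)) (Icc 0 t₀ ×ˢ univ) :=
      hg.mul ((hk.contDiff_comp d).continuous.comp continuous_snd).continuousOn
    have hi : IntegrableOn (fun p : ℝ × E d => g p.1 p.2 * k (‖p.2‖ ^ 2))
        (Icc 0 t₀ ×ˢ annulus d a' b') (volume.prod volume) :=
      (hco.mono (prod_mono le_rfl (subset_univ _))).integrableOn_compact
        (isCompact_Icc.prod (isCompact_annulus d a' b'))
    refine hi.of_forall_sdiff_eq_zero (measurableSet_Ioc.prod MeasurableSet.univ) ?_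
    rintro ⟨s, y⟩ ⟨hs, hn⟩
    have : y ∉ annulus d a' b' := fun hy => hn ⟨⟨ha.le.trans hs.1.1.le, hs.1.2.trans hb⟩, hy⟩
    simp only
    rw [hk.zero _ this, mul_zero]
  · intro s hs k a' b' hk
    exact hk.integrable_bdd_mul (continuous_barenblatt hp (h.mono hs) hC)
  · intro k a' b' hk
    have hev : ∀ᶠ s in 𝓝[>] (0 : ℝ), s ∈ Ioc 0 t₀ := Ioc_mem_nhdsGT ht
    have h0 : (0 : ℝ) ∈ Icc 0 t₀ := ⟨le_rfl, ht.le⟩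
    have := tendsto_integral_filter_of_dominated_convergence (μ := (volume : Measure (E d)))
      (F := fun s y => |barenblatt d m β γ C T s y - barenblatt d m β γ C T 0 y| * |k (‖y‖ ^ 2)|)
      (f := fun _ => 0) (l := 𝓝[>] (0 : ℝ)) (fun y => 2 * M * |k (‖y‖ ^ 2)|) ?_ ?_ ?_ ?_
    · simpa using this
    · filter_upwards [hev] with s hs
      exact ((((continuous_barenblatt hp (hIoc s hs) hC).sub
        (continuous_barenblatt hp (h.mono h0) hC)).abs).mul
        (hk.contDiff_comp d).continuous.abs).aestronglyMeasurable
    · filter_upwards [hev] with s hs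
      refine Eventually.of_forall fun y => ?_
      rw [norm_mul, Real.norm_eq_abs, Real.norm_eq_abs, abs_abs, abs_abs]
      refine mul_le_mul_of_nonneg_right ?_ (abs_nonneg _)
      have b1 := hM s (Ioc_subset_Icc_self hs) y
      have b2 := hM 0 h0 y
      have b3 := barenblatt_nonneg hp (hIoc s hs) hC y
      have b4 := barenblatt_nonneg hp (h.mono h0) hC y
      rw [abs_le]; constructor <;> linarith
    · have := ((hk.integrable_bdd_mul (d := d) (Q := fun _ => 2 * M) continuous_const)).abs
      refine this.congr (Eventually.of_forall fun y => ?_)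
      simp only
      rw [abs_mul, abs_of_pos (by positivity : 0 < 2 * M)]
    · refine Eventually.of_forall fun y => ?_
      have hc : ContinuousWithinAt (fun s => barenblatt d m β γ C T s y) (Icc 0 t₀) 0 :=
        ((continuousOn_barenblatt hp h hC).comp (f := fun s => (s, y)) (by fun_prop)
          fun s hs => ⟨hs, mem_univ _⟩) 0 h0
      have hc' : Tendsto (fun s => barenblatt d m β γ C T s y) (𝓝[>] 0)
          (𝓝 (barenblatt d m β γ C T 0 y)) := by
        refine hc.tendsto.mono_left ?_
        rw [← nhdsWithin_Ioc_eq_nhdsGT ht]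
        exact nhdsWithin_mono _ Ioc_subset_Icc_self
      simpa using ((hc'.sub_const (barenblatt d m β γ C T 0 y)).abs).mul_const |k (‖y‖ ^ 2)|


/-- `f` varies slowly on `(0, ∞)`, with respect to the weight `w`: the functions `s ^ j f⁽ʲ⁾(s)`,
`j ≤ 2`, are bounded by `K w`. -/
structure IsSlow (K : ℝ) (w f : ℝ → ℝ) : Prop where
  smooth : ∀ s, 0 < s → ContDiffAt ℝ ∞ f s
  bound : ∀ s, 0 < s → |f s| ≤ K * w s
  bound_deriv : ∀ s, 0 < s → |s * deriv f s| ≤ K * w s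
  bound_deriv_deriv : ∀ s, 0 < s → |s ^ 2 * deriv (deriv f) s| ≤ K * w s

theorem deriv_mul_eventuallyEq {f g : ℝ → ℝ} (hf : ∀ s, 0 < s → ContDiffAt ℝ ∞ f s)
    (hg : ∀ s, 0 < s → ContDiffAt ℝ ∞ g s) {s : ℝ} (hs : 0 < s) :
    deriv (fun s => f s * g s) =ᶠ[𝓝 s] fun s => deriv f s * g s + f s * deriv g s := by
  filter_upwards [Ioi_mem_nhds hs] with x hx
  exact (((hf x hx).differentiableAt (by simp)).hasDerivAt.mul
    ((hg x hx).differentiableAt (by simp)).hasDerivAt).deriv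

theorem contDiffAt_deriv_infty {f : ℝ → ℝ} {s : ℝ} (hf : ContDiffAt ℝ ∞ f s) :
    ContDiffAt ℝ ∞ (deriv f) s :=
  (hf.fderiv_right (m := ∞) (by simp)).clm_apply contDiffAt_const

theorem IsSlow.mul {K₁ K₂ : ℝ} {w₁ w₂ f₁ f₂ : ℝ → ℝ} (h₁ : IsSlow K₁ w₁ f₁)
    (h₂ : IsSlow K₂ w₂ f₂) :
    IsSlow (4 * (K₁ * K₂)) (fun s => w₁ s * w₂ s) fun s => f₁ s * f₂ s := by
  have hmul : ∀ {a b A B : ℝ}, |a| ≤ A → |b| ≤ B → |a * b| ≤ A * B := by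
    intro a b A B ha hb
    rw [abs_mul]
    exact mul_le_mul ha hb (abs_nonneg _) ((abs_nonneg _).trans ha)
  have hpos : ∀ s, 0 < s → 0 ≤ (K₁ * w₁ s) * (K₂ * w₂ s) := fun s hs =>
    mul_nonneg ((abs_nonneg _).trans (h₁.bound s hs)) ((abs_nonneg _).trans (h₂.bound s hs))
  refine ⟨fun s hs => (h₁.smooth s hs).mul (h₂.smooth s hs), fun s hs => ?_, fun s hs => ?_,
    fun s hs => ?_⟩
  · have := hmul (h₁.bound s hs) (h₂.bound s hs)
    linarith [hpos s hs]
  · rw [(deriv_mul_eventuallyEq h₁.smooth h₂.smooth hs).eq_of_nhds]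
    have e1 := hmul (h₁.bound_deriv s hs) (h₂.bound s hs)
    have e2 := hmul (h₁.bound s hs) (h₂.bound_deriv s hs)
    have : s * (deriv f₁ s * f₂ s + f₁ s * deriv f₂ s) =
      s * deriv f₁ s * f₂ s + f₁ s * (s * deriv f₂ s) := by ring
    rw [this]
    refine (abs_add_le _ _).trans ?_
    linarith [hpos s hs]
  · have e0 : deriv (deriv fun s => f₁ s * f₂ s) s =
        deriv (deriv f₁) s * f₂ s + 2 * (deriv f₁ s * deriv f₂ s) + f₁ s * deriv (deriv f₂) s := by
      rw [(deriv_mul_eventuallyEq h₁.smooth h₂.smooth hs).deriv_eq]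
      have d1 := ((h₁.smooth s hs).differentiableAt (by simp)).hasDerivAt
      have d2 := ((h₂.smooth s hs).differentiableAt (by simp)).hasDerivAt
      have dd1 := ((contDiffAt_deriv_infty (h₁.smooth s hs)).differentiableAt (by simp)).hasDerivAt
      have dd2 := ((contDiffAt_deriv_infty (h₂.smooth s hs)).differentiableAt (by simp)).hasDerivAt
      refine (((dd1.mul d2).add (d1.mul dd2)).deriv).trans ?_
      ring
    have e1 := hmul (h₁.bound_deriv_deriv s hs) (h₂.bound s hs)
    have e2 := hmul (h₁.bound_deriv s hs) (h₂.bound_deriv s hs)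
    have e3 := hmul (h₁.bound s hs) (h₂.bound_deriv_deriv s hs)
    have : s ^ 2 * deriv (deriv fun s => f₁ s * f₂ s) s = s ^ 2 * deriv (deriv f₁) s * f₂ s +
        (s * deriv f₁ s * (s * deriv f₂ s) + s * deriv f₁ s * (s * deriv f₂ s)) +
        f₁ s * (s ^ 2 * deriv (deriv f₂) s) := by rw [e0]; ring
    rw [this]
    refine (abs_add_le _ _).trans ?_
    have := abs_add_le (s ^ 2 * deriv (deriv f₁) s * f₂ s)
      (s * deriv f₁ s * (s * deriv f₂ s) + s * deriv f₁ s * (s * deriv f₂ s))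
    have := abs_add_le (s * deriv f₁ s * (s * deriv f₂ s)) (s * deriv f₁ s * (s * deriv f₂ s))
    linarith

theorem IsSlow.comp_mul {K : ℝ} {w f : ℝ → ℝ} (h : IsSlow K w f) {c : ℝ} (hc : 0 < c) :
    IsSlow K (fun s => w (c * s)) fun s => f (c * s) := by
  have hd : deriv (fun s => f (c * s)) = fun s => c * deriv f (c * s) := by
    ext s
    rw [deriv_comp_mul_left, smul_eq_mul]
  refine ⟨fun s hs => (h.smooth (c * s) (by positivity)).comp s (by fun_prop), fun s hs =>
    h.bound _ (by positivity), fun s hs => ?_, fun s hs => ?_⟩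
  · have := h.bound_deriv (c * s) (by positivity)
    rw [hd]
    convert this using 2
    ring
  · have := h.bound_deriv_deriv (c * s) (by positivity)
    rw [hd]
    have : deriv (fun s => c * deriv f (c * s)) s = c * (c * deriv (deriv f) (c * s)) := by
      rw [deriv_const_mul_field, deriv_comp_mul_left, smul_eq_mul]
    rw [this]
    convert h.bound_deriv_deriv (c * s) (by positivity) using 2
    ring

theorem isSlow_one : IsSlow 1 (fun _ => 1) fun _ => 1 :=
  ⟨fun _ _ => contDiffAt_const, fun _ _ => by simp, fun _ _ => by simp, fun _ _ => by simp⟩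

theorem deriv_one_add_rpow (q : ℝ) {s : ℝ} (hs : 0 < s) :
    deriv (fun s : ℝ => (1 + s) ^ q) s = q * (1 + s) ^ (q - 1) := by
  have : HasDerivAt (fun s : ℝ => 1 + s) 1 s := (hasDerivAt_id s).const_add 1
  have := (this.rpow_const (p := q) (Or.inl (by linarith))).deriv
  rw [this]; ring

theorem deriv_deriv_one_add_rpow (q : ℝ) {s : ℝ} (hs : 0 < s) :
    deriv (deriv fun s : ℝ => (1 + s) ^ q) s = q * ((q - 1) * (1 + s) ^ (q - 2)) := by
  have : deriv (fun s : ℝ => (1 + s) ^ q) =ᶠ[𝓝 s] fun s => q * (1 + s) ^ (q - 1) := by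
    filter_upwards [Ioi_mem_nhds hs] with x hx using deriv_one_add_rpow q hx
  rw [this.deriv_eq, deriv_const_mul_field, deriv_one_add_rpow _ hs]
  congr 3; ring

theorem isSlow_one_add_rpow {q : ℝ} (hq : 0 ≤ q) :
    IsSlow (1 + q * (q + 1)) (fun s => (1 + s) ^ (-q)) fun s => (1 + s) ^ (-q) := by
  have hK : 1 ≤ 1 + q * (q + 1) := by nlinarith
  refine ⟨fun s hs => ?_, fun s hs => ?_, fun s hs => ?_, fun s hs => ?_⟩
  · exact (contDiffAt_const.add contDiffAt_id).rpow_const_of_ne (by simp; linarith)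
  · rw [abs_of_nonneg (by positivity)]
    exact le_mul_of_one_le_left (by positivity) hK
  · rw [deriv_one_add_rpow _ hs]
    have e : (1 + s) ^ (-q) = (1 + s) ^ (-q - 1) * (1 + s) := by
      rw [← Real.rpow_add_one (by positivity)]; congr 1; ring
    have e' : s * (-q * (1 + s) ^ (-q - 1)) = -(q * (s * (1 + s) ^ (-q - 1))) := by ring
    rw [e, e', abs_neg, abs_of_nonneg (by positivity)]
    have hx : 0 ≤ (1 + s) ^ (-q - 1) := by positivity
    set x := (1 + s) ^ (-q - 1)
    have : 0 ≤ x * (1 + s) - s * x := by nlinarith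
    have : 0 ≤ (1 + q * q) * (x * (1 + s)) := by positivity
    nlinarith
  · rw [deriv_deriv_one_add_rpow _ hs]
    have e : (1 + s) ^ (-q) = (1 + s) ^ (-q - 2) * (1 + s) ^ 2 := by
      rw [← Real.rpow_add_natCast (by positivity)]; congr 1; push_cast; ring
    have e' : s ^ 2 * (-q * ((-q - 1) * (1 + s) ^ (-q - 2))) =
      q * (q + 1) * (s ^ 2 * (1 + s) ^ (-q - 2)) := by ring
    rw [e, e', abs_of_nonneg (by positivity)]
    have hx : 0 ≤ (1 + s) ^ (-q - 2) := by positivity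
    refine mul_le_mul (by linarith) ?_ (by positivity) (by positivity)
    rw [mul_comm]
    exact mul_le_mul_of_nonneg_left (by nlinarith) hx

/-- A smooth function that vanishes on `(-∞, 1]` and equals one on `[2, ∞)`. -/
noncomputable def step (s : ℝ) : ℝ := Real.smoothTransition (s - 1)

theorem contDiff_step : ContDiff ℝ ∞ step :=
  Real.smoothTransition.contDiff.comp (contDiff_id.sub contDiff_const)

theorem step_of_le {s : ℝ} (hs : s ≤ 1) : step s = 0 :=
  Real.smoothTransition.zero_of_nonpos (by linarith)

theorem step_of_ge {s : ℝ} (hs : 2 ≤ s) : step s = 1 :=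
  Real.smoothTransition.one_of_one_le (by linarith)

theorem step_nonneg (s : ℝ) : 0 ≤ step s := Real.smoothTransition.nonneg _

theorem step_le_one (s : ℝ) : step s ≤ 1 := Real.smoothTransition.le_one _

theorem isProfile_deriv_step : IsProfile (deriv step) 1 2 := by
  refine ⟨(contDiff_infty_iff_deriv.1 contDiff_step).2, one_pos, one_lt_two, fun s hs => ?_⟩
  have : deriv step s = deriv Real.smoothTransition (s - 1) :=
    deriv_comp_sub_const Real.smoothTransition 1 s
  rw [this]
  refine deriv_smoothTransition_eq_zero fun h => hs ⟨by linarith [h.1], by linarith [h.2]⟩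

theorem exists_isSlow_step :
    ∃ K, 0 ≤ K ∧ IsSlow K (fun _ => 1) step ∧ IsSlow K (fun _ => 1) fun s => 1 - step s := by
  have hbd : ∀ {f : ℝ → ℝ} (q : ℕ), IsProfile f 1 2 → ∃ N, ∀ s, |s ^ q * f s| ≤ N := by
    intro f q hf
    obtain ⟨N, hN⟩ := (isCompact_Icc (a := (1 : ℝ)) (b := 2)).exists_bound_of_continuousOn
      (f := fun s => s ^ q * f s) ((continuous_pow q).mul hf.smooth.continuous).continuousOn
    refine ⟨max N 0, fun s => ?_⟩
    by_cases hs : s ∈ Icc (1 : ℝ) 2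
    · exact (hN s hs).trans (le_max_left _ _)
    · rw [hf.zero s hs, mul_zero, abs_zero]; exact le_max_right _ _
  obtain ⟨N1, h1⟩ := hbd 1 isProfile_deriv_step
  obtain ⟨N2, h2⟩ := hbd 2 isProfile_deriv_step.deriv
  have hd : deriv (fun s => 1 - step s) = fun s => -deriv step s := by
    ext s; rw [deriv_const_sub]
  refine ⟨1 + |N1| + |N2|, by positivity,
    ⟨fun s _ => contDiff_step.contDiffAt, fun s _ => ?_, fun s _ => ?_, fun s _ => ?_⟩,
    ⟨fun s _ => (contDiff_const.sub contDiff_step).contDiffAt, fun s _ => ?_, fun s _ => ?_,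
      fun s _ => ?_⟩⟩
  · rw [abs_of_nonneg (step_nonneg s)]
    linarith [step_le_one s, abs_nonneg N1, abs_nonneg N2]
  · have := h1 s
    rw [pow_one] at this
    linarith [le_abs_self N1, abs_nonneg N2]
  · have := h2 s
    linarith [le_abs_self N2, abs_nonneg N1]
  · rw [abs_of_nonneg (by linarith [step_le_one s])]
    linarith [step_nonneg s, abs_nonneg N1, abs_nonneg N2]
  · have := h1 s
    rw [pow_one] at this
    rw [hd, mul_neg, abs_neg]
    linarith [le_abs_self N1, abs_nonneg N2]
  · have := h2 s
    rw [hd]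
    have e : deriv (fun s => -deriv step s) s = -deriv (deriv step) s := deriv.fun_neg
    rw [e, mul_neg, abs_neg]
    linarith [le_abs_self N2, abs_nonneg N1]

/-- Truncations of functions on the half line away from zero and infinity. -/
noncomputable def trunc (k : ℕ) (s : ℝ) : ℝ :=
  step (((k : ℝ) + 1) * s) * (1 - step (((k : ℝ) + 1)⁻¹ * s))

theorem trunc_nonneg (k : ℕ) (s : ℝ) : 0 ≤ trunc k s :=
  mul_nonneg (step_nonneg _) (by linarith [step_le_one (((k : ℝ) + 1)⁻¹ * s)])

theorem trunc_le_one (k : ℕ) (s : ℝ) : trunc k s ≤ 1 :=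
  mul_le_one₀ (step_le_one _) (by linarith [step_le_one (((k : ℝ) + 1)⁻¹ * s)])
    (by linarith [step_nonneg (((k : ℝ) + 1)⁻¹ * s)])

theorem contDiff_trunc (k : ℕ) : ContDiff ℝ ∞ (trunc k) :=
  (contDiff_step.comp (contDiff_const.mul contDiff_id)).mul
    (contDiff_const.sub (contDiff_step.comp (contDiff_const.mul contDiff_id)))

theorem trunc_eq_zero {k : ℕ} {s : ℝ}
    (hs : s ∉ Icc (((k : ℝ) + 1)⁻¹) (2 * ((k : ℝ) + 1))) : trunc k s = 0 := by
  have hk : 0 < (k : ℝ) + 1 := by positivity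
  rw [mem_Icc, not_and_or, not_le, not_le] at hs
  rcases hs with hs | hs
  · have : ((k : ℝ) + 1) * s ≤ 1 := by
      have := mul_le_mul_of_nonneg_left hs.le hk.le
      rwa [mul_inv_cancel₀ hk.ne'] at this
    rw [trunc, step_of_le this, zero_mul]
  · have : 2 ≤ ((k : ℝ) + 1)⁻¹ * s := by
      rw [inv_mul_eq_div, le_div_iff₀ hk]; exact hs.le
    rw [trunc, step_of_ge this]; ring

theorem trunc_eventuallyEq_one {s : ℝ} (hs : 0 < s) :
    ∀ᶠ k in atTop, trunc k =ᶠ[𝓝 s] fun _ => 1 := by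
  filter_upwards [tendsto_natCast_atTop_atTop.eventually_gt_atTop (4 / s),
    tendsto_natCast_atTop_atTop.eventually_gt_atTop (2 * s)] with k h1 h2
  have hk : 0 < (k : ℝ) + 1 := by positivity
  filter_upwards [Ioo_mem_nhds (show s / 2 < s by linarith) (show s < 2 * s by linarith)] with x hx
  have h3 : 2 ≤ ((k : ℝ) + 1) * x := by
    rw [div_lt_iff₀ hs] at h1
    nlinarith [hx.1]
  have h4 : ((k : ℝ) + 1)⁻¹ * x ≤ 1 := by
    rw [inv_mul_eq_div, div_le_one hk]; linarith [hx.2]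
  rw [trunc, step_of_ge h3, step_of_le h4]; ring

theorem isProfile_trunc_mul (k : ℕ) {F : ℝ → ℝ} (hF : ∀ s, 0 < s → ContDiffAt ℝ ∞ F s) :
    IsProfile (fun s => trunc k s * F s) (((k : ℝ) + 1)⁻¹) (2 * ((k : ℝ) + 1)) := by
  have hk : 0 < (k : ℝ) + 1 := by positivity
  refine ⟨?_, by positivity, ?_, fun s hs => by rw [trunc_eq_zero hs, zero_mul]⟩
  · rw [contDiff_iff_contDiffAt]
    intro s
    rcases le_or_gt s 0 with hs | hs
    · have : (fun s => trunc k s * F s) =ᶠ[𝓝 s] fun _ => 0 := by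
        have h0 : s < ((k : ℝ) + 1)⁻¹ := hs.trans_lt (by positivity)
        filter_upwards [Iio_mem_nhds h0] with x hx
        rw [trunc_eq_zero (fun h => absurd h.1 (not_le.2 hx)), zero_mul]
      exact contDiffAt_const.congr_of_eventuallyEq this
    · exact (contDiff_trunc k).contDiffAt.mul (hF s hs)
  · have : ((k : ℝ) + 1)⁻¹ ≤ 1 := inv_le_one_of_one_le₀ (by linarith)
    linarith

theorem exists_isSlow_trunc : ∃ K, 0 ≤ K ∧ ∀ k, IsSlow K (fun _ => 1) (trunc k) := by
  obtain ⟨K, hK, h1, h2⟩ := exists_isSlow_step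
  refine ⟨4 * (K * K), by positivity, fun k => ?_⟩
  have hk : 0 < (k : ℝ) + 1 := by positivity
  have := (h1.comp_mul hk).mul (h2.comp_mul (inv_pos.2 hk))
  simp only [mul_one] at this
  exact this

theorem IsSlow.abs_radL_le {K : ℝ} {w f : ℝ → ℝ} (h : IsSlow K w f) (d : ℕ) (β : ℝ) {s : ℝ}
    (hs : 0 < s) :
    |radL d β f s| ≤ (4 + 2 * |(d : ℝ) - β|) * K * (s ^ (-β / 2 - 1) * w s) := by
  have e : s ^ (-β / 2) = s ^ (-β / 2 - 1) * s := by
    rw [← Real.rpow_add_one hs.ne']; congr 1; ring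
  have e' : radL d β f s = s ^ (-β / 2 - 1) * (4 * (s ^ 2 * deriv (deriv f) s) +
      2 * ((d : ℝ) - β) * (s * deriv f s)) := by rw [radL, e]; ring
  rw [e', abs_mul, abs_of_nonneg (by positivity)]
  have h1 := h.bound_deriv s hs
  have h2 := h.bound_deriv_deriv s hs
  have h3 : |4 * (s ^ 2 * deriv (deriv f) s) + 2 * ((d : ℝ) - β) * (s * deriv f s)| ≤
      4 * (K * w s) + 2 * |(d : ℝ) - β| * (K * w s) := by
    refine (abs_add_le _ _).trans (add_le_add ?_ ?_)
    · rw [abs_mul, abs_of_pos (by norm_num : (0 : ℝ) < 4)]; linarith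
    · rw [abs_mul, abs_mul, abs_of_pos (by norm_num : (0 : ℝ) < 2)]
      exact mul_le_mul_of_nonneg_left h1 (by positivity)
  calc _ ≤ s ^ (-β / 2 - 1) * (4 * (K * w s) + 2 * |(d : ℝ) - β| * (K * w s)) :=
        mul_le_mul_of_nonneg_left h3 (by positivity)
    _ = _ := by ring

theorem exists_abs_radL_trunc_mul_le {K : ℝ} {w F : ℝ → ℝ} (hF : IsSlow K w F) (d : ℕ) (β : ℝ)
    (hK : 0 ≤ K) :
    ∃ N, 0 ≤ N ∧ ∀ k s, 0 < s →
      |radL d β (fun s => trunc k s * F s) s| ≤ N * (s ^ (-β / 2 - 1) * w s) := by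
  obtain ⟨A, hA, h⟩ := exists_isSlow_trunc
  refine ⟨(4 + 2 * |(d : ℝ) - β|) * (4 * (A * K)), by positivity, fun k s hs => ?_⟩
  have := ((h k).mul hF).abs_radL_le d β hs
  simpa only [one_mul] using this

theorem radL_congr {d : ℕ} {β : ℝ} {f g : ℝ → ℝ} {s : ℝ} (h : f =ᶠ[𝓝 s] g) :
    radL d β f s = radL d β g s := by
  rw [radL, radL, h.deriv_eq, h.deriv.deriv_eq]

theorem radL_trunc_mul_eventually_eq (d : ℕ) (β : ℝ) (F : ℝ → ℝ) {s : ℝ} (hs : 0 < s) :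
    ∀ᶠ k in atTop, radL d β (fun s => trunc k s * F s) s = radL d β F s := by
  filter_upwards [trunc_eventuallyEq_one hs] with k hk
  refine radL_congr ?_
  filter_upwards [hk] with x hx
  rw [hx, one_mul]

theorem radL_one (d : ℕ) (β s : ℝ) : radL d β (fun _ => 1) s = 0 := by
  simp [radL]

theorem radL_one_add_mul_rpow_nonpos {d : ℕ} {β ε s : ℝ} (hβ : β < d - 2) (hε : 0 < ε)
    (hs : 0 < s) : radL d β (fun s => (1 + ε * s) ^ (-(((d : ℝ) - 2 - β) / 2))) s ≤ 0 := by
  set q := ((d : ℝ) - 2 - β) / 2 with hq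
  have hd : (d : ℝ) - β = 2 * q + 2 := by rw [hq]; ring
  have hq0 : 0 < q := by rw [hq]; linarith
  have h0 : deriv (fun s : ℝ => (1 + ε * s) ^ (-q)) =
      fun s => ε * deriv (fun s : ℝ => (1 + s) ^ (-q)) (ε * s) := by
    ext x
    rw [deriv_comp_mul_left ε (fun s : ℝ => (1 + s) ^ (-q)), smul_eq_mul]
  have h1 : deriv (deriv fun s : ℝ => (1 + ε * s) ^ (-q)) s =
      ε * (ε * deriv (deriv fun s : ℝ => (1 + s) ^ (-q)) (ε * s)) := by
    rw [h0, deriv_const_mul_field, deriv_comp_mul_left, smul_eq_mul]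
  have hes : 0 < ε * s := by positivity
  rw [radL, h1, congrFun h0 s, deriv_deriv_one_add_rpow _ hes, deriv_one_add_rpow _ hes, hd]
  have e : (1 + ε * s) ^ (-q - 1) = (1 + ε * s) ^ (-q - 2) * (1 + ε * s) := by
    rw [← Real.rpow_add_one (by positivity)]; congr 1; ring
  rw [e]
  refine mul_nonpos_of_nonneg_of_nonpos (by positivity) ?_
  have : 4 * s * (ε * (ε * (-q * ((-q - 1) * (1 + ε * s) ^ (-q - 2))))) +
      2 * (2 * q + 2) * (ε * (-q * ((1 + ε * s) ^ (-q - 2) * (1 + ε * s)))) =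
      -(4 * q * (q + 1) * ε * (1 + ε * s) ^ (-q - 2)) := by ring
  rw [this, neg_nonpos]
  positivity


/-- The radial function `|y|^(-α)` in the unit ball, `|y|^(-κ)` outside. -/
noncomputable def radialBound (d : ℕ) (α κ : ℝ) (y : E d) : ℝ :=
  if ‖y‖ < 1 then ‖y‖ ^ (-α) else ‖y‖ ^ (-κ)

theorem radialBound_nonneg (d : ℕ) (α κ : ℝ) (y : E d) : 0 ≤ radialBound d α κ y := by
  rw [radialBound]; split_ifs <;> positivity

theorem integrable_radialBound {d : ℕ} (hd : 0 < d) {α κ : ℝ} (hα : α < d) (hκ : d < κ) :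
    Integrable (radialBound d α κ) := by
  have : Nonempty (Fin d) := ⟨⟨0, hd⟩⟩
  have hfr : Module.finrank ℝ (E d) = d := by simp
  have hpow : ∀ (x q : ℝ), 0 < x → x ^ (d - 1) * x ^ q = x ^ ((d : ℝ) - 1 + q) := by
    intro x q hx
    rw [Real.rpow_add hx, ← Real.rpow_natCast x (d - 1), Nat.cast_pred hd]
  refine (integrable_fun_norm_addHaar (volume : Measure (E d))
    (f := fun r : ℝ => if r < 1 then r ^ (-α) else r ^ (-κ))).2 ?_
  rw [hfr]
  have hu : Ioi (0 : ℝ) = Ioo 0 1 ∪ Ici 1 := (Ioo_union_Ici_eq_Ioi zero_lt_one).symm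
  rw [hu, integrableOn_union]
  constructor
  · refine ((intervalIntegral.integrableOn_Ioo_rpow_iff (s := (d : ℝ) - 1 + -α) one_pos).2
      (by linarith)).congr_fun ?_ measurableSet_Ioo
    intro x hx
    simp only [smul_eq_mul]
    rw [if_pos hx.2, hpow x _ hx.1]
  · rw [integrableOn_Ici_iff_integrableOn_Ioi]
    refine (integrableOn_Ioi_rpow_of_lt (a := (d : ℝ) - 1 + -κ) (by linarith) one_pos).congr_fun ?_
      measurableSet_Ioi
    intro x hx
    have hx' : (1 : ℝ) < x := hx
    simp only [smul_eq_mul]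
    rw [if_neg (by linarith), hpow x _ (by linarith)]

theorem ae_ne_zero {d : ℕ} (hd : 0 < d) : ∀ᵐ y : E d, y ≠ 0 := by
  have : Nonempty (Fin d) := ⟨⟨0, hd⟩⟩
  exact compl_mem_ae_iff.2 (measure_singleton 0)

theorem abs_max_zero_le (x : ℝ) : |max x 0| ≤ |x| := by
  rcases le_total x 0 with h0 | h0
  · simp [max_eq_right h0]
  · simp [max_eq_left h0]

namespace IsLocalStrongSolution

variable {d : ℕ} {m β γ t₀ : ℝ} {v g v' g' : ℝ → E d → ℝ} {G G' : ℝ → E d → E d}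

theorem tendsto_integral_trunc_mul (hd : 0 < d) (h : IsLocalStrongSolution m β γ t₀ v g G)
    (h' : IsLocalStrongSolution m β γ t₀ v' g' G') {F : ℝ → ℝ}
    (hF : ∀ s, 0 < s → ContDiffAt ℝ ∞ F s) {s : ℝ} (hs : s ∈ Icc 0 t₀)
    (hi : Integrable fun y => (v s y - v' s y) * ((‖y‖ ^ 2) ^ (-γ / 2) * F (‖y‖ ^ 2))) {Θ : ℝ → ℝ}
    (hΘ : Continuous Θ) (hΘ1 : ∀ x, |Θ x| ≤ |x|) :
    Tendsto (fun k : ℕ => ∫ y, Θ ((v s y - v' s y) *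
        ((‖y‖ ^ 2) ^ (-γ / 2) * (trunc k (‖y‖ ^ 2) * F (‖y‖ ^ 2))))) atTop
      (𝓝 (∫ y, Θ ((v s y - v' s y) * ((‖y‖ ^ 2) ^ (-γ / 2) * F (‖y‖ ^ 2))))) := by
  refine tendsto_integral_of_dominated_convergence _ (fun k => ?_) hi.abs (fun k => ?_) ?_
  · exact hΘ.comp_aestronglyMeasurable
      (h.integrable_sub_mul h' ((isProfile_trunc_mul k hF).rpow_mul (-γ / 2)) hs).1
  · refine Eventually.of_forall fun y => (hΘ1 _).trans ?_
    have : (v s y - v' s y) * ((‖y‖ ^ 2) ^ (-γ / 2) * (trunc k (‖y‖ ^ 2) * F (‖y‖ ^ 2))) =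
        trunc k (‖y‖ ^ 2) * ((v s y - v' s y) * ((‖y‖ ^ 2) ^ (-γ / 2) * F (‖y‖ ^ 2))) := by ring
    rw [this, abs_mul, abs_of_nonneg (trunc_nonneg _ _)]
    exact mul_le_of_le_one_left (abs_nonneg _) (trunc_le_one _ _)
  · filter_upwards [ae_ne_zero hd] with y hy
    have hs : 0 < ‖y‖ ^ 2 := by positivity
    refine tendsto_const_nhds.congr' ?_
    filter_upwards [trunc_eventuallyEq_one hs] with k hk
    rw [hk.eq_of_nhds, one_mul]

/-- Weighted `L¹` contraction, for supersolution weights. -/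
theorem contraction_of_isSlow (hd : 0 < d) (hm : 0 < m) (hm1 : m < 1)
    (h : IsLocalStrongSolution m β γ t₀ v g G)
    (h' : IsLocalStrongSolution m β γ t₀ v' g' G') (ht : 0 < t₀) {K : ℝ} {F : ℝ → ℝ}
    (hK : 0 ≤ K) (hF : IsSlow K F F) (hF0 : ∀ s, 0 < s → 0 ≤ F s)
    (hL : ∀ s, 0 < s → radL d β F s ≤ 0)
    (hi0 : Integrable fun y => (v 0 y - v' 0 y) * ((‖y‖ ^ 2) ^ (-γ / 2) * F (‖y‖ ^ 2)))
    (hi1 : Integrable fun y => (v t₀ y - v' t₀ y) * ((‖y‖ ^ 2) ^ (-γ / 2) * F (‖y‖ ^ 2)))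
    (hZ : ∃ N, ∀ᵐ s ∂(volume.restrict (Ioc 0 t₀)),
      Integrable (fun y => (v s y ^ m + v' s y ^ m) * ((‖y‖ ^ 2) ^ (-β / 2 - 1) * F (‖y‖ ^ 2))) ∧
      ∫ y, (v s y ^ m + v' s y ^ m) * ((‖y‖ ^ 2) ^ (-β / 2 - 1) * F (‖y‖ ^ 2)) ≤ N) :
    ∫ y, max ((v t₀ y - v' t₀ y) * ((‖y‖ ^ 2) ^ (-γ / 2) * F (‖y‖ ^ 2))) 0 ≤
      ∫ y, max ((v 0 y - v' 0 y) * ((‖y‖ ^ 2) ^ (-γ / 2) * F (‖y‖ ^ 2))) 0 := by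
  have hc : 0 ≤ (1 - m) / m := div_nonneg (by linarith) hm.le
  have hmc : Continuous fun x : ℝ => max x 0 := by fun_prop
  obtain ⟨A, hA, hb⟩ := exists_abs_radL_trunc_mul_le hF d β hK
  obtain ⟨N, hN⟩ := hZ
  have hpr := fun k => isProfile_trunc_mul k hF.smooth
  have hpr0 : ∀ k s, 0 ≤ trunc k s * F s := by
    intro k s
    rcases le_or_gt s 0 with hs | hs
    · rw [trunc_eq_zero, zero_mul]
      intro hh
      have := hh.1
      have : 0 < ((k : ℝ) + 1)⁻¹ := by positivity
      linarith
    · exact mul_nonneg (trunc_nonneg _ _) (hF0 s hs)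
  have l1 := h.tendsto_integral_trunc_mul hd h' hF.smooth ⟨ht.le, le_rfl⟩ hi1 hmc abs_max_zero_le
  have l0 := h.tendsto_integral_trunc_mul hd h' hF.smooth ⟨le_rfl, ht.le⟩ hi0 hmc abs_max_zero_le
  have hnn : ∀ᵐ s ∂(volume.restrict (Ioc 0 t₀)), ∀ᵐ y, 0 ≤ v s y ^ m ∧ 0 ≤ v' s y ^ m := by
    filter_upwards [ae_restrict_mem measurableSet_Ioc] with s hs
    filter_upwards [h.nonneg s (Ioc_subset_Icc_self hs),
      h'.nonneg s (Ioc_subset_Icc_self hs)] with y h1 h2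
    exact ⟨by positivity, by positivity⟩
  have hdom : ∀ᵐ s ∂(volume.restrict (Ioc 0 t₀)), ∀ k, ∀ᵐ y : E d,
      ‖max (v s y ^ m - v' s y ^ m) 0 * radL d β (fun x => trunc k x * F x) (‖y‖ ^ 2)‖ ≤
        A * ((v s y ^ m + v' s y ^ m) * ((‖y‖ ^ 2) ^ (-β / 2 - 1) * F (‖y‖ ^ 2))) := by
    filter_upwards [hnn] with s h1 k
    filter_upwards [h1, ae_ne_zero hd] with y h2 hy
    have hs : 0 < ‖y‖ ^ 2 := by positivity
    rw [norm_mul, Real.norm_eq_abs, Real.norm_eq_abs]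
    have e1 : |max (v s y ^ m - v' s y ^ m) 0| ≤ v s y ^ m + v' s y ^ m := by
      refine (abs_max_zero_le _).trans ?_
      rw [abs_le]; constructor <;> linarith [h2.1, h2.2]
    refine (mul_le_mul e1 (hb k _ hs) (abs_nonneg _) (by linarith [h2.1, h2.2])).trans_eq ?_
    ring
  have l2 : Tendsto (fun k : ℕ => ∫ s in Ioc 0 t₀, (1 - m) / m *
      ∫ y, max (v s y ^ m - v' s y ^ m) 0 * radL d β (fun x => trunc k x * F x) (‖y‖ ^ 2)) atTop
      (𝓝 (∫ s in Ioc 0 t₀, (1 - m) / m *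
        ∫ y, max (v s y ^ m - v' s y ^ m) 0 * radL d β F (‖y‖ ^ 2))) := by
    refine tendsto_integral_of_dominated_convergence (fun _ => (1 - m) / m * (A * N))
      (fun k => ?_) (integrable_const _) (fun k => ?_) ?_
    · exact (h.exists_flux_bound hm h' (hpr k) hmc abs_max_zero_le).1.const_mul _
    · filter_upwards [hdom, hN] with s h1 h2
      rw [norm_mul, Real.norm_of_nonneg hc]
      refine mul_le_mul_of_nonneg_left ?_ hc
      refine (norm_integral_le_of_norm_le (h2.1.const_mul A) (h1 k)).trans ?_
      rw [integral_const_mul]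
      exact mul_le_mul_of_nonneg_left h2.2 hA
    · filter_upwards [hdom, hN, h.pair, h'.pair] with s h1 h2 h3 h4
      refine Tendsto.const_mul _ ?_
      refine tendsto_integral_of_dominated_convergence _ (fun k => ?_) (h2.1.const_mul A) h1 ?_
      · exact (hmc.comp_aestronglyMeasurable (h3.meas.sub h4.meas)).mul
          (((hpr k).continuous_radL d β).comp (by fun_prop)).aestronglyMeasurable
      · filter_upwards [ae_ne_zero hd] with y hy
        have hs : 0 < ‖y‖ ^ 2 := by positivity
        refine tendsto_const_nhds.congr' ?_
        filter_upwards [radL_trunc_mul_eventually_eq d β F hs] with k hk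
        rw [hk]
  have l3 : ∫ s in Ioc 0 t₀, (1 - m) / m *
      ∫ y, max (v s y ^ m - v' s y ^ m) 0 * radL d β F (‖y‖ ^ 2) ≤ 0 := by
    refine integral_nonpos fun s => mul_nonpos_of_nonneg_of_nonpos hc ?_
    refine integral_nonpos_of_ae ?_
    filter_upwards [ae_ne_zero hd] with y hy
    exact mul_nonpos_of_nonneg_of_nonpos (le_max_right _ _) (hL _ (by positivity))
  have := le_of_tendsto_of_tendsto' l1 (l0.add l2) fun k =>
    h.contraction hm hm1 h' (hpr k) (hpr0 k) ht
  linarith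

end IsLocalStrongSolution

/-- A weight `F` with `∇ · (|y|^(-β) ∇ F(|y|²)) ≤ 0`. -/
noncomputable def slowWeight (d : ℕ) (β ε s : ℝ) : ℝ := (1 + ε * s) ^ (-(((d : ℝ) - 2 - β) / 2))

section slowWeight

variable {d : ℕ} {β ε s : ℝ}

theorem slowWeight_pos (hε : 0 < ε) (hs : 0 ≤ s) : 0 < slowWeight d β ε s := by
  rw [slowWeight]; positivity

theorem slowWeight_le_one (hβ : β < d - 2) (hε : 0 < ε) (hs : 0 ≤ s) :
    slowWeight d β ε s ≤ 1 := by
  refine Real.rpow_le_one_of_one_le_of_nonpos ?_ (by linarith)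
  have : 0 ≤ ε * s := by positivity
  linarith

theorem slowWeight_le_rpow (hβ : β < d - 2) (hε : 0 < ε) (hs : 0 < s) :
    slowWeight d β ε s ≤ ε ^ (-(((d : ℝ) - 2 - β) / 2)) * s ^ (-(((d : ℝ) - 2 - β) / 2)) := by
  rw [slowWeight, ← Real.mul_rpow hε.le hs.le]
  exact Real.rpow_le_rpow_of_nonpos (by positivity) (by linarith) (by linarith)

theorem le_slowWeight (hβ : β < d - 2) (hε : 0 < ε) (hs : 0 ≤ s) (hεs : ε * s ≤ 1) :
    (2 : ℝ) ^ (-(((d : ℝ) - 2 - β) / 2)) ≤ slowWeight d β ε s := by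
  have : 0 ≤ ε * s := by positivity
  exact Real.rpow_le_rpow_of_nonpos (by linarith) (by linarith) (by linarith)

theorem exists_isSlow_slowWeight (hβ : β < d - 2) (hε : 0 < ε) :
    ∃ K, 0 ≤ K ∧ IsSlow K (slowWeight d β ε) (slowWeight d β ε) := by
  have hq : 0 ≤ ((d : ℝ) - 2 - β) / 2 := by linarith
  exact ⟨_, by positivity, (isSlow_one_add_rpow hq).comp_mul hε⟩

theorem measurable_slowWeight : Measurable (slowWeight d β ε) := by
  unfold slowWeight
  exact (measurable_const.add (measurable_const.mul measurable_id)).pow_const _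

end slowWeight

theorem measurable_sq_rpow {d : ℕ} (q : ℝ) : Measurable fun y : E d => (‖y‖ ^ 2) ^ q :=
  (measurable_norm.pow_const 2).pow_const q

theorem measurable_weight_mul_slowWeight {d : ℕ} (q β ε : ℝ) :
    Measurable fun y : E d => (‖y‖ ^ 2) ^ q * slowWeight d β ε (‖y‖ ^ 2) :=
  (measurable_sq_rpow q).mul (measurable_slowWeight.comp (measurable_norm.pow_const 2))

theorem sq_rpow_mul_slowWeight_le {d : ℕ} {β ε : ℝ} (hβ : β < d - 2) (hε : 0 < ε) (q : ℝ) {y : E d}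
    (hy : y ≠ 0) : (‖y‖ ^ 2) ^ (q / 2) * slowWeight d β ε (‖y‖ ^ 2) ≤
      ε ^ (-(((d : ℝ) - 2 - β) / 2)) * ‖y‖ ^ (q - ((d : ℝ) - 2 - β)) := by
  have hs : 0 < ‖y‖ ^ 2 := by positivity
  have e : ‖y‖ ^ (q - ((d : ℝ) - 2 - β)) =
      (‖y‖ ^ 2) ^ (q / 2) * (‖y‖ ^ 2) ^ (-(((d : ℝ) - 2 - β) / 2)) := by
    rw [norm_rpow_eq_sq_rpow, ← Real.rpow_add hs]; congr 1; ring
  rw [e, mul_left_comm]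
  exact mul_le_mul_of_nonneg_left (slowWeight_le_rpow hβ hε hs) (by positivity)

theorem exists_integrable_barenblatt_mul_le {d : ℕ} {m β γ C T t ε : ℝ} (hd : 0 < d)
    (hp : Admissible d m β γ) (h : ValidTime d m β γ T t) (hC : 0 < C) (hε : 0 < ε) :
    ∃ H : E d → ℝ, Integrable H ∧ ∀ s ∈ Icc 0 t, ∀ y, y ≠ 0 →
      barenblatt d m β γ C T s y * ((‖y‖ ^ 2) ^ (-γ / 2) * slowWeight d β ε (‖y‖ ^ 2)) ≤ H y := by
  obtain ⟨K, hK, hb⟩ := exists_barenblatt_bounds (d := d) hp h hC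
  have h1m : 0 < 1 - m := by linarith [hp.m_lt_one]
  have hσ := hp.sigma_pos
  set σ := 2 + β - γ with hσd
  set B := max 1 (ε ^ (-(((d : ℝ) - 2 - β) / 2))) with hB
  have hB0 : 0 < B := lt_max_of_lt_left one_pos
  refine ⟨fun y => K * B * radialBound d γ (σ / (1 - m) + γ + ((d : ℝ) - 2 - β)) y, ?_, ?_⟩
  · refine (integrable_radialBound hd hp.gamma_lt ?_).const_mul _
    have : σ < σ / (1 - m) := by
      rw [lt_div_iff₀ h1m]; nlinarith [hp.m_pos]
    linarith
  · intro s hs y hy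
    have hny : 0 < ‖y‖ := norm_pos_iff.2 hy
    have b1 := (hb s hs y).1
    have b0 := barenblatt_nonneg hp (h.mono hs) hC y
    have hw : 0 < slowWeight d β ε (‖y‖ ^ 2) := slowWeight_pos hε (by positivity)
    have hw0 : 0 ≤ (‖y‖ ^ 2) ^ (-γ / 2) * slowWeight d β ε (‖y‖ ^ 2) := by positivity
    have hn : -(1 / (1 - m)) ≤ 0 := by rw [neg_nonpos]; positivity
    simp only [radialBound]
    split_ifs with hlt
    · have c1 : barenblatt d m β γ C T s y ≤ K := by
        refine b1.trans (mul_le_of_le_one_right hK.le ?_)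
        refine Real.rpow_le_one_of_one_le_of_nonpos ?_ hn
        have : 0 ≤ ‖y‖ ^ σ := by positivity
        linarith
      have c2 : (‖y‖ ^ 2) ^ (-γ / 2) * slowWeight d β ε (‖y‖ ^ 2) ≤ B * ‖y‖ ^ (-γ) := by
        rw [norm_rpow_eq_sq_rpow, mul_comm B]
        exact mul_le_mul_of_nonneg_left
          ((slowWeight_le_one hp.beta_lt hε (by positivity)).trans (le_max_left _ _))
          (by positivity)
      calc _ ≤ K * (B * ‖y‖ ^ (-γ)) := mul_le_mul c1 c2 hw0 hK.le
        _ = _ := by ring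
    · have c1 : barenblatt d m β γ C T s y ≤ K * ‖y‖ ^ (-(σ / (1 - m))) := by
        refine b1.trans (mul_le_mul_of_nonneg_left ?_ hK.le)
        have e : ‖y‖ ^ (-(σ / (1 - m))) = (‖y‖ ^ σ) ^ (-(1 / (1 - m))) := by
          rw [← Real.rpow_mul hny.le]; congr 1; ring
        rw [e]
        exact Real.rpow_le_rpow_of_nonpos (by positivity) (by linarith) hn
      have c2 := (sq_rpow_mul_slowWeight_le hp.beta_lt hε (-γ) hy).trans
        (mul_le_mul_of_nonneg_right (le_max_right 1 _) (by positivity))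
      calc _ ≤ K * ‖y‖ ^ (-(σ / (1 - m))) * (B * ‖y‖ ^ (-γ - ((d : ℝ) - 2 - β))) :=
            mul_le_mul c1 c2 hw0 (by positivity)
        _ = K * B * (‖y‖ ^ (-(σ / (1 - m))) * ‖y‖ ^ (-γ - ((d : ℝ) - 2 - β))) := by ring
        _ = _ := by rw [← Real.rpow_add hny]; congr 2; ring

theorem exists_integral_rpow_mul_le {d : ℕ} {m β γ ε : ℝ} (hd : 0 < d) (hp : Admissible d m β γ)
    (hε : 0 < ε) (M : ℝ) :
    ∃ A, ∀ V : E d → ℝ, AEStronglyMeasurable V → (∀ᵐ y, 0 ≤ V y ∧ V y ≤ M) →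
      Integrable (fun y => V y * ((‖y‖ ^ 2) ^ (-γ / 2) * slowWeight d β ε (‖y‖ ^ 2))) →
      Integrable (fun y => V y ^ m * ((‖y‖ ^ 2) ^ (-β / 2 - 1) * slowWeight d β ε (‖y‖ ^ 2))) ∧
      ∫ y, V y ^ m * ((‖y‖ ^ 2) ^ (-β / 2 - 1) * slowWeight d β ε (‖y‖ ^ 2)) ≤
        A + ∫ y, V y * ((‖y‖ ^ 2) ^ (-γ / 2) * slowWeight d β ε (‖y‖ ^ 2)) := by
  have hm0 := hp.m_pos
  have h1m : 0 < 1 - m := by linarith [hp.m_lt_one]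
  set D := max (|M| ^ m) (ε ^ (-(((d : ℝ) - 2 - β) / 2))) with hD
  have hD0 : 0 ≤ D := le_max_of_le_left (by positivity)
  set κ := (β + 2 - γ * m) / (1 - m) with hκ
  have hint : Integrable fun y : E d => D * radialBound d (β + 2) (κ + ((d : ℝ) - 2 - β)) y := by
    refine (integrable_radialBound hd (by linarith [hp.beta_lt]) ?_).const_mul _
    have : β + 2 < κ := by
      rw [hκ, lt_div_iff₀ h1m]; nlinarith [mul_pos hm0 hp.sigma_pos]
    linarith
  refine ⟨∫ y : E d, D * radialBound d (β + 2) (κ + ((d : ℝ) - 2 - β)) y, fun V hV hb hi => ?_⟩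
  have hle : ∀ᵐ y, V y ^ m * ((‖y‖ ^ 2) ^ (-β / 2 - 1) * slowWeight d β ε (‖y‖ ^ 2)) ≤
      D * radialBound d (β + 2) (κ + ((d : ℝ) - 2 - β)) y +
        V y * ((‖y‖ ^ 2) ^ (-γ / 2) * slowWeight d β ε (‖y‖ ^ 2)) := by
    filter_upwards [hb, ae_ne_zero hd] with y hy hy0
    have hny : 0 < ‖y‖ := norm_pos_iff.2 hy0
    have hs : 0 < ‖y‖ ^ 2 := by positivity
    have hw : 0 < slowWeight d β ε (‖y‖ ^ 2) := slowWeight_pos hε (by positivity)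
    have hV0 := hy.1
    have hX : 0 ≤ V y * ((‖y‖ ^ 2) ^ (-γ / 2) * slowWeight d β ε (‖y‖ ^ 2)) := by positivity
    have e1 : (‖y‖ ^ 2) ^ (-β / 2 - 1) = ‖y‖ ^ (-(β + 2)) := by
      rw [norm_rpow_eq_sq_rpow]; congr 1; ring
    rw [radialBound]
    split_ifs with hlt
    · have c1 : V y ^ m ≤ D := (Real.rpow_le_rpow hV0 (hy.2.trans (le_abs_self M)) hm0.le).trans
        (le_max_left _ _)
      have c2 : (‖y‖ ^ 2) ^ (-β / 2 - 1) * slowWeight d β ε (‖y‖ ^ 2) ≤ ‖y‖ ^ (-(β + 2)) := by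
        rw [e1]
        exact mul_le_of_le_one_right (by positivity)
          (slowWeight_le_one hp.beta_lt hε (by positivity))
      have := mul_le_mul c1 c2 (by positivity) hD0
      linarith
    · have young := Real.geom_mean_le_arith_mean2_weighted (w₁ := m) (w₂ := 1 - m) hm0.le h1m.le hX
        (p₂ := (‖y‖ ^ 2) ^ (-κ / 2) * slowWeight d β ε (‖y‖ ^ 2)) (by positivity) (by ring)
      have c2 := (sq_rpow_mul_slowWeight_le hp.beta_lt hε (-κ) hy0).trans
        (mul_le_mul_of_nonneg_right (le_max_right (|M| ^ m) _) (by positivity))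
      have e2 : ‖y‖ ^ (-(κ + ((d : ℝ) - 2 - β))) = ‖y‖ ^ (-κ - ((d : ℝ) - 2 - β)) := by
        congr 1; ring
      rw [e2]
      have e3 : (V y * ((‖y‖ ^ 2) ^ (-γ / 2) * slowWeight d β ε (‖y‖ ^ 2))) ^ m *
          ((‖y‖ ^ 2) ^ (-κ / 2) * slowWeight d β ε (‖y‖ ^ 2)) ^ (1 - m) =
          V y ^ m * ((‖y‖ ^ 2) ^ (-β / 2 - 1) * slowWeight d β ε (‖y‖ ^ 2)) := by
        rw [Real.mul_rpow hV0 (by positivity), Real.mul_rpow (by positivity) hw.le,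
          Real.mul_rpow (by positivity) hw.le, ← Real.rpow_mul hs.le, ← Real.rpow_mul hs.le]
        have e4 : (‖y‖ ^ 2) ^ (-β / 2 - 1) =
            (‖y‖ ^ 2) ^ (-γ / 2 * m) * (‖y‖ ^ 2) ^ (-κ / 2 * (1 - m)) := by
          rw [← Real.rpow_add hs]; congr 1; rw [hκ]; field_simp; ring
        have e5 : slowWeight d β ε (‖y‖ ^ 2) =
            slowWeight d β ε (‖y‖ ^ 2) ^ m * slowWeight d β ε (‖y‖ ^ 2) ^ (1 - m) := by
          rw [← Real.rpow_add hw]; simp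
        conv_rhs => rw [e4, e5]
        ring
      rw [e3] at young
      have hY : 0 ≤ (‖y‖ ^ 2) ^ (-κ / 2) * slowWeight d β ε (‖y‖ ^ 2) := by positivity
      nlinarith
  have hi2 : Integrable fun y => V y ^ m *
      ((‖y‖ ^ 2) ^ (-β / 2 - 1) * slowWeight d β ε (‖y‖ ^ 2)) := by
    refine (hint.add hi).mono' (((Real.continuous_rpow_const hm0.le).comp_aestronglyMeasurable
      hV).mul (measurable_weight_mul_slowWeight _ _ _).aestronglyMeasurable) ?_
    filter_upwards [hle, hb] with y h1 h2
    have := h2.1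
    have hw : 0 < slowWeight d β ε (‖y‖ ^ 2) := slowWeight_pos hε (by positivity)
    rw [Real.norm_of_nonneg (by positivity)]
    exact h1
  refine ⟨hi2, ?_⟩
  rw [← integral_add hint hi]
  exact integral_mono_ae hi2 (hint.add hi) hle


/-- The weight of the `L¹` contraction. -/
noncomputable abbrev contrWeight (d : ℕ) (β γ ε : ℝ) (y : E d) : ℝ :=
  (‖y‖ ^ 2) ^ (-γ / 2) * slowWeight d β ε (‖y‖ ^ 2)

theorem contrWeight_nonneg {d : ℕ} {β γ ε : ℝ} (hε : 0 < ε) (y : E d) :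
    0 ≤ contrWeight d β γ ε y := by
  have := slowWeight_pos (d := d) (β := β) hε (by positivity : 0 ≤ ‖y‖ ^ 2)
  positivity

theorem contrWeight_le {d : ℕ} {β γ ε : ℝ} (hβ : β < d - 2) (hε : 0 < ε) (y : E d) :
    contrWeight d β γ ε y ≤ ‖y‖ ^ (-γ) := by
  rw [norm_rpow_eq_sq_rpow]
  exact mul_le_of_le_one_right (by positivity) (slowWeight_le_one hβ hε (by positivity))

theorem contrWeight_pos {d : ℕ} {β γ ε : ℝ} (hε : 0 < ε) {y : E d} (hy : y ≠ 0) :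
    0 < contrWeight d β γ ε y := by
  have := slowWeight_pos (d := d) (β := β) hε (by positivity : 0 ≤ ‖y‖ ^ 2)
  have : 0 < ‖y‖ := norm_pos_iff.2 hy
  positivity

theorem MemL1w.mul_contrWeight {d : ℕ} {β γ ε : ℝ} (hβ : β < d - 2) (hε : 0 < ε) {f : E d → ℝ}
    (hf : MemL1w γ f) : Integrable fun y => f y * contrWeight d β γ ε y := by
  have h1 : Integrable fun y => f y * ‖y‖ ^ (-γ) * slowWeight d β ε (‖y‖ ^ 2) := by
    refine Integrable.mul_bdd (c := 1) hf
      (measurable_slowWeight.comp (measurable_norm.pow_const 2)).aestronglyMeasurable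
      (Eventually.of_forall fun y => ?_)
    rw [Real.norm_of_nonneg (slowWeight_pos hε (by positivity)).le]
    exact slowWeight_le_one hβ hε (by positivity)
  refine h1.congr (Eventually.of_forall fun y => ?_)
  simp only [contrWeight]
  rw [norm_rpow_eq_sq_rpow, mul_assoc]

theorem MemL1w.aestronglyMeasurable {d : ℕ} (hd : 0 < d) {γ : ℝ} {f : E d → ℝ}
    (hf : MemL1w γ f) : AEStronglyMeasurable f := by
  have hpm : Measurable fun y : E d => ‖y‖ ^ γ := measurable_norm.pow_const γ
  refine (hf.1.mul hpm.aestronglyMeasurable).congr ?_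
  filter_upwards [ae_ne_zero hd] with y hy
  have h3 : 0 < ‖y‖ := norm_pos_iff.2 hy
  simp only [Pi.mul_apply]
  rw [mul_assoc, ← Real.rpow_add h3]
  simp

theorem integrable_barenblatt_mul_contrWeight {d : ℕ} {m β γ C T t ε : ℝ} (hd : 0 < d)
    (hp : Admissible d m β γ) (h : ValidTime d m β γ T t) (hC : 0 < C) (hε : 0 < ε) :
    Integrable fun y : E d => barenblatt d m β γ C T t y * contrWeight d β γ ε y := by
  obtain ⟨H, hH, hle⟩ := exists_integrable_barenblatt_mul_le hd hp h hC hε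
  refine hH.mono' ((continuous_barenblatt hp h hC).aestronglyMeasurable.mul
    (measurable_weight_mul_slowWeight _ _ _).aestronglyMeasurable) ?_
  filter_upwards [ae_ne_zero hd] with y hy
  rw [Real.norm_of_nonneg (mul_nonneg (barenblatt_nonneg hp h hC y) (contrWeight_nonneg hε y))]
  exact hle t ⟨h.nonneg, le_rfl⟩ y hy

theorem exists_barenblatt_flux_bound {d : ℕ} {m β γ C T t ε : ℝ} (hd : 0 < d)
    (hp : Admissible d m β γ) (h : ValidTime d m β γ T t) (hC : 0 < C) (hε : 0 < ε) :
    ∃ N, ∀ s ∈ Icc 0 t,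
      Integrable (fun y : E d => barenblatt d m β γ C T s y ^ m *
        ((‖y‖ ^ 2) ^ (-β / 2 - 1) * slowWeight d β ε (‖y‖ ^ 2))) ∧
      ∫ y : E d, barenblatt d m β γ C T s y ^ m *
        ((‖y‖ ^ 2) ^ (-β / 2 - 1) * slowWeight d β ε (‖y‖ ^ 2)) ≤ N := by
  obtain ⟨H, hH, hle⟩ := exists_integrable_barenblatt_mul_le hd hp h hC hε
  obtain ⟨M, -, hM⟩ := exists_barenblatt_le (d := d) hp h hC
  obtain ⟨A, hA⟩ := exists_integral_rpow_mul_le hd hp hε M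
  refine ⟨A + ∫ y, H y, fun s hs => ?_⟩
  have hi := integrable_barenblatt_mul_contrWeight hd hp (h.mono hs) hC hε
  obtain ⟨h1, h2⟩ := hA _ (continuous_barenblatt hp (h.mono hs) hC).aestronglyMeasurable
    (Eventually.of_forall fun y => ⟨barenblatt_nonneg hp (h.mono hs) hC y, hM s hs y⟩) hi
  refine ⟨h1, h2.trans (add_le_add le_rfl (integral_mono_ae hi hH ?_))⟩
  filter_upwards [ae_ne_zero hd] with y hy using hle s hs y hy

namespace IsStrongSolution

variable {d : ℕ} {m β γ : ℝ} {v₀ : E d → ℝ} {v : ℝ → E d → ℝ}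

theorem exists_integral_le (h : IsStrongSolution m β γ v₀ v) (t : ℝ) :
    ∃ N, ∀ s ∈ Icc 0 t, ∫ y, v s y * ‖y‖ ^ (-γ) ≤ N := by
  have hc : ContinuousOn (fun s => ∫ y, v s y * ‖y‖ ^ (-γ)) (Icc 0 t) := by
    intro τ hτ
    refine ContinuousWithinAt.mono ?_ (fun x hx => hx.1 : Icc 0 t ⊆ Ici 0)
    refine tendsto_iff_norm_sub_tendsto_zero.2 ?_
    refine squeeze_zero' (Eventually.of_forall fun s => norm_nonneg _) ?_ (h.continuous τ hτ.1)
    filter_upwards [self_mem_nhdsWithin] with s hs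
    rw [← integral_sub (h.memL1w s hs) (h.memL1w τ hτ.1)]
    refine (norm_integral_le_integral_norm _).trans_eq ?_
    congr 1; ext1 y
    rw [← sub_mul, norm_mul, Real.norm_eq_abs, Real.norm_of_nonneg (by positivity)]
  obtain ⟨N, hN⟩ := isCompact_Icc.exists_bound_of_continuousOn hc
  exact ⟨N, fun s hs => (le_abs_self _).trans (hN s hs)⟩

theorem exists_flux_weight_bound (hd : 0 < d) (hp : Admissible d m β γ)
    (h : IsStrongSolution m β γ v₀ v) (t : ℝ) {ε : ℝ} (hε : 0 < ε) :
    ∃ N, ∀ᵐ s ∂(volume.restrict (Ioc 0 t)),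
      Integrable (fun y => v s y ^ m * ((‖y‖ ^ 2) ^ (-β / 2 - 1) *
        slowWeight d β ε (‖y‖ ^ 2))) ∧
      ∫ y, v s y ^ m * ((‖y‖ ^ 2) ^ (-β / 2 - 1) * slowWeight d β ε (‖y‖ ^ 2)) ≤ N := by
  obtain ⟨g, G, hl⟩ := h.exists_isLocalStrongSolution hp.m_pos
  obtain ⟨M, hM⟩ := (hl t).bdd
  obtain ⟨A, hA⟩ := exists_integral_rpow_mul_le hd hp hε M
  obtain ⟨N, hN⟩ := h.exists_integral_le t
  refine ⟨A + N, ?_⟩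
  filter_upwards [hM, ae_restrict_mem measurableSet_Ioc] with s h1 hs
  have hi := (h.memL1w s hs.1.le).mul_contrWeight hp.beta_lt hε
  obtain ⟨h2, h3⟩ := hA _ ((h.memL1w s hs.1.le).aestronglyMeasurable hd)
    (by filter_upwards [h1, h.nonneg s hs.1.le] with y e1 e2 using ⟨e2, e1⟩) hi
  refine ⟨h2, h3.trans (add_le_add le_rfl (le_trans ?_ (hN s (Ioc_subset_Icc_self hs))))⟩
  refine integral_mono_ae hi (h.memL1w s hs.1.le) ?_
  filter_upwards [h.nonneg s hs.1.le] with y hy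
  exact mul_le_mul_of_nonneg_left (contrWeight_le hp.beta_lt hε y) hy

variable {C T t ε : ℝ}

theorem integrable_sub_barenblatt (hd : 0 < d) (hp : Admissible d m β γ)
    (h : IsStrongSolution m β γ v₀ v) (ht : ValidTime d m β γ T t) (hC : 0 < C) (hε : 0 < ε) :
    Integrable fun y => (v t y - barenblatt d m β γ C T t y) * contrWeight d β γ ε y := by
  simp_rw [sub_mul]
  exact ((h.memL1w t ht.nonneg).mul_contrWeight hp.beta_lt hε).sub
    (integrable_barenblatt_mul_contrWeight hd hp ht hC hε)

theorem contraction_barenblatt (hd : 0 < d) (hp : Admissible d m β γ)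
    (h : IsStrongSolution m β γ v₀ v) (ht : ValidTime d m β γ T t) (hC : 0 < C) (hε : 0 < ε) :
    (∫ y, max ((v t y - barenblatt d m β γ C T t y) * contrWeight d β γ ε y) 0 ≤
      ∫ y, max ((v 0 y - barenblatt d m β γ C T 0 y) * contrWeight d β γ ε y) 0) ∧
    ∫ y, max ((barenblatt d m β γ C T t y - v t y) * contrWeight d β γ ε y) 0 ≤
      ∫ y, max ((barenblatt d m β γ C T 0 y - v 0 y) * contrWeight d β γ ε y) 0 := by
  rcases ht.nonneg.eq_or_lt with rfl | ht0
  · exact ⟨le_rfl, le_rfl⟩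
  have h00 : ValidTime d m β γ T 0 := ht.mono ⟨le_rfl, ht0.le⟩
  obtain ⟨g, G, hl⟩ := h.exists_isLocalStrongSolution hp.m_pos
  obtain ⟨g', G', hl'⟩ := exists_isLocalStrongSolution_barenblatt (d := d) hp ht ht0 hC
  obtain ⟨K, hK, hslow⟩ := exists_isSlow_slowWeight (d := d) hp.beta_lt hε
  obtain ⟨N, hN⟩ := h.exists_flux_weight_bound hd hp t hε
  obtain ⟨N', hN'⟩ := exists_barenblatt_flux_bound hd hp ht hC hε
  have hF0 : ∀ s : ℝ, 0 < s → 0 ≤ slowWeight d β ε s := fun s hs => (slowWeight_pos hε hs.le).le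
  have hL : ∀ s, 0 < s → radL d β (slowWeight d β ε) s ≤ 0 := fun s hs =>
    radL_one_add_mul_rpow_nonpos hp.beta_lt hε hs
  have hneg : ∀ s, Integrable (fun y => (v s y - barenblatt d m β γ C T s y) *
      contrWeight d β γ ε y) → Integrable fun y => (barenblatt d m β γ C T s y - v s y) *
      contrWeight d β γ ε y := fun s hs => hs.neg.congr (Eventually.of_forall fun y => by
    simp only [Pi.neg_apply]; ring)
  have i0 := h.integrable_sub_barenblatt hd hp h00 hC hε
  have i1 := h.integrable_sub_barenblatt hd hp ht hC hε
  constructor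
  · refine (hl t).contraction_of_isSlow hd hp.m_pos hp.m_lt_one hl' ht0 hK hslow hF0 hL i0 i1
      ⟨N + N', ?_⟩
    filter_upwards [hN, ae_restrict_mem measurableSet_Ioc] with s h1 hs
    have h2 := hN' s (Ioc_subset_Icc_self hs)
    simp_rw [add_mul]
    refine ⟨h1.1.add h2.1, ?_⟩
    rw [integral_add h1.1 h2.1]
    exact add_le_add h1.2 h2.2
  · refine hl'.contraction_of_isSlow hd hp.m_pos hp.m_lt_one (hl t) ht0 hK hslow hF0 hL
      (hneg 0 i0) (hneg t i1) ⟨N' + N, ?_⟩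
    filter_upwards [hN, ae_restrict_mem measurableSet_Ioc] with s h1 hs
    have h2 := hN' s (Ioc_subset_Icc_self hs)
    simp_rw [add_mul]
    refine ⟨h2.1.add h1.1, ?_⟩
    rw [integral_add h2.1 h1.1]
    exact add_le_add h2.2 h1.2

theorem contraction_abs_barenblatt (hd : 0 < d) (hp : Admissible d m β γ)
    (h : IsStrongSolution m β γ v₀ v) (ht : ValidTime d m β γ T t) (hC : 0 < C) (hε : 0 < ε) :
    ∫ y, |v t y - barenblatt d m β γ C T t y| * contrWeight d β γ ε y ≤
      ∫ y, |v 0 y - barenblatt d m β γ C T 0 y| * contrWeight d β γ ε y := by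
  have key : ∀ s, ValidTime d m β γ T s →
      ∫ y, |v s y - barenblatt d m β γ C T s y| * contrWeight d β γ ε y =
      (∫ y, max ((v s y - barenblatt d m β γ C T s y) * contrWeight d β γ ε y) 0) +
      ∫ y, max ((barenblatt d m β γ C T s y - v s y) * contrWeight d β γ ε y) 0 := by
    intro s hs
    have i1 := h.integrable_sub_barenblatt hd hp hs hC hε
    have i2 : Integrable fun y => (barenblatt d m β γ C T s y - v s y) * contrWeight d β γ ε y :=
      i1.neg.congr (Eventually.of_forall fun y => by simp only [Pi.neg_apply]; ring)
    rw [← integral_add i1.pos_part i2.pos_part]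
    congr 1; ext1 y
    have hw := contrWeight_nonneg (d := d) (β := β) (γ := γ) hε y
    rcases le_total (v s y) (barenblatt d m β γ C T s y) with hle | hle
    · rw [abs_of_nonpos (by linarith), max_eq_right, max_eq_left]
      · ring
      · exact mul_nonneg (by linarith) hw
      · exact mul_nonpos_of_nonpos_of_nonneg (by linarith) hw
    · rw [abs_of_nonneg (by linarith), max_eq_left, max_eq_right]
      · ring
      · exact mul_nonpos_of_nonpos_of_nonneg (by linarith) hw
      · exact mul_nonneg (by linarith) hw
  rw [key t ht, key 0 (ht.mono ⟨le_rfl, ht.nonneg⟩)]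
  obtain ⟨h1, h2⟩ := h.contraction_barenblatt hd hp ht hC hε
  exact add_le_add h1 h2

theorem le_barenblatt (hd : 0 < d) (hp : Admissible d m β γ)
    (h : IsStrongSolution m β γ v₀ v) (ht : ValidTime d m β γ T t) (hC : 0 < C)
    (h0 : ∀ᵐ y, v₀ y ≤ barenblatt d m β γ C T 0 y) :
    ∀ᵐ y, v t y ≤ barenblatt d m β γ C T t y := by
  have h1 := (h.contraction_barenblatt hd hp ht hC one_pos).1
  have h2 : ∫ y, max ((v 0 y - barenblatt d m β γ C T 0 y) * contrWeight d β γ 1 y) 0 = 0 := by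
    refine integral_eq_zero_of_ae ?_
    filter_upwards [h0, h.initial] with y e1 e2
    refine max_eq_right (mul_nonpos_of_nonpos_of_nonneg (by linarith)
      (contrWeight_nonneg one_pos y))
  rw [h2] at h1
  have h3 := (integral_eq_zero_iff_of_nonneg (fun y => le_max_right _ _)
    (h.integrable_sub_barenblatt hd hp ht hC one_pos).pos_part).1
    (h1.antisymm (integral_nonneg fun y => le_max_right _ _))
  filter_upwards [h3, ae_ne_zero hd] with y e1 hy
  by_contra hlt
  have := mul_pos (sub_pos.2 (not_le.1 hlt)) (contrWeight_pos (β := β) (γ := γ) one_pos hy)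
  simp only [Pi.zero_apply] at e1
  have := le_max_left ((v t y - barenblatt d m β γ C T t y) * contrWeight d β γ 1 y) 0
  linarith

end IsStrongSolution


/-- A solution together with an approximating sequence, under the assumptions on the initial
datum. -/
structure ApproximatedSolution (d : ℕ) (m β γ T C₁ C₂ C : ℝ) (u₀ f : E d → ℝ) (u : ℝ → E d → ℝ)
    (φ : E d → ℝ) (v : ℕ → ℝ → E d → ℝ) : Prop where
  dim_pos : 0 < d
  admissible : Admissible d m β γ
  C₁_pos : 0 < C₁
  C₂_pos : 0 < C₂
  C_pos : 0 < C
  lower : ∀ᵐ y, barenblatt d m β γ C₁ T 0 y ≤ u₀ y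
  upper : ∀ᵐ y, u₀ y ≤ barenblatt d m β γ C₂ T 0 y
  memL1w : MemL1w γ f
  initial_eq : ∀ᵐ y, u₀ y = barenblatt d m β γ C T 0 y + f y
  memL1wLoc : ∀ τ, 0 ≤ τ → MemL1wLoc γ (u τ)
  truncation : IsTruncation φ
  strong : ∀ n : ℕ, 1 ≤ n → IsStrongSolution m β γ (fun y => φ ((n : ℝ)⁻¹ • y) * u₀ y) (v n)
  tendsto : ∀ τ, 0 ≤ τ → TendstoL1wLoc γ (fun n => v n τ) atTop (u τ)

theorem IsTruncation.tendsto_one {d : ℕ} {φ : E d → ℝ} (h : IsTruncation φ) (y : E d) :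
    ∀ᶠ n : ℕ in atTop, φ ((n : ℝ)⁻¹ • y) = 1 := by
  filter_upwards [tendsto_natCast_atTop_atTop.eventually_ge_atTop (‖y‖ + 1)] with n hn
  refine h.eq_one _ ?_
  have : 0 < (n : ℝ) := by linarith [norm_nonneg y]
  rw [norm_smul, norm_inv, Real.norm_of_nonneg this.le, inv_mul_eq_div, div_le_one this]
  linarith

namespace ApproximatedSolution

variable {d : ℕ} {m β γ T C₁ C₂ C : ℝ} {u₀ f : E d → ℝ} {u : ℝ → E d → ℝ}
  {φ : E d → ℝ} {v : ℕ → ℝ → E d → ℝ}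

theorem validTime_zero {t : ℝ} (ht : ValidTime d m β γ T t) : ValidTime d m β γ T 0 :=
  ht.mono ⟨le_rfl, ht.nonneg⟩

variable (S : ApproximatedSolution d m β γ T C₁ C₂ C u₀ f u φ v)
include S

theorem initial_nonneg {t : ℝ} (ht : ValidTime d m β γ T t) : ∀ᵐ y, 0 ≤ u₀ y := by
  filter_upwards [S.lower] with y hy
  exact (barenblatt_nonneg S.admissible (validTime_zero ht) S.C₁_pos y).trans hy

theorem approx_initial_bounds {t : ℝ} (ht : ValidTime d m β γ T t) {n : ℕ} (hn : 1 ≤ n) :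
    ∀ᵐ y, v n 0 y = φ ((n : ℝ)⁻¹ • y) * u₀ y ∧ 0 ≤ v n 0 y ∧
      v n 0 y ≤ barenblatt d m β γ C₂ T 0 y := by
  filter_upwards [(S.strong n hn).initial, S.initial_nonneg ht, S.upper] with y h1 h2 h3
  rw [h1]
  exact ⟨rfl, mul_nonneg (S.truncation.nonneg _) h2,
    (mul_le_of_le_one_left h2 (S.truncation.le_one _)).trans h3⟩

theorem approx_le {t : ℝ} (ht : ValidTime d m β γ T t) {n : ℕ} (hn : 1 ≤ n) :
    ∀ᵐ y, v n t y ≤ barenblatt d m β γ C₂ T t y := by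
  refine (S.strong n hn).le_barenblatt S.dim_pos S.admissible ht S.C₂_pos ?_
  filter_upwards [(S.strong n hn).initial, S.approx_initial_bounds ht hn] with y h1 h2
  rw [← h1]
  exact h2.2.2

theorem tendsto_integral_initial {t : ℝ} (ht : ValidTime d m β γ T t) {C' ε : ℝ} (hC' : 0 < C')
    (hε : 0 < ε) {Θ : ℝ → ℝ} (hΘ : Continuous Θ) (hΘ1 : ∀ x, |Θ x| ≤ |x|) :
    Tendsto (fun n : ℕ => ∫ y, Θ ((v n 0 y - barenblatt d m β γ C' T 0 y) * contrWeight d β γ ε y))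
      atTop (𝓝 (∫ y, Θ ((u₀ y - barenblatt d m β γ C' T 0 y) * contrWeight d β γ ε y))) := by
  have h0 := validTime_zero ht
  have i2 := integrable_barenblatt_mul_contrWeight (t := 0) S.dim_pos S.admissible h0 S.C₂_pos hε
  have i' := integrable_barenblatt_mul_contrWeight (t := 0) S.dim_pos S.admissible h0 hC' hε
  have hall : ∀ᵐ y, ∀ n : ℕ, 1 ≤ n → v n 0 y = φ ((n : ℝ)⁻¹ • y) * u₀ y ∧ 0 ≤ v n 0 y ∧
      v n 0 y ≤ barenblatt d m β γ C₂ T 0 y := by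
    rw [ae_all_iff]
    intro n
    by_cases hn : 1 ≤ n
    · filter_upwards [S.approx_initial_bounds ht hn] with y hy using fun _ => hy
    · exact Eventually.of_forall fun y h => absurd h hn
  refine tendsto_integral_filter_of_dominated_convergence _ ?_ ?_ (i2.add i') ?_
  · filter_upwards [eventually_ge_atTop 1] with n hn
    exact hΘ.comp_aestronglyMeasurable
      ((S.strong n hn).integrable_sub_barenblatt S.dim_pos S.admissible h0 hC' hε).1
  · filter_upwards [eventually_ge_atTop 1] with n hn
    filter_upwards [S.approx_initial_bounds ht hn] with y hy
    have hw := contrWeight_nonneg (d := d) (β := β) (γ := γ) hε y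
    have hb := barenblatt_nonneg S.admissible h0 hC' y
    refine (hΘ1 _).trans ?_
    rw [abs_mul, abs_of_nonneg hw, Pi.add_apply, ← add_mul]
    refine mul_le_mul_of_nonneg_right ?_ hw
    rw [abs_le]; constructor <;> linarith [hy.2.1, hy.2.2]
  · filter_upwards [hall] with y hy
    refine tendsto_const_nhds.congr' ?_
    filter_upwards [eventually_ge_atTop 1, S.truncation.tendsto_one y] with n hn h1
    rw [(hy n hn).1, h1, one_mul]

theorem integrableOn_sub_barenblatt {t : ℝ} (ht : ValidTime d m β γ T t) {C' ε : ℝ} (hC' : 0 < C')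
    (hε : 0 < ε) (r : ℝ) :
    IntegrableOn (fun y => (u t y - barenblatt d m β γ C' T t y) * contrWeight d β γ ε y)
      (Metric.ball 0 r) := by
  have h1 : IntegrableOn (fun y => u t y * ‖y‖ ^ (-γ) * slowWeight d β ε (‖y‖ ^ 2))
      (Metric.ball 0 r) := by
    refine Integrable.mul_bdd (c := 1) (S.memL1wLoc t ht.nonneg r)
      (measurable_slowWeight.comp (measurable_norm.pow_const 2)).aestronglyMeasurable
      (Eventually.of_forall fun y => ?_)
    rw [Real.norm_of_nonneg (slowWeight_pos hε (by positivity)).le]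
    exact slowWeight_le_one S.admissible.beta_lt hε (by positivity)
  have h2 := (integrable_barenblatt_mul_contrWeight S.dim_pos S.admissible ht hC' hε).integrableOn
    (s := Metric.ball 0 r)
  refine (h1.sub h2).congr (Eventually.of_forall fun y => ?_)
  simp only [Pi.sub_apply, contrWeight]
  rw [norm_rpow_eq_sq_rpow]
  ring

theorem integral_ball_le {t : ℝ} (ht : ValidTime d m β γ T t) {C' ε : ℝ} (hC' : 0 < C')
    (hε : 0 < ε) {Θ : ℝ → ℝ} (hΘ : Continuous Θ) (hΘ0 : ∀ x, 0 ≤ Θ x) (hΘ1 : ∀ x, |Θ x| ≤ |x|)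
    (hΘ2 : ∀ x y, Θ x ≤ Θ y + |y - x|)
    (hcon : ∀ n, 1 ≤ n →
      ∫ y, Θ ((v n t y - barenblatt d m β γ C' T t y) * contrWeight d β γ ε y) ≤
        ∫ y, Θ ((v n 0 y - barenblatt d m β γ C' T 0 y) * contrWeight d β γ ε y)) (r : ℝ) :
    ∫ y in Metric.ball 0 r, Θ ((u t y - barenblatt d m β γ C' T t y) * contrWeight d β γ ε y) ≤
      ∫ y, Θ ((u₀ y - barenblatt d m β γ C' T 0 y) * contrWeight d β γ ε y) := by
  have l1 := (S.tendsto_integral_initial ht hC' hε hΘ hΘ1).add (S.tendsto t ht.nonneg r)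
  rw [add_zero] at l1
  have hint : ∀ {q : E d → ℝ} {μ : Measure (E d)}, Integrable q μ →
      Integrable (fun y => Θ (q y)) μ := fun hq =>
    hq.abs.mono' (hΘ.comp_aestronglyMeasurable hq.1) (Eventually.of_forall fun y => hΘ1 _)
  refine ge_of_tendsto l1 ?_
  filter_upwards [eventually_ge_atTop 1] with n hn
  have iu := hint (S.integrableOn_sub_barenblatt ht hC' hε r)
  have iv := hint ((S.strong n hn).integrable_sub_barenblatt S.dim_pos S.admissible ht hC' hε)
  have id : IntegrableOn (fun y => |v n t y - u t y| * ‖y‖ ^ (-γ)) (Metric.ball 0 r) := by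
    refine ((((S.strong n hn).memL1w t ht.nonneg).integrableOn).sub
      (S.memL1wLoc t ht.nonneg r)).abs.congr (Eventually.of_forall fun y => ?_)
    simp only [Pi.sub_apply]
    rw [← sub_mul, abs_mul, abs_of_nonneg (a := ‖y‖ ^ (-γ)) (by positivity)]
  calc _ ≤ ∫ y in Metric.ball 0 r,
          (Θ ((v n t y - barenblatt d m β γ C' T t y) * contrWeight d β γ ε y) +
          |v n t y - u t y| * ‖y‖ ^ (-γ)) := by
        refine integral_mono iu (iv.integrableOn.add id) fun y => ?_
        refine (hΘ2 _ _).trans (add_le_add le_rfl ?_)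
        rw [← sub_mul, abs_mul, abs_of_nonneg (contrWeight_nonneg hε y), sub_sub_sub_cancel_right]
        exact mul_le_mul_of_nonneg_left (contrWeight_le S.admissible.beta_lt hε y) (abs_nonneg _)
    _ = (∫ y in Metric.ball 0 r,
          Θ ((v n t y - barenblatt d m β γ C' T t y) * contrWeight d β γ ε y)) +
          ∫ y in Metric.ball 0 r, |v n t y - u t y| * ‖y‖ ^ (-γ) :=
        integral_add iv.integrableOn id
    _ ≤ _ := add_le_add ((setIntegral_le_integral iv (Eventually.of_forall fun y => hΘ0 _)).trans
        (hcon n hn)) le_rfl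

theorem ae_eq_zero_of_initial {t : ℝ} (ht : ValidTime d m β γ T t) {C' : ℝ} (hC' : 0 < C')
    {Θ : ℝ → ℝ} (hΘ : Continuous Θ) (hΘ0 : ∀ x, 0 ≤ Θ x) (hΘ1 : ∀ x, |Θ x| ≤ |x|)
    (hΘ2 : ∀ x y, Θ x ≤ Θ y + |y - x|)
    (hcon : ∀ n, 1 ≤ n →
      ∫ y, Θ ((v n t y - barenblatt d m β γ C' T t y) * contrWeight d β γ 1 y) ≤
        ∫ y, Θ ((v n 0 y - barenblatt d m β γ C' T 0 y) * contrWeight d β γ 1 y))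
    (h0 : ∀ᵐ y, Θ ((u₀ y - barenblatt d m β γ C' T 0 y) * contrWeight d β γ 1 y) = 0) :
    ∀ᵐ y, Θ ((u t y - barenblatt d m β γ C' T t y) * contrWeight d β γ 1 y) = 0 := by
  have hr : ∀ r : ℕ, ∀ᵐ y ∂(volume.restrict (Metric.ball (0 : E d) r)),
      Θ ((u t y - barenblatt d m β γ C' T t y) * contrWeight d β γ 1 y) = 0 := by
    intro r
    have h1 := S.integral_ball_le ht hC' one_pos hΘ hΘ0 hΘ1 hΘ2 hcon r
    rw [integral_eq_zero_of_ae h0] at h1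
    have hi := S.integrableOn_sub_barenblatt ht hC' one_pos r
    have hi' : IntegrableOn (fun y => Θ ((u t y - barenblatt d m β γ C' T t y) *
        contrWeight d β γ 1 y)) (Metric.ball 0 r) :=
      hi.abs.mono' (hΘ.comp_aestronglyMeasurable hi.1) (Eventually.of_forall fun y => hΘ1 _)
    exact (integral_eq_zero_iff_of_nonneg (fun y => hΘ0 _) hi').1
      (h1.antisymm (integral_nonneg fun y => hΘ0 _))
  rw [← Measure.restrict_univ (μ := (volume : Measure (E d))), ← Metric.iUnion_ball_nat 0,
    ae_restrict_iUnion_iff]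
  exact hr

theorem le_barenblatt {t : ℝ} (ht : ValidTime d m β γ T t) :
    ∀ᵐ y, u t y ≤ barenblatt d m β γ C₂ T t y := by
  have key := S.ae_eq_zero_of_initial ht S.C₂_pos (Θ := fun x => max x 0) (by fun_prop)
    (fun x => le_max_right _ _) abs_max_zero_le
    (fun x y => by
      refine max_le ?_ (by positivity)
      have := le_max_left y 0
      linarith [neg_abs_le (y - x)])
    (fun n hn => ((S.strong n hn).contraction_barenblatt S.dim_pos S.admissible ht S.C₂_pos
      one_pos).1) (by
      filter_upwards [S.upper] with y hy
      exact max_eq_right (mul_nonpos_of_nonpos_of_nonneg (by linarith)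
        (contrWeight_nonneg one_pos y)))
  filter_upwards [key, ae_ne_zero S.dim_pos] with y h1 hy
  by_contra hlt
  have := mul_pos (sub_pos.2 (not_le.1 hlt)) (contrWeight_pos (β := β) (γ := γ) one_pos hy)
  have := le_max_left ((u t y - barenblatt d m β γ C₂ T t y) * contrWeight d β γ 1 y) 0
  linarith

theorem barenblatt_le {t : ℝ} (ht : ValidTime d m β γ T t) :
    ∀ᵐ y, barenblatt d m β γ C₁ T t y ≤ u t y := by
  have hrw : ∀ (a b w : ℝ), max ((a - b) * w) 0 = max (-((b - a) * w)) 0 := by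
    intro a b w; congr 1; ring
  have key := S.ae_eq_zero_of_initial ht S.C₁_pos (Θ := fun x => max (-x) 0) (by fun_prop)
    (fun x => le_max_right _ _) (fun x => by rw [← abs_neg x]; exact abs_max_zero_le _)
    (fun x y => by
      refine max_le ?_ (by positivity)
      have := le_max_left (-y) 0
      linarith [le_abs_self (y - x)])
    (fun n hn => by
      have := ((S.strong n hn).contraction_barenblatt S.dim_pos S.admissible ht S.C₁_pos
        one_pos).2
      simp_rw [hrw] at this
      exact this) (by
      filter_upwards [S.lower] with y hy
      refine max_eq_right ?_
      rw [neg_nonpos]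
      exact mul_nonneg (by linarith) (contrWeight_nonneg one_pos y))
  filter_upwards [key, ae_ne_zero S.dim_pos] with y h1 hy
  by_contra hlt
  have := mul_pos (sub_pos.2 (not_le.1 hlt)) (contrWeight_pos (β := β) (γ := γ) one_pos hy)
  have := le_max_left (-((u t y - barenblatt d m β γ C₁ T t y) * contrWeight d β γ 1 y)) 0
  linarith

theorem integral_ball_abs_sub_le {t : ℝ} (ht : ValidTime d m β γ T t) {r : ℝ} (hr : 0 < r) :
    ∫ y in Metric.ball 0 r, |u t y - barenblatt d m β γ C T t y| * ‖y‖ ^ (-γ) ≤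
      2 ^ (((d : ℝ) - 2 - β) / 2) * ∫ y, |f y| * ‖y‖ ^ (-γ) := by
  set ε : ℝ := (r ^ 2)⁻¹ with hεd
  have hε : 0 < ε := by positivity
  have hβ := S.admissible.beta_lt
  set q := ((d : ℝ) - 2 - β) / 2 with hq
  have hmul : ∀ (x : ℝ) (y : E d), |x * contrWeight d β γ ε y| = |x| * contrWeight d β γ ε y :=
    fun x y => by rw [abs_mul, abs_of_nonneg (contrWeight_nonneg hε y)]
  have key := S.integral_ball_le ht S.C_pos hε (Θ := fun x => |x|) continuous_abs abs_nonneg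
    (fun x => by rw [abs_abs]) (fun x y => by
      have := abs_sub_abs_le_abs_sub x y
      rw [abs_sub_comm y x]; linarith) (fun n hn => by
      have := (S.strong n hn).contraction_abs_barenblatt S.dim_pos S.admissible ht S.C_pos hε
      simp_rw [hmul]
      exact this) r
  have hi := (S.integrableOn_sub_barenblatt ht S.C_pos hε r).abs
  have e1 : ∫ y, |(u₀ y - barenblatt d m β γ C T 0 y) * contrWeight d β γ ε y| ≤
      ∫ y, |f y| * ‖y‖ ^ (-γ) := by
    refine integral_mono_of_nonneg (Eventually.of_forall fun y => abs_nonneg _) ?_ ?_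
    · refine S.memL1w.abs.congr (Eventually.of_forall fun y => ?_)
      simp only
      rw [abs_mul, abs_of_nonneg (a := ‖y‖ ^ (-γ)) (by positivity)]
    · filter_upwards [S.initial_eq] with y hy
      rw [hy, add_sub_cancel_left, abs_mul, abs_of_nonneg (contrWeight_nonneg hε y)]
      exact mul_le_mul_of_nonneg_left (contrWeight_le hβ hε y) (abs_nonneg _)
  have e2 : ∫ y in Metric.ball 0 r, |u t y - barenblatt d m β γ C T t y| * ‖y‖ ^ (-γ) ≤
      ∫ y in Metric.ball 0 r,
        2 ^ q * |(u t y - barenblatt d m β γ C T t y) * contrWeight d β γ ε y| := by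
    refine integral_mono_of_nonneg (Eventually.of_forall fun y => by positivity)
      (hi.const_mul _) ?_
    refine (ae_restrict_iff' measurableSet_ball).2 (Eventually.of_forall fun y hy => ?_)
    rw [mem_ball_zero_iff] at hy
    have hle : ε * ‖y‖ ^ 2 ≤ 1 := by
      rw [hεd, inv_mul_eq_div, div_le_one (by positivity)]
      exact pow_le_pow_left₀ (norm_nonneg y) hy.le 2
    have h1 := le_slowWeight hβ hε (by positivity : 0 ≤ ‖y‖ ^ 2) hle
    rw [← hq, Real.rpow_neg zero_le_two] at h1
    have h2 : (1 : ℝ) ≤ 2 ^ q * slowWeight d β ε (‖y‖ ^ 2) := by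
      have := mul_le_mul_of_nonneg_left h1 (by positivity : (0 : ℝ) ≤ 2 ^ q)
      rwa [mul_inv_cancel₀ (by positivity)] at this
    simp only
    rw [abs_mul, abs_of_nonneg (contrWeight_nonneg hε y), contrWeight, norm_rpow_eq_sq_rpow]
    have h3 : 0 ≤ |u t y - barenblatt d m β γ C T t y| * (‖y‖ ^ 2) ^ (-γ / 2) := by positivity
    calc _ ≤ _ := le_mul_of_one_le_right h3 h2
      _ = _ := by ring
  rw [integral_const_mul] at e2
  exact e2.trans (mul_le_mul_of_nonneg_left (key.trans e1) (by positivity))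

theorem memL1w_sub {t : ℝ} (ht : ValidTime d m β γ T t) :
    MemL1w γ (fun y => u t y - barenblatt d m β γ C T t y) ∧
      ∫ y, |u t y - barenblatt d m β γ C T t y| * ‖y‖ ^ (-γ) ≤
        2 ^ (((d : ℝ) - 2 - β) / 2) * ∫ y, |f y| * ‖y‖ ^ (-γ) := by
  have hcov : AECover (volume : Measure (E d)) atTop
      fun n : ℕ => Metric.ball (0 : E d) ((n : ℝ) + 1) :=
    aecover_ball (tendsto_atTop_add_const_right _ _ tendsto_natCast_atTop_atTop)
  have hloc : ∀ r : ℝ, IntegrableOn (fun y => (u t y - barenblatt d m β γ C T t y) * ‖y‖ ^ (-γ))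
      (Metric.ball 0 r) := by
    intro r
    simp_rw [sub_mul]
    refine (S.memL1wLoc t ht.nonneg r).sub ?_
    obtain ⟨M, hM0, hM⟩ := exists_barenblatt_le (d := d) S.admissible ht S.C_pos
    have hw : IntegrableOn (fun y : E d => ‖y‖ ^ (-γ)) (Metric.ball 0 r) := by
      have hfr : Module.finrank ℝ (E d) = d := by simp
      have : Nonempty (Fin d) := ⟨⟨0, S.dim_pos⟩⟩
      rcases le_or_gt r 0 with hr | hr
      · rw [Metric.ball_eq_empty.2 hr]; exact integrableOn_empty
      refine (integrableOn_fun_norm_addHaar (volume : Measure (E d))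
        (f := fun x : ℝ => x ^ (-γ))).2 ?_
      rw [hfr]
      refine ((intervalIntegral.integrableOn_Ioo_rpow_iff (s := (d : ℝ) - 1 + -γ) hr).2
        (by linarith [S.admissible.gamma_lt])).congr_fun ?_ measurableSet_Ioo
      intro x hx
      have hx0 : 0 < x := hx.1
      simp only [smul_eq_mul]
      rw [Real.rpow_add hx0, ← Real.rpow_natCast x (d - 1), Nat.cast_pred S.dim_pos]
    refine Integrable.bdd_mul (c := M) hw
      (continuous_barenblatt S.admissible ht S.C_pos).aestronglyMeasurable
      (Eventually.of_forall fun y => ?_)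
    rw [Real.norm_of_nonneg (barenblatt_nonneg S.admissible ht S.C_pos y)]
    exact hM t ⟨ht.nonneg, le_rfl⟩ y
  have hnorm : ∀ y, ‖(u t y - barenblatt d m β γ C T t y) * ‖y‖ ^ (-γ)‖ =
      |u t y - barenblatt d m β γ C T t y| * ‖y‖ ^ (-γ) := fun y => by
    rw [norm_mul, Real.norm_eq_abs, Real.norm_of_nonneg (by positivity)]
  have hb : ∀ n : ℕ, ∫ y in Metric.ball (0 : E d) ((n : ℝ) + 1),
      ‖(u t y - barenblatt d m β γ C T t y) * ‖y‖ ^ (-γ)‖ ≤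
      2 ^ (((d : ℝ) - 2 - β) / 2) * ∫ y, |f y| * ‖y‖ ^ (-γ) := fun n => by
    simp_rw [hnorm]
    exact S.integral_ball_abs_sub_le ht (by positivity)
  have hi : Integrable fun y => (u t y - barenblatt d m β γ C T t y) * ‖y‖ ^ (-γ) :=
    hcov.integrable_of_integral_norm_bounded _ (fun n => hloc _) (Eventually.of_forall hb)
  refine ⟨hi, ?_⟩
  have := le_of_tendsto' (hcov.integral_tendsto_of_countably_generated hi.norm) hb
  simp_rw [hnorm] at this
  exact this

end ApproximatedSolution


theorem abs_rpow_sub_rpow_le_rpow {a b m : ℝ} (ha : 0 ≤ a) (hb : 0 ≤ b) (hm : 0 ≤ m)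
    (hm1 : m ≤ 1) : |a ^ m - b ^ m| ≤ |a - b| ^ m := by
  have key : ∀ {x y : ℝ}, 0 ≤ y → y ≤ x → |x ^ m - y ^ m| ≤ |x - y| ^ m := by
    intro x y hy hxy
    have h1 := Real.rpow_add_le_add_rpow (sub_nonneg.2 hxy) hy hm hm1
    rw [sub_add_cancel] at h1
    rw [abs_of_nonneg (sub_nonneg.2 hxy),
      abs_of_nonneg (sub_nonneg.2 (Real.rpow_le_rpow hy hxy hm))]
    linarith
  rcases le_total b a with h | h
  · exact key hb h
  · rw [abs_sub_comm, abs_sub_comm a]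
    exact key ha h

theorem abs_rpow_sub_rpow_le_mul {a b m Λ : ℝ} (ha : 0 < a) (hb : 0 < b) (hm : 0 ≤ m)
    (hm1 : m ≤ 1) (haΛ : a ^ (m - 1) ≤ Λ) (hbΛ : b ^ (m - 1) ≤ Λ) :
    |a ^ m - b ^ m| ≤ Λ * |a - b| := by
  have key : ∀ {x y : ℝ}, 0 < y → y ≤ x → y ^ (m - 1) ≤ Λ → |x ^ m - y ^ m| ≤ Λ * |x - y| := by
    intro x y hy hxy hΛ
    have hx := hy.trans_le hxy
    rw [abs_of_nonneg (sub_nonneg.2 hxy),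
      abs_of_nonneg (sub_nonneg.2 (Real.rpow_le_rpow hy.le hxy hm))]
    have e : ∀ {z : ℝ}, 0 < z → z ^ m = z ^ (m - 1) * z := fun hz => by
      rw [← Real.rpow_add_one hz.ne']; congr 1; ring
    have h1 : x ^ (m - 1) ≤ y ^ (m - 1) := Real.rpow_le_rpow_of_nonpos hy hxy (by linarith)
    rw [e hx, e hy]
    nlinarith [mul_le_mul_of_nonneg_right h1 hx.le,
      mul_le_mul_of_nonneg_right hΛ (sub_nonneg.2 hxy)]
  rcases le_total b a with h | h
  · exact key hb h hbΛ
  · rw [abs_sub_comm, abs_sub_comm a]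
    exact key ha h haΛ

theorem rpow_le_mul_add {x m δ : ℝ} (hx : 0 ≤ x) (hδ : 0 < δ) (hm : 0 < m) (hm1 : m < 1) :
    x ^ m ≤ δ ^ (m - 1) * x + δ ^ m := by
  rcases le_or_gt x δ with h | h
  · have := Real.rpow_le_rpow hx h hm.le
    have : 0 ≤ δ ^ (m - 1) * x := by positivity
    linarith
  · have hx0 := hδ.trans h
    have h1 : x ^ (m - 1) ≤ δ ^ (m - 1) := Real.rpow_le_rpow_of_nonpos hδ h.le (by linarith)
    have e : x ^ m = x ^ (m - 1) * x := by
      rw [← Real.rpow_add_one hx0.ne']; congr 1; ring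
    have : 0 ≤ δ ^ m := by positivity
    rw [e]
    nlinarith [mul_le_mul_of_nonneg_right h1 hx]

theorem tendsto_integral_rpow_mul {X ι : Type*} [MeasurableSpace X] {μ : Measure X} {l : Filter ι}
    {q : ι → X → ℝ} {B : X → ℝ} {m : ℝ} (hm : 0 < m) (hm1 : m < 1) (hq : ∀ i x, 0 ≤ q i x)
    (hB : ∀ x, 0 ≤ B x) (hBi : Integrable B μ)
    (hqi : ∀ᶠ i in l, Integrable (fun x => q i x * B x) μ)
    (hl : Tendsto (fun i => ∫ x, q i x * B x ∂μ) l (𝓝 0)) :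
    Tendsto (fun i => ∫ x, q i x ^ m * B x ∂μ) l (𝓝 0) := by
  have hI : 0 ≤ ∫ x, B x ∂μ := integral_nonneg hB
  rw [tendsto_order]
  constructor
  · intro a ha
    exact Eventually.of_forall fun i => ha.trans_le
      (integral_nonneg fun x => mul_nonneg (Real.rpow_nonneg (hq i x) _) (hB x))
  · intro a ha
    have hδ : ∃ δ : ℝ, 0 < δ ∧ δ ^ m * ∫ x, B x ∂μ < a := by
      have h0 : Tendsto (fun δ : ℝ => δ ^ m * ∫ x, B x ∂μ) (𝓝[>] 0) (𝓝 0) := by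
        have := ((Real.continuousAt_rpow_const 0 m (Or.inr hm.le)).tendsto.mono_left
          (nhdsWithin_le_nhds (s := Ioi 0))).mul_const (∫ x, B x ∂μ)
        rwa [Real.zero_rpow hm.ne', zero_mul] at this
      obtain ⟨δ, h1, h2⟩ := ((h0.eventually_lt_const ha).and self_mem_nhdsWithin).exists
      exact ⟨δ, h2, h1⟩
    obtain ⟨δ, hδ0, hδ⟩ := hδ
    have h1 : Tendsto (fun i => δ ^ (m - 1) * (∫ x, q i x * B x ∂μ) + δ ^ m * ∫ x, B x ∂μ) l
        (𝓝 (δ ^ (m - 1) * 0 + δ ^ m * ∫ x, B x ∂μ)) :=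
      (hl.const_mul _).add_const _
    rw [mul_zero, zero_add] at h1
    filter_upwards [h1.eventually_lt_const hδ, hqi] with i h2 h3
    refine lt_of_le_of_lt ?_ h2
    rw [← integral_const_mul, ← integral_const_mul, ← integral_add (h3.const_mul _)
      (hBi.const_mul _)]
    refine integral_mono_of_nonneg
      (Eventually.of_forall fun x => mul_nonneg (Real.rpow_nonneg (hq i x) _) (hB x))
      ((h3.const_mul _).add (hBi.const_mul _)) (Eventually.of_forall fun x => ?_)
    have := mul_le_mul_of_nonneg_right (rpow_le_mul_add (hq i x) hδ0 hm hm1) (hB x)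
    simp only
    linarith

theorem IsProfile.radL {F : ℝ → ℝ} {a b : ℝ} (hF : IsProfile F a b) (d : ℕ) (β : ℝ) :
    IsProfile (radL d β F) a b := by
  have h1 : IsProfile (fun s => 4 * s * _root_.deriv (_root_.deriv F) s +
      2 * ((d : ℝ) - β) * _root_.deriv F s) a b := by
    refine ⟨?_, hF.pos, hF.lt, fun s hs => ?_⟩
    · exact ((contDiff_const.mul contDiff_id).mul hF.deriv.deriv.smooth).add
        (contDiff_const.mul hF.deriv.smooth)
    · rw [hF.deriv.zero s hs, hF.deriv.deriv.zero s hs]; ring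
  exact h1.rpow_mul (-β / 2)

theorem IsProfile.exists_weight_bound {k : ℝ → ℝ} {a b : ℝ} (hk : IsProfile k a b) (d : ℕ) (γ : ℝ) :
    ∃ N r, 0 ≤ N ∧ ∀ y : E d, |k (‖y‖ ^ 2)| ≤ N * (Metric.ball 0 r).indicator
      (fun y => ‖y‖ ^ (-γ)) y := by
  have hk' := hk.rpow_mul (γ / 2)
  obtain ⟨N, hN⟩ := (hk'.contDiff_comp d).continuous.bounded_above_of_compact_support
    (hk'.hasCompactSupport_comp d)
  have hN0 : 0 ≤ N := (norm_nonneg _).trans (hN 0)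
  obtain ⟨r, hr⟩ := (isCompact_annulus d a b).isBounded.subset_ball 0
  refine ⟨N, r, hN0, fun y => ?_⟩
  by_cases hy : y ∈ Metric.ball (0 : E d) r
  · rw [indicator_of_mem hy]
    have h1 := mul_weight_eq hk γ 1 y
    rw [one_mul, one_mul] at h1
    rw [h1, abs_mul, abs_of_nonneg (by positivity), mul_comm]
    exact mul_le_mul_of_nonneg_right (hN y) (by positivity)
  · rw [indicator_of_notMem hy, mul_zero, hk.zero _ fun h => hy (hr h), abs_zero]

theorem MemL1wLoc.integrable_mul_profile {d : ℕ} {γ : ℝ} {f : E d → ℝ}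
    (hf : MemL1wLoc γ f) {k : ℝ → ℝ} {a b : ℝ} (hk : IsProfile k a b) :
    Integrable fun y => f y * k (‖y‖ ^ 2) := by
  have hk' := hk.rpow_mul (γ / 2)
  obtain ⟨N, hN⟩ := (hk'.contDiff_comp d).continuous.bounded_above_of_compact_support
    (hk'.hasCompactSupport_comp d)
  obtain ⟨r, hr⟩ := (isCompact_annulus d a b).isBounded.subset_ball 0
  rw [← integrableOn_iff_integrable_of_support_subset (s := Metric.ball 0 r)]
  · refine (Integrable.mul_bdd (c := N) (hf r) (hk'.contDiff_comp d).continuous.aestronglyMeasurable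
      (Eventually.of_forall hN)).congr (Eventually.of_forall fun y => ?_)
    exact (mul_weight_eq hk γ _ y).symm
  · intro y hy
    by_contra hcon
    exact hy (by simp only [hk.zero _ fun h => hcon (hr h), mul_zero])

theorem TendstoL1wLoc.tendsto_integral_profile {d : ℕ} {γ : ℝ} {ι : Type*} {l : Filter ι}
    {V : ι → E d → ℝ} {f : E d → ℝ} (h : TendstoL1wLoc γ V l f)
    (hV : ∀ᶠ i in l, MemL1wLoc γ (V i)) (hf : MemL1wLoc γ f) {k : ℝ → ℝ} {a b : ℝ}
    (hk : IsProfile k a b) :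
    Tendsto (fun i => ∫ y, |V i y - f y| * |k (‖y‖ ^ 2)|) l (𝓝 0) := by
  obtain ⟨N, r, hN, hb⟩ := hk.exists_weight_bound d γ
  have h1 := (h r).const_mul N
  rw [mul_zero] at h1
  refine squeeze_zero' (Eventually.of_forall fun i => integral_nonneg fun y => by positivity) ?_ h1
  filter_upwards [hV] with i hi
  have hint : IntegrableOn (fun y => |V i y - f y| * ‖y‖ ^ (-γ)) (Metric.ball 0 r) := by
    refine ((hi r).sub (hf r)).abs.congr (Eventually.of_forall fun y => ?_)
    simp only [Pi.sub_apply]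
    rw [← sub_mul, abs_mul, abs_of_nonneg (a := ‖y‖ ^ (-γ)) (by positivity)]
  rw [← integral_const_mul, ← integral_indicator measurableSet_ball]
  refine integral_mono_of_nonneg (Eventually.of_forall fun y => by positivity)
    ((integrable_indicator_iff measurableSet_ball).2 (hint.const_mul N))
    (Eventually.of_forall fun y => ?_)
  have h2 := mul_le_mul_of_nonneg_left (hb y) (abs_nonneg (V i y - f y))
  refine h2.trans_eq ?_
  by_cases hy : y ∈ Metric.ball (0 : E d) r
  · simp only [indicator_of_mem hy]; ring
  · simp only [indicator_of_notMem hy]; ring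

theorem MemL1w.memL1wLoc {d : ℕ} {γ : ℝ} {f : E d → ℝ} (hf : MemL1w γ f) : MemL1wLoc γ f :=
  fun _ => hf.integrableOn

theorem integrable_bdd_mul_profile {d : ℕ} {f : E d → ℝ} {M : ℝ} (hf : AEStronglyMeasurable f)
    (hM : ∀ᵐ y, |f y| ≤ M) {k : ℝ → ℝ} {a b : ℝ} (hk : IsProfile k a b) :
    Integrable fun y => f y * k (‖y‖ ^ 2) :=
  Integrable.bdd_mul (c := M) ((hk.contDiff_comp d).continuous.integrable_of_hasCompactSupport
    (hk.hasCompactSupport_comp d)) hf hM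

namespace ApproximatedSolution

variable {d : ℕ} {m β γ T C₁ C₂ C : ℝ} {u₀ f : E d → ℝ} {u : ℝ → E d → ℝ}
  {φ : E d → ℝ} {v : ℕ → ℝ → E d → ℝ}

variable (S : ApproximatedSolution d m β γ T C₁ C₂ C u₀ f u φ v)
include S

theorem zero_eq : u 0 =ᵐ[volume] u₀ := by
  have hr : ∀ r : ℕ, ∀ᵐ y ∂(volume.restrict (Metric.ball (0 : E d) r)),
      |u₀ y - u 0 y| * ‖y‖ ^ (-γ) = 0 := by
    intro r
    have hev : ∀ᶠ n : ℕ in atTop, (fun y => |v n 0 y - u 0 y| * ‖y‖ ^ (-γ))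
        =ᵐ[volume.restrict (Metric.ball (0 : E d) r)] fun y => |u₀ y - u 0 y| * ‖y‖ ^ (-γ) := by
      filter_upwards [eventually_ge_atTop (r + 1)] with n hn
      have hn1 : 1 ≤ n := by omega
      rw [EventuallyEq, ae_restrict_iff' measurableSet_ball]
      filter_upwards [(S.strong n hn1).initial] with y hy hyr
      rw [mem_ball_zero_iff] at hyr
      have hn' : (r : ℝ) ≤ n := by exact_mod_cast (by omega : r ≤ n)
      have hpos : (0 : ℝ) < n := by exact_mod_cast (by omega : 0 < n)
      have : φ ((n : ℝ)⁻¹ • y) = 1 := by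
        refine S.truncation.eq_one _ ?_
        rw [norm_smul, norm_inv, Real.norm_of_nonneg hpos.le, inv_mul_eq_div, div_le_one hpos]
        linarith
      rw [hy, this, one_mul]
    have h1 := S.tendsto 0 le_rfl r
    have h2 : ∫ y in Metric.ball (0 : E d) r, |u₀ y - u 0 y| * ‖y‖ ^ (-γ) = 0 := by
      refine tendsto_nhds_unique (tendsto_const_nhds.congr' ?_) h1
      filter_upwards [hev] with n hn
      exact (integral_congr_ae hn).symm
    obtain ⟨n, hn, hn1⟩ := (hev.and (eventually_ge_atTop 1)).exists
    have hi : IntegrableOn (fun y => |u₀ y - u 0 y| * ‖y‖ ^ (-γ)) (Metric.ball 0 r) := by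
      refine Integrable.congr ?_ hn
      refine (((S.strong n hn1).memL1w 0 le_rfl).integrableOn.sub
        (S.memL1wLoc 0 le_rfl r)).abs.congr (Eventually.of_forall fun y => ?_)
      simp only [Pi.sub_apply]
      rw [← sub_mul, abs_mul, abs_of_nonneg (a := ‖y‖ ^ (-γ)) (by positivity)]
    exact (integral_eq_zero_iff_of_nonneg (fun y => by positivity) hi).1 h2
  have hall : ∀ᵐ y, |u₀ y - u 0 y| * ‖y‖ ^ (-γ) = 0 := by
    rw [← Measure.restrict_univ (μ := (volume : Measure (E d))), ← Metric.iUnion_ball_nat 0,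
      ae_restrict_iUnion_iff]
    exact hr
  filter_upwards [hall, ae_ne_zero S.dim_pos] with y h1 hy
  have hpos : 0 < ‖y‖ ^ (-γ) := Real.rpow_pos_of_pos (norm_pos_iff.2 hy) _
  rcases mul_eq_zero.1 h1 with h2 | h2
  · linarith [abs_eq_zero.1 h2]
  · exact absurd h2 hpos.ne'

theorem aestronglyMeasurable {t : ℝ} (ht : ValidTime d m β γ T t) : AEStronglyMeasurable (u t) := by
  have h1 := MemL1w.aestronglyMeasurable S.dim_pos (S.memL1w_sub ht).1
  have h2 := h1.add (continuous_barenblatt S.admissible ht S.C_pos).aestronglyMeasurable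
  refine h2.congr (Eventually.of_forall fun y => ?_)
  simp

theorem nonneg {t : ℝ} (ht : ValidTime d m β γ T t) : ∀ᵐ y, 0 ≤ u t y := by
  filter_upwards [S.barenblatt_le ht] with y hy
  exact (barenblatt_nonneg S.admissible ht S.C₁_pos y).trans hy

theorem tendsto_integral_sub_mul {t : ℝ} (ht : ValidTime d m β γ T t) {k : ℝ → ℝ} {a b : ℝ}
    (hk : IsProfile k a b) :
    Tendsto (fun n => ∫ y, (v n t y - barenblatt d m β γ C T t y) * k (‖y‖ ^ 2)) atTop
      (𝓝 (∫ y, (u t y - barenblatt d m β γ C T t y) * k (‖y‖ ^ 2))) := by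
  have hv : ∀ᶠ n : ℕ in atTop, MemL1wLoc γ (v n t) := by
    filter_upwards [eventually_ge_atTop 1] with n hn
    exact ((S.strong n hn).memL1w t ht.nonneg).memL1wLoc
  have hu := S.memL1wLoc t ht.nonneg
  have iU : Integrable fun y : E d => barenblatt d m β γ C T t y * k (‖y‖ ^ 2) :=
    hk.integrable_bdd_mul (continuous_barenblatt S.admissible ht S.C_pos)
  have iu : Integrable fun y => (u t y - barenblatt d m β γ C T t y) * k (‖y‖ ^ 2) := by
    simp_rw [sub_mul]
    exact (hu.integrable_mul_profile hk).sub iU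
  rw [tendsto_iff_norm_sub_tendsto_zero]
  refine squeeze_zero' (Eventually.of_forall fun n => norm_nonneg _) ?_
    ((S.tendsto t ht.nonneg).tendsto_integral_profile hv hu hk)
  filter_upwards [hv] with n hn
  have iv : Integrable fun y => (v n t y - barenblatt d m β γ C T t y) * k (‖y‖ ^ 2) := by
    simp_rw [sub_mul]
    exact (hn.integrable_mul_profile hk).sub iU
  rw [← integral_sub iv iu]
  refine (norm_integral_le_integral_norm _).trans_eq ?_
  congr 1; ext1 y
  rw [← sub_mul, norm_mul, sub_sub_sub_cancel_right, Real.norm_eq_abs, Real.norm_eq_abs]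

theorem tendsto_integral_rpow_sub_mul {t : ℝ} (ht : ValidTime d m β γ T t) {k : ℝ → ℝ} {a b : ℝ}
    (hk : IsProfile k a b) :
    Tendsto (fun n => ∫ y, (v n t y ^ m - barenblatt d m β γ C T t y ^ m) * k (‖y‖ ^ 2)) atTop
      (𝓝 (∫ y, (u t y ^ m - barenblatt d m β γ C T t y ^ m) * k (‖y‖ ^ 2))) := by
  have hm0 := S.admissible.m_pos
  have hm1 := S.admissible.m_lt_one
  have hv : ∀ᶠ n : ℕ in atTop, MemL1wLoc γ (v n t) := by
    filter_upwards [eventually_ge_atTop 1] with n hn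
    exact ((S.strong n hn).memL1w t ht.nonneg).memL1wLoc
  have hu := S.memL1wLoc t ht.nonneg
  have hcp : Continuous fun x : ℝ => x ^ m := Real.continuous_rpow_const hm0.le
  have iU : Integrable fun y : E d => barenblatt d m β γ C T t y ^ m * k (‖y‖ ^ 2) :=
    hk.integrable_bdd_mul (hcp.comp (continuous_barenblatt S.admissible ht S.C_pos))
  obtain ⟨M, -, hM⟩ := exists_barenblatt_le (d := d) S.admissible ht S.C₂_pos
  have hpow : ∀ {V : E d → ℝ}, AEStronglyMeasurable V →
      (∀ᵐ y, 0 ≤ V y) → (∀ᵐ y, V y ≤ barenblatt d m β γ C₂ T t y) →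
      Integrable fun y => V y ^ m * k (‖y‖ ^ 2) := by
    intro V h1 h2 h3
    refine integrable_bdd_mul_profile (M := M ^ m) (hcp.comp_aestronglyMeasurable h1) ?_ hk
    filter_upwards [h2, h3] with y e1 e2
    rw [abs_of_nonneg (by positivity)]
    exact Real.rpow_le_rpow e1 (e2.trans (hM t ⟨ht.nonneg, le_rfl⟩ y)) hm0.le
  have iu : Integrable fun y =>
      (u t y ^ m - barenblatt d m β γ C T t y ^ m) * k (‖y‖ ^ 2) := by
    simp_rw [sub_mul]
    exact (hpow (S.aestronglyMeasurable ht) (S.nonneg ht) (S.le_barenblatt ht)).sub iU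
  have hki : Integrable fun y : E d => |k (‖y‖ ^ 2)| :=
    ((hk.contDiff_comp d).continuous.integrable_of_hasCompactSupport
      (hk.hasCompactSupport_comp d)).abs
  have hqi : ∀ᶠ n in atTop, Integrable fun y => |v n t y - u t y| * |k (‖y‖ ^ 2)| := by
    filter_upwards [hv] with n hn
    refine ((hn.integrable_mul_profile hk).sub
      (hu.integrable_mul_profile hk)).abs.congr (Eventually.of_forall fun y => ?_)
    simp only [Pi.sub_apply]
    rw [← sub_mul, abs_mul]
  have hlim := tendsto_integral_rpow_mul hm0 hm1 (fun n y => abs_nonneg (v n t y - u t y))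
    (fun y => abs_nonneg (k (‖y‖ ^ 2))) hki hqi
    ((S.tendsto t ht.nonneg).tendsto_integral_profile hv hu hk)
  rw [tendsto_iff_norm_sub_tendsto_zero]
  refine squeeze_zero' (Eventually.of_forall fun n => norm_nonneg _) ?_ hlim
  filter_upwards [eventually_ge_atTop 1, hqi] with n hn hqn
  have hvm := ((S.strong n hn).memL1w t ht.nonneg).aestronglyMeasurable S.dim_pos
  have iv : Integrable fun y =>
      (v n t y ^ m - barenblatt d m β γ C T t y ^ m) * k (‖y‖ ^ 2) := by
    simp_rw [sub_mul]
    exact (hpow hvm ((S.strong n hn).nonneg t ht.nonneg) (S.approx_le ht hn)).sub iU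
  rw [← integral_sub iv iu]
  refine norm_integral_le_of_norm_le ?_ ?_
  · refine (hki.add hqn).mono' (((hcp.comp_aestronglyMeasurable
      (hvm.sub (S.aestronglyMeasurable ht)).norm)).mul hki.1) (Eventually.of_forall fun y => ?_)
    have h1 := rpow_le_mul_add (abs_nonneg (v n t y - u t y)) one_pos hm0 hm1
    rw [Real.one_rpow, Real.one_rpow, one_mul] at h1
    have h2 := mul_le_mul_of_nonneg_right h1 (abs_nonneg (k (‖y‖ ^ 2)))
    rw [Real.norm_of_nonneg (by positivity)]
    simp only [Pi.add_apply]
    linarith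
  · filter_upwards [(S.strong n hn).nonneg t ht.nonneg, S.nonneg ht] with y h1 h2
    rw [← sub_mul, norm_mul, sub_sub_sub_cancel_right, Real.norm_eq_abs, Real.norm_eq_abs]
    exact mul_le_mul_of_nonneg_right (abs_rpow_sub_rpow_le_rpow h1 h2 hm0.le hm1.le)
      (abs_nonneg _)

theorem balance {t : ℝ} (ht : ValidTime d m β γ T t) (ht0 : 0 < t) {F : ℝ → ℝ} {a b : ℝ}
    (hF : IsProfile F a b) (hF0 : ∀ s, 0 ≤ F s) :
    AEStronglyMeasurable (fun s => ∫ y, (u s y ^ m - barenblatt d m β γ C T s y ^ m) *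
      radL d β F (‖y‖ ^ 2)) (volume.restrict (Ioc 0 t)) ∧
    ∫ y, (u t y - barenblatt d m β γ C T t y) * ((‖y‖ ^ 2) ^ (-γ / 2) * F (‖y‖ ^ 2)) =
      (∫ y, (u 0 y - barenblatt d m β γ C T 0 y) * ((‖y‖ ^ 2) ^ (-γ / 2) * F (‖y‖ ^ 2))) +
      ∫ s in Ioc 0 t, (1 - m) / m * ∫ y, (u s y ^ m - barenblatt d m β γ C T s y ^ m) *
        radL d β F (‖y‖ ^ 2) := by
  have hp := S.admissible
  have hm0 := hp.m_pos
  have hc : 0 ≤ (1 - m) / m := div_nonneg (by linarith [hp.m_lt_one]) hm0.le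
  obtain ⟨g', G', hl'⟩ := exists_isLocalStrongSolution_barenblatt (d := d) hp ht ht0 S.C_pos
  have hR := hF.radL d β
  have hpt : ∀ᵐ s ∂(volume.restrict (Ioc 0 t)),
      Tendsto (fun n => ∫ y, (v n s y ^ m - barenblatt d m β γ C T s y ^ m) *
        radL d β F (‖y‖ ^ 2)) atTop
      (𝓝 (∫ y, (u s y ^ m - barenblatt d m β γ C T s y ^ m) * radL d β F (‖y‖ ^ 2))) := by
    filter_upwards [ae_restrict_mem measurableSet_Ioc] with s hs
    exact S.tendsto_integral_rpow_sub_mul (ht.mono (Ioc_subset_Icc_self hs)) hR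
  have hmeas : ∀ n, 1 ≤ n → AEStronglyMeasurable (fun s => ∫ y, (v n s y ^ m -
      barenblatt d m β γ C T s y ^ m) * radL d β F (‖y‖ ^ 2)) (volume.restrict (Ioc 0 t)) := by
    intro n hn
    obtain ⟨g, G, hl⟩ := (S.strong n hn).exists_isLocalStrongSolution hm0
    exact ((hl t).exists_flux_bound hm0 hl' hF (Θ := fun x => x) continuous_id
      (fun x => le_rfl)).1
  obtain ⟨M, -, hM⟩ := exists_barenblatt_le (d := d) hp ht S.C₂_pos
  obtain ⟨M', -, hM'⟩ := exists_barenblatt_le (d := d) hp ht S.C_pos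
  have hki : Integrable fun y : E d => |radL d β F (‖y‖ ^ 2)| :=
    ((hR.contDiff_comp d).continuous.integrable_of_hasCompactSupport
      (hR.hasCompactSupport_comp d)).abs
  have hbound : ∀ n, 1 ≤ n → ∀ s ∈ Ioc 0 t, ‖∫ y, (v n s y ^ m -
      barenblatt d m β γ C T s y ^ m) * radL d β F (‖y‖ ^ 2)‖ ≤
      ∫ y : E d, (M ^ m + M' ^ m) * |radL d β F (‖y‖ ^ 2)| := by
    intro n hn s hs
    have hs' := Ioc_subset_Icc_self hs
    refine norm_integral_le_of_norm_le (hki.const_mul _) ?_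
    filter_upwards [S.approx_le (ht.mono hs') hn, (S.strong n hn).nonneg s hs'.1] with y h1 h2
    rw [norm_mul, Real.norm_eq_abs, Real.norm_eq_abs]
    refine mul_le_mul_of_nonneg_right ?_ (abs_nonneg _)
    have b0 := barenblatt_nonneg hp (ht.mono hs') S.C_pos y
    have b1 := Real.rpow_le_rpow h2 (h1.trans (hM s hs' y)) hm0.le
    have b2 := Real.rpow_le_rpow b0 (hM' s hs' y) hm0.le
    have b3 : 0 ≤ v n s y ^ m := by positivity
    have b4 : 0 ≤ barenblatt d m β γ C T s y ^ m := by positivity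
    rw [abs_le]; constructor <;> linarith
  have l2 := tendsto_integral_filter_of_dominated_convergence
    (μ := volume.restrict (Ioc 0 t)) (l := atTop)
    (F := fun (n : ℕ) s => (1 - m) / m * ∫ y, (v n s y ^ m -
      barenblatt d m β γ C T s y ^ m) * radL d β F (‖y‖ ^ 2))
    (f := fun s => (1 - m) / m * ∫ y, (u s y ^ m -
      barenblatt d m β γ C T s y ^ m) * radL d β F (‖y‖ ^ 2))
    (fun _ => (1 - m) / m * ∫ y : E d, (M ^ m + M' ^ m) * |radL d β F (‖y‖ ^ 2)|)
    (by filter_upwards [eventually_ge_atTop 1] with n hn using (hmeas n hn).const_mul _)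
    (by
      filter_upwards [eventually_ge_atTop 1] with n hn
      filter_upwards [ae_restrict_mem measurableSet_Ioc] with s hs
      rw [norm_mul, Real.norm_of_nonneg hc]
      exact mul_le_mul_of_nonneg_left (hbound n hn s hs) hc)
    (integrable_const _) (hpt.mono fun s hs => hs.const_mul _)
  have l1 := S.tendsto_integral_sub_mul ht (hF.rpow_mul (-γ / 2))
  have l0 := S.tendsto_integral_sub_mul (validTime_zero ht) (hF.rpow_mul (-γ / 2))
  constructor
  · refine aestronglyMeasurable_of_tendsto_ae atTop (f := fun (n : ℕ) s => ∫ y, (v (n + 1) s y ^ m -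
      barenblatt d m β γ C T s y ^ m) * radL d β F (‖y‖ ^ 2)) (fun n => hmeas _ (by omega)) ?_
    filter_upwards [hpt] with s hs
    exact hs.comp (tendsto_add_atTop_nat 1)
  · refine tendsto_nhds_unique l1 ((l0.add l2).congr' ?_)
    filter_upwards [eventually_ge_atTop 1] with n hn
    obtain ⟨g, G, hl⟩ := (S.strong n hn).exists_isLocalStrongSolution hm0
    exact ((hl t).balance hm0 hp.m_lt_one hl' hF hF0 ht0).symm

theorem abs_flux_le {t : ℝ} (ht : ValidTime d m β γ T t) :
    ∃ A, 0 ≤ A ∧ ∀ s ∈ Icc 0 t, ∀ᵐ y, ‖y‖ ^ (-(β + 2)) *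
      |u s y ^ m - barenblatt d m β γ C T s y ^ m| ≤
      A * (radialBound d (β + 2) (d + 1) y +
        |u s y - barenblatt d m β γ C T s y| * ‖y‖ ^ (-γ)) := by
  have hp := S.admissible
  have hm0 := hp.m_pos
  have hσ := hp.sigma_pos
  obtain ⟨M, hM0, hM⟩ := exists_barenblatt_le (d := d) hp ht S.C₂_pos
  obtain ⟨M', hM0', hM'⟩ := exists_barenblatt_le (d := d) hp ht S.C_pos
  obtain ⟨K, hK, hb⟩ := exists_barenblatt_bounds (d := d) hp ht S.C_pos
  obtain ⟨K₁, hK₁, hb₁⟩ := exists_barenblatt_bounds (d := d) hp ht S.C₁_pos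
  refine ⟨max (M ^ m + M' ^ m) (2 * (K + K₁)), le_max_of_le_left (by positivity), fun s hs => ?_⟩
  have hv := ht.mono hs
  set A := max (M ^ m + M' ^ m) (2 * (K + K₁)) with hA
  have hA0 : 0 ≤ A := le_max_of_le_left (by positivity)
  filter_upwards [S.barenblatt_le hv, S.le_barenblatt hv, ae_ne_zero S.dim_pos] with y h1 h2 hy
  have hny : 0 < ‖y‖ := norm_pos_iff.2 hy
  have hpos : ∀ {C' : ℝ}, 0 < C' → 0 < barenblatt d m β γ C' T s y := fun hC' => by
    rw [barenblatt_eq hp hv hC']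
    exact Real.rpow_pos_of_pos (pressure_pos hC' (scaleR_pos hp hv) (by positivity)) _
  have u0 := (hpos S.C₁_pos).trans_le h1
  have U0 := hpos S.C_pos
  have hX : 0 ≤ |u s y - barenblatt d m β γ C T s y| * ‖y‖ ^ (-γ) := by positivity
  have hr := radialBound_nonneg d (β + 2) (d + 1) y
  by_cases hlt : ‖y‖ < 1
  · have c1 : |u s y ^ m - barenblatt d m β γ C T s y ^ m| ≤ A := by
      have b1 := Real.rpow_le_rpow u0.le (h2.trans (hM s hs y)) hm0.le
      have b2 := Real.rpow_le_rpow U0.le (hM' s hs y) hm0.le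
      have b3 : 0 ≤ u s y ^ m := by positivity
      have b4 : 0 ≤ barenblatt d m β γ C T s y ^ m := by positivity
      have := le_max_left (M ^ m + M' ^ m) (2 * (K + K₁))
      rw [abs_le]; constructor <;> linarith
    have e : radialBound d (β + 2) (d + 1) y = ‖y‖ ^ (-(β + 2)) := by
      rw [radialBound, if_pos hlt]
    rw [mul_add, e]
    have := mul_le_mul_of_nonneg_left c1 (by positivity : 0 ≤ ‖y‖ ^ (-(β + 2)))
    nlinarith [mul_nonneg hA0 hX]
  · have hge : 1 ≤ ‖y‖ := not_lt.1 hlt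
    have hσ1 : 1 ≤ ‖y‖ ^ (2 + β - γ) := Real.one_le_rpow hge hσ.le
    have d1 : u s y ^ (m - 1) ≤ A * ‖y‖ ^ (2 + β - γ) := by
      have := Real.rpow_le_rpow_of_nonpos (hpos S.C₁_pos) h1
        (by linarith [hp.m_lt_one] : m - 1 ≤ 0)
      have h3 := (hb₁ s hs y).2
      have := le_max_right (M ^ m + M' ^ m) (2 * (K + K₁))
      nlinarith
    have d2 : barenblatt d m β γ C T s y ^ (m - 1) ≤ A * ‖y‖ ^ (2 + β - γ) := by
      have h3 := (hb s hs y).2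
      have := le_max_right (M ^ m + M' ^ m) (2 * (K + K₁))
      nlinarith
    have d3 := abs_rpow_sub_rpow_le_mul u0 U0 hm0.le hp.m_lt_one.le d1 d2
    have e : ‖y‖ ^ (-(β + 2)) * ‖y‖ ^ (2 + β - γ) = ‖y‖ ^ (-γ) := by
      rw [← Real.rpow_add hny]; congr 1; ring
    have d4 := mul_le_mul_of_nonneg_left d3 (by positivity : 0 ≤ ‖y‖ ^ (-(β + 2)))
    have e2 : ‖y‖ ^ (-(β + 2)) * (A * ‖y‖ ^ (2 + β - γ) *
        |u s y - barenblatt d m β γ C T s y|) =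
        A * (|u s y - barenblatt d m β γ C T s y| * ‖y‖ ^ (-γ)) := by rw [← e]; ring
    rw [e2] at d4
    rw [mul_add]
    nlinarith [mul_nonneg hA0 hr]

theorem tendsto_integral_trunc {t : ℝ} (ht : ValidTime d m β γ T t) :
    Tendsto (fun k : ℕ => ∫ y, (u t y - barenblatt d m β γ C T t y) *
        ((‖y‖ ^ 2) ^ (-γ / 2) * (trunc k (‖y‖ ^ 2) * 1))) atTop
      (𝓝 (∫ y, (u t y - barenblatt d m β γ C T t y) * ‖y‖ ^ (-γ))) := by
  have hi := (S.memL1w_sub ht).1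
  have e : ∀ (k : ℕ) (y : E d), (u t y - barenblatt d m β γ C T t y) *
      ((‖y‖ ^ 2) ^ (-γ / 2) * (trunc k (‖y‖ ^ 2) * 1)) =
      trunc k (‖y‖ ^ 2) * ((u t y - barenblatt d m β γ C T t y) * ‖y‖ ^ (-γ)) := by
    intro k y
    rw [norm_rpow_eq_sq_rpow]; ring
  simp_rw [e]
  refine tendsto_integral_of_dominated_convergence _ (fun k => ?_) (Integrable.abs hi)
    (fun k => ?_) ?_
  · exact (((contDiff_trunc k).continuous.comp
      (by fun_prop : Continuous fun y : E d => ‖y‖ ^ 2)).aestronglyMeasurable).mul hi.1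
  · refine Eventually.of_forall fun y => ?_
    rw [norm_mul, Real.norm_of_nonneg (trunc_nonneg _ _), Real.norm_eq_abs]
    exact mul_le_of_le_one_left (abs_nonneg _) (trunc_le_one _ _)
  · filter_upwards [ae_ne_zero S.dim_pos] with y hy
    have hs : 0 < ‖y‖ ^ 2 := by positivity
    refine tendsto_const_nhds.congr' ?_
    filter_upwards [trunc_eventuallyEq_one hs] with k hk
    rw [hk.eq_of_nhds, one_mul]

/-- Conservation of the relative mass. -/
theorem integral_sub_eq {t : ℝ} (ht : ValidTime d m β γ T t) :
    ∫ y, (u t y - barenblatt d m β γ C T t y) * ‖y‖ ^ (-γ) =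
      ∫ y, (u 0 y - barenblatt d m β γ C T 0 y) * ‖y‖ ^ (-γ) := by
  rcases ht.nonneg.eq_or_lt with rfl | ht0
  · rfl
  have hp := S.admissible
  have hc : 0 ≤ (1 - m) / m := div_nonneg (by linarith [hp.m_lt_one]) hp.m_pos.le
  obtain ⟨N, hN, hrad⟩ := exists_abs_radL_trunc_mul_le isSlow_one d β zero_le_one
  obtain ⟨A, hA, hflux⟩ := S.abs_flux_le ht
  have hpr := fun k => isProfile_trunc_mul k (F := fun _ => (1 : ℝ)) fun _ _ => contDiffAt_const
  have hbal := fun k => S.balance ht ht0 (hpr k)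
    (fun s => mul_nonneg (trunc_nonneg k s) zero_le_one)
  have hir : Integrable (radialBound d (β + 2) (d + 1)) :=
    integrable_radialBound S.dim_pos (by linarith [hp.beta_lt]) (by linarith)
  set J := 2 ^ (((d : ℝ) - 2 - β) / 2) * ∫ y, |f y| * ‖y‖ ^ (-γ) with hJ
  have hdom : ∀ s ∈ Icc 0 t, ∀ k, ∀ᵐ y, ‖(u s y ^ m - barenblatt d m β γ C T s y ^ m) *
      radL d β (fun s => trunc k s * 1) (‖y‖ ^ 2)‖ ≤ N * (A * (radialBound d (β + 2) (d + 1) y +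
        |u s y - barenblatt d m β γ C T s y| * ‖y‖ ^ (-γ))) := by
    intro s hs k
    filter_upwards [hflux s hs, ae_ne_zero S.dim_pos] with y h1 hy
    have hsq : 0 < ‖y‖ ^ 2 := by positivity
    have h2 := hrad k _ hsq
    have e : (‖y‖ ^ 2) ^ (-β / 2 - 1) = ‖y‖ ^ (-(β + 2)) := by
      rw [norm_rpow_eq_sq_rpow]; congr 1; ring
    rw [mul_one, e] at h2
    rw [norm_mul, Real.norm_eq_abs, Real.norm_eq_abs, mul_comm]
    refine (mul_le_mul_of_nonneg_right h2 (abs_nonneg _)).trans ?_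
    rw [mul_assoc]
    exact mul_le_mul_of_nonneg_left h1 hN
  have hint : ∀ s ∈ Icc 0 t, Integrable (fun y => N * (A * (radialBound d (β + 2) (d + 1) y +
      |u s y - barenblatt d m β γ C T s y| * ‖y‖ ^ (-γ)))) ∧
      ∫ y, N * (A * (radialBound d (β + 2) (d + 1) y +
        |u s y - barenblatt d m β γ C T s y| * ‖y‖ ^ (-γ))) ≤
      N * (A * ((∫ y, radialBound d (β + 2) (d + 1) y) + J)) := by
    intro s hs
    obtain ⟨h1, h2⟩ := S.memL1w_sub (ht.mono hs)
    have h3 : Integrable fun y => |u s y - barenblatt d m β γ C T s y| * ‖y‖ ^ (-γ) := by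
      refine (Integrable.abs h1).congr (Eventually.of_forall fun y => ?_)
      simp only
      rw [abs_mul, abs_of_nonneg (a := ‖y‖ ^ (-γ)) (by positivity)]
    refine ⟨((hir.add h3).const_mul A).const_mul N, ?_⟩
    rw [integral_const_mul, integral_const_mul, integral_add hir h3]
    gcongr
  have l2 : Tendsto (fun k : ℕ => ∫ s in Ioc 0 t, (1 - m) / m *
      ∫ y, (u s y ^ m - barenblatt d m β γ C T s y ^ m) *
        radL d β (fun s => trunc k s * 1) (‖y‖ ^ 2)) atTop (𝓝 (∫ s in Ioc 0 t, (0 : ℝ))) := by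
    refine tendsto_integral_of_dominated_convergence
      (fun _ => (1 - m) / m * (N * (A * ((∫ y, radialBound d (β + 2) (d + 1) y) + J))))
      (fun k => (hbal k).1.const_mul _) (integrable_const _) (fun k => ?_) ?_
    · filter_upwards [ae_restrict_mem measurableSet_Ioc] with s hs
      have hs' := Ioc_subset_Icc_self hs
      rw [norm_mul, Real.norm_of_nonneg hc]
      exact mul_le_mul_of_nonneg_left
        ((norm_integral_le_of_norm_le (hint s hs').1 (hdom s hs' k)).trans (hint s hs').2) hc
    · filter_upwards [ae_restrict_mem measurableSet_Ioc] with s hs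
      have hs' := Ioc_subset_Icc_self hs
      have hv := ht.mono hs'
      have hcp : Continuous fun x : ℝ => x ^ m := Real.continuous_rpow_const hp.m_pos.le
      have h0 : Tendsto (fun k : ℕ => ∫ y, (u s y ^ m - barenblatt d m β γ C T s y ^ m) *
          radL d β (fun s => trunc k s * 1) (‖y‖ ^ 2)) atTop (𝓝 (∫ _ : E d, (0 : ℝ))) := by
        refine tendsto_integral_of_dominated_convergence _ (fun k => ?_) (hint s hs').1
          (fun k => hdom s hs' k) ?_
        · exact ((hcp.comp_aestronglyMeasurable (S.aestronglyMeasurable hv)).sub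
            (hcp.comp (continuous_barenblatt hp hv S.C_pos)).aestronglyMeasurable).mul
            (((hpr k).continuous_radL d β).comp
              (by fun_prop : Continuous fun y : E d => ‖y‖ ^ 2)).aestronglyMeasurable
        · filter_upwards [ae_ne_zero S.dim_pos] with y hy
          have hsq : 0 < ‖y‖ ^ 2 := by positivity
          refine tendsto_const_nhds.congr' ?_
          filter_upwards [radL_trunc_mul_eventually_eq d β (fun _ => 1) hsq] with k hk
          rw [hk, radL_one, mul_zero]
      rw [integral_zero] at h0
      simpa using h0.const_mul ((1 - m) / m)
  rw [integral_zero] at l2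
  have l0 := S.tendsto_integral_trunc (validTime_zero ht)
  have h := (l0.add l2).congr fun k => ((hbal k).2).symm
  rw [add_zero] at h
  exact tendsto_nhds_unique (S.tendsto_integral_trunc ht) h

end ApproximatedSolution

end WFD

theorem mainTheorem8 (d : ℕ) (hd : 2 ≤ d) (m β γ : ℝ) (hm₀ : 0 < m) (hm₁ : m < 1)
    (hγ : γ < d) (hβ : γ - 2 < β) (hβ' : β < ((d : ℝ) - 2) / d * γ)
    (T C₁ C₂ C : ℝ) (u₀ : WFD.E d → ℝ) (u : ℝ → WFD.E d → ℝ)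
    (h1 : WFD.H1 m β γ T C₁ C₂ u₀) (h2 : WFD.H2 m β γ T C₁ C₂ C u₀)
    (hu : WFD.IsSolution m β γ u₀ u)
    (τ : ℝ) (hτ : 0 ≤ τ) (hτT : m < WFD.mc d β γ → τ < T) :
    WFD.MemL1w γ (fun y => u τ y - WFD.barenblatt d m β γ C T τ y) ∧
      ∫ y, (u τ y - WFD.barenblatt d m β γ C T τ y) * ‖y‖ ^ (-γ) =
        ∫ y, (u₀ y - WFD.barenblatt d m β γ C T 0 y) * ‖y‖ ^ (-γ) := by
  obtain ⟨hT, hC₂, hC₂₁, hb⟩ := h1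
  obtain ⟨hC, f, hf, hf0⟩ := h2
  obtain ⟨φ, v, hφ, hv, hlim⟩ := hu.approximation
  have hd0 : (0 : ℝ) < d := by exact_mod_cast (by omega : 0 < d)
  have hd2 : (2 : ℝ) ≤ d := by exact_mod_cast hd
  have hβd : β < (d : ℝ) - 2 := by
    have h : ((d : ℝ) - 2) / d * γ ≤ ((d : ℝ) - 2) / d * d :=
      mul_le_mul_of_nonneg_left hγ.le (div_nonneg (by linarith) hd0.le)
    rw [div_mul_cancel₀ _ hd0.ne'] at h
    linarith
  have S : WFD.ApproximatedSolution d m β γ T C₁ C₂ C u₀ f u φ v :=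
    { dim_pos := by omega
      admissible := ⟨hm₀, hm₁, hγ, by linarith, hβd⟩
      C₁_pos := hC₂.trans hC₂₁
      C₂_pos := hC₂
      C_pos := hC₂.trans_le hC.1
      lower := hb.mono fun y h => h.1
      upper := hb.mono fun y h => h.2
      memL1w := hf
      initial_eq := hf0
      memL1wLoc := hu.isVeryWeakSolution.memL1wLoc
      truncation := hφ
      strong := hv
      tendsto := hlim }
  have ht : WFD.ValidTime d m β γ T τ := ⟨hτ, hT, hτT⟩
  refine ⟨(S.memL1w_sub ht).1, (S.integral_sub_eq ht).trans (integral_congr_ae ?_)⟩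
  filter_upwards [S.zero_eq] with y hy
  rw [hy]
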